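/- Let $r\in\mathbb{R}$ and $T>0$. Let $\mathscr{C}_r^T$ be the space of continuous functions $u:[0,T]\times[0,\infty)\to\mathbb{R}$ with $$\|u\|_{\mathscr{C}_r^T}:=\sup_{t\in[0,T]}\sup_{x\ge 0}e^{-rx}|u(t,x)|<\infty .$$ For $v\in\mathscr{C}_r^T$, a solution to the heat equation on $[0,\infty)$ with Dirichlet condition, obstacle $v$ and exponential growth $r$ is a pair $(z,\eta)$ such that (i) $z\in\mathscr{C}_r^T$, $z(t,0)=0$ for all $t\in[0,T]$, $z(0,x)=0$ for all $x\ge 0$, and $z\ge v$; (ii) $\eta$ is a (nonnegative Borel) measure on $(0,\infty)\times[0,T]$ for which every $\phi\in C_c^\infty([0,\infty))$ with $\phi(0)=0$, viewed as the function $(x,s)\mapsto\phi(x)$, is integrable; (iii) $\partial_t z=\partial_x^2 z+\eta$ weakly, i.e. for every $t\in[0,T]$ and every $\phi\in C_c^\infty([0,\infty))$ with $\phi(0)=0$, $$\int_0^\infty z(t,x)\phi(x)\,dx=\int_0^t\int_0^\infty z(s,x)\phi''(x)\,dx\,ds+\int_{(0,\infty)\times[0,t]}\phi(x)\,\eta(dx,ds);$$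 (iv) $\int_{(0,\infty)\times[0,t]}(z(s,x)-v(s,x))\,\eta(dx,ds)=0$ for every $t\in[0,T]$. Here $C_c^\infty([0,\infty))$ consists of the restrictions to $[0,\infty)$ of functions in $C_c^\infty(\mathbb{R})$. Then for every $v\in\mathscr{C}_r^T$ with $v(t,0)=0$ for all $t\in[0,T]$ and $v(0,x)\le 0$ for all $x\ge 0$, there exists a unique solution $(z,\eta)$. Moreover, there is a constant $C_{r,T}$, depending only on $r$ and $T$, such that whenever $v_1,v_2\in\mathscr{C}_r^T$ are two such obstacles and $(z_1,\eta_1),(z_2,\eta_2)$ are the corresponding solutions, $$\|z_1-z_2\|_{\mathscr{C}_r^T}\le C_{r,T}\,\|v_1-v_2\|_{\mathscr{C}_r^T}.$$ -/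

import Mathlib

open scoped ContDiff
open MeasureTheory

namespace ObstacleProblem

attribute [local instance] Measure.Subtype.measureSpace

/-- The space-time domain `[0,T] × [0,∞)`, with points `(t, x)`. -/
abbrev Domain (T : ℝ) : Type := Set.Icc (0 : ℝ) T × Set.Ici (0 : ℝ)

/-- The domain `(0,∞) × [0,T]` of the reflection measure, with points `(x, t)`. -/
abbrev ReflDomain (T : ℝ) : Type := Set.Ioi (0 : ℝ) × Set.Icc (0 : ℝ) T

/-- The point `(t, x)` of `[0,T] × [0,∞)` that corresponds to `(x, t)` in `(0,∞) × [0,T]`. -/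
def ReflDomain.toDomain {T : ℝ} (p : ReflDomain T) : Domain T :=
  (p.2, ⟨(p.1 : ℝ), Set.Ioi_subset_Ici_self p.1.2⟩)

/-- The space of continuous `u : [0,T] × [0,∞) → ℝ` such that
`e^{-rx} |u(t,x)|` is bounded over `t ∈ [0,T]` and `x ≥ 0`. -/
def CSpace (r T : ℝ) : Submodule ℝ C(Domain T, ℝ) where
  carrier := {u | ∃ M : ℝ, ∀ p : Domain T, Real.exp (-r * (p.2 : ℝ)) * |u p| ≤ M}
  zero_mem' := ⟨0, fun p => by simp⟩
  add_mem' := by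
    rintro u w ⟨M, hM⟩ ⟨N, hN⟩
    refine ⟨M + N, fun p => ?_⟩
    calc Real.exp (-r * (p.2 : ℝ)) * |(u + w) p|
        ≤ Real.exp (-r * (p.2 : ℝ)) * (|u p| + |w p|) := by
          gcongr
          exact abs_add_le _ _
      _ ≤ M + N := by
          rw [mul_add]
          exact add_le_add (hM p) (hN p)
  smul_mem' := by
    rintro c u ⟨M, hM⟩
    refine ⟨|c| * M, fun p => ?_⟩
    calc Real.exp (-r * (p.2 : ℝ)) * |(c • u) p|
        = |c| * (Real.exp (-r * (p.2 : ℝ)) * |u p|) := by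
          simp only [ContinuousMap.coe_smul, Pi.smul_apply, smul_eq_mul, abs_mul]
          ring
      _ ≤ |c| * M := mul_le_mul_of_nonneg_left (hM p) (abs_nonneg c)

/-- The norm `sup_{t ∈ [0,T]} sup_{x ≥ 0} e^{-rx} |u(t,x)|` of the space `CSpace r T`. -/
noncomputable def growthNorm {r T : ℝ} (u : CSpace r T) : ℝ :=
  ⨆ p : Domain T, Real.exp (-r * (p.2 : ℝ)) * |u.1 p|

/-- Admissible obstacles: `v(t,0) = 0` for all `t`, and `v(0,x) ≤ 0` for all `x`. -/
structure IsObstacle {r T : ℝ} (v : CSpace r T) : Prop where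
  boundary : ∀ (t : Set.Icc (0 : ℝ) T) (x : Set.Ici (0 : ℝ)), (x : ℝ) = 0 → v.1 (t, x) = 0
  initial : ∀ (t : Set.Icc (0 : ℝ) T) (x : Set.Ici (0 : ℝ)), (t : ℝ) = 0 → v.1 (t, x) ≤ 0

/-- Test functions: smooth and compactly supported on `[0,∞)` (restrictions to `[0,∞)` of smooth
compactly supported functions on the line), with `φ(0) = 0`. -/
structure IsTestFunction (φ : ℝ → ℝ) : Prop where
  smooth : ContDiff ℝ ∞ φ
  compactSupport : HasCompactSupport φ
  zero : φ 0 = 0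

/-- `(z, η)` satisfies the heat equation on `[0,∞)` with Dirichlet condition at `0`, zero initial
data and obstacle `v`, with `z` of exponential growth `r`. -/
structure IsSolution {r T : ℝ} (v z : CSpace r T) (η : Measure (ReflDomain T)) : Prop where
  boundary : ∀ (t : Set.Icc (0 : ℝ) T) (x : Set.Ici (0 : ℝ)), (x : ℝ) = 0 → z.1 (t, x) = 0
  initial : ∀ (t : Set.Icc (0 : ℝ) T) (x : Set.Ici (0 : ℝ)), (t : ℝ) = 0 → z.1 (t, x) = 0
  above : ∀ p : Domain T, v.1 p ≤ z.1 p
  /-- The integrals of test functions against `η` exist. -/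
  integrable : ∀ φ : ℝ → ℝ, IsTestFunction φ → Integrable (fun p : ReflDomain T => φ p.1) η
  /-- `∂z/∂t = ∂²z/∂x² + η` in the weak sense. -/
  weak : ∀ (t : Set.Icc (0 : ℝ) T) (φ : ℝ → ℝ), IsTestFunction φ →
    ∫ x : Set.Ici (0 : ℝ), z.1 (t, x) * φ x =
      (∫ s in Set.Iic t, ∫ x : Set.Ici (0 : ℝ), z.1 (s, x) * iteratedDeriv 2 φ x) +
        ∫ p in {p : ReflDomain T | p.2 ≤ t}, φ p.1 ∂η
  /-- `∫₀ᵗ ∫₀^∞ (z - v) dη = 0`, as the Lebesgue integral of a nonnegative function. -/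
  contact : ∀ t : Set.Icc (0 : ℝ) T,
    ∫⁻ p in {p : ReflDomain T | p.2 ≤ t}, ENNReal.ofReal (z.1 p.toDomain - v.1 p.toDomain) ∂η = 0

end ObstacleProblem

/-!
The comparison estimate rests on a maximum principle. If `v₁ ≤ v₂ + ε e^{rx}`, then
`z₁ ≤ z₂ + ε e^{rx + r²t}`, because the added function solves the heat equation and, wherever the
inequality fails, `z₁ > z₂ + ε e^{rx} ≥ v₁`, so that `η₁` has no mass there and `z₁ - z₂` is a weak
subsolution. Growth at infinity is absorbed by a small multiple of a faster exponential, and a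
continuous weak subsolution is compared with a strict classical supersolution by mollifying in
space only (`no_interior_max`). This is `IsSolution.le_add_exp`; it gives the Lipschitz bound with
the constant `e^{r²T}` and the uniqueness of `z`. The weak equation then expresses `∫ φ dη` over
`[0,t]` through `z` alone, which determines `η` (`IsSolution.measure_unique`).

For existence, the obstacle problem is discretized by a random walk with space step `δ` and time
step `δ²/2`: the values are averaged along the walk and then raised to the obstacle (`scheme`). The
same comparison argument, now elementary, transfers the modulus of continuity of `v` to the scheme
uniformly in `δ`, up to an error of order `δ` (`abs_scheme_sub_le`). Hence along an ultrafilter the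
scheme converges, locally uniformly, to a function `z` of the required class (`exists_limit`,
`eventually_abs_scheme_sub_le`).

The amounts by which the obstacle raises the scheme (`push`) form nonnegative measures. Summation by
parts and the consistency of the walk with `∂²/∂x²` show that their integrals of test functions
supported away from `0` converge to the value prescribed by the weak equation for `z`
(`tendsto_pushMass`). So they are locally bounded, and their limit along the ultrafilter is a
positive functional on compactly supported functions, that is, a measure `η`
(`exists_limit_measure`). Since the scheme is raised only where it equals the obstacle, `η` is
carried by the contact set (`integral_mul_gap_nonpos`). Test functions that vanish at `0` but not
near it are truncated near `0`: for `φ(0) = 0` the error of the truncation in `∫ φ'' z` is at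
most a constant times the supremum of `|z|` near the boundary (`tendsto_weakMass_truncate`), which
yields both the integrability of `φ` and the weak equation.
-/

namespace ObstacleProblem

attribute [local instance] Measure.Subtype.measureSpace

open Set Filter Topology
open scoped CompactlySupported

variable {r T : ℝ}

/-! ### Functions on the domain, extended to the plane -/

/-- The extension of `u ∈ CSpace r T` to the whole plane, by projecting the time onto `[0,T]` and
the position onto `[0,∞)`. -/
noncomputable def extend (hT : 0 ≤ T) (u : CSpace r T) (t x : ℝ) : ℝ :=
  u.1 (projIcc 0 T hT t, projIci 0 x)

theorem continuous_extend (hT : 0 ≤ T) (u : CSpace r T) :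
    Continuous fun p : ℝ × ℝ => extend hT u p.1 p.2 := by
  unfold extend
  refine u.1.continuous.comp (Continuous.prodMk ?_ ?_)
  · exact continuous_projIcc.comp continuous_fst
  · exact Continuous.subtype_mk (continuous_const.max continuous_snd) _

theorem extend_of_mem (hT : 0 ≤ T) (u : CSpace r T) {t x : ℝ} (ht : t ∈ Icc 0 T) (hx : 0 ≤ x) :
    extend hT u t x = u.1 (⟨t, ht⟩, ⟨x, hx⟩) := by
  unfold extend
  rw [projIcc_of_mem hT ht, projIci_of_mem hx]

theorem extend_coe (hT : 0 ≤ T) (u : CSpace r T) (p : Domain T) :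
    extend hT u p.1 p.2 = u.1 p := by
  rw [extend_of_mem hT u p.1.2 p.2.2]

theorem extend_sub (hT : 0 ≤ T) (u w : CSpace r T) (t x : ℝ) :
    extend hT (u - w) t x = extend hT u t x - extend hT w t x := rfl

theorem exists_extend_bound (hT : 0 ≤ T) (u : CSpace r T) :
    ∃ M, 0 ≤ M ∧ ∀ t x, 0 ≤ x → |extend hT u t x| ≤ M * Real.exp (r * x) := by
  obtain ⟨M, hM⟩ := u.2
  refine ⟨|M|, abs_nonneg _, fun t x hx => ?_⟩
  have h := (hM (projIcc 0 T hT t, projIci 0 x)).trans (le_abs_self M)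
  rw [projIci_of_mem hx] at h
  calc |extend hT u t x|
      = (Real.exp (-r * x) * |extend hT u t x|) * Real.exp (r * x) := by
        rw [mul_right_comm, ← Real.exp_add]; simp
    _ ≤ |M| * Real.exp (r * x) := by
        gcongr
        rwa [extend, projIci_of_mem hx]

/-- Continuity and the growth bound are only needed on the domain. -/
theorem exists_cspace_eq (f : ℝ → ℝ → ℝ)
    (hf : ContinuousOn (fun p : ℝ × ℝ => f p.1 p.2) (Icc 0 T ×ˢ Ici 0)) {M : ℝ}
    (hM : ∀ t ∈ Icc 0 T, ∀ x, 0 ≤ x → |f t x| ≤ M * Real.exp (r * x)) :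
    ∃ u : CSpace r T, ∀ p : Domain T, u.1 p = f p.1 p.2 := by
  refine ⟨⟨⟨fun p => f p.1 p.2, ?_⟩, M, fun p => ?_⟩, fun p => rfl⟩
  · refine hf.comp_continuous (f := fun p : Domain T => ((p.1 : ℝ), (p.2 : ℝ))) (by fun_prop) ?_
    exact fun p => ⟨p.1.2, p.2.2⟩
  · have := hM p.1 p.1.2 p.2 p.2.2
    calc Real.exp (-r * (p.2 : ℝ)) * |f p.1 p.2|
        ≤ Real.exp (-r * (p.2 : ℝ)) * (M * Real.exp (r * p.2)) := by gcongr
      _ = M := by rw [mul_left_comm, ← Real.exp_add]; simp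

theorem IsObstacle.extend_eq_zero {v : CSpace r T} (hv : IsObstacle v) (hT : 0 ≤ T) (t : ℝ) {x : ℝ}
    (hx : x ≤ 0) : extend hT v t x = 0 :=
  hv.boundary _ _ (by simpa [projIci] using hx)

theorem IsObstacle.extend_nonpos {v : CSpace r T} (hv : IsObstacle v) (hT : 0 ≤ T) {t : ℝ}
    (ht : t ≤ 0) (x : ℝ) : extend hT v t x ≤ 0 :=
  hv.initial _ _ (by rw [projIcc_of_le_left hT ht])

theorem growthNorm_bddAbove (u : CSpace r T) :
    BddAbove (range fun p : Domain T => Real.exp (-r * (p.2 : ℝ)) * |u.1 p|) := by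
  obtain ⟨M, hM⟩ := u.2
  exact ⟨M, by rintro _ ⟨p, rfl⟩; exact hM p⟩

theorem abs_le_growthNorm (u : CSpace r T) (p : Domain T) :
    |u.1 p| ≤ growthNorm u * Real.exp (r * p.2) := by
  have h : Real.exp (-r * (p.2 : ℝ)) * |u.1 p| ≤ growthNorm u := le_ciSup (growthNorm_bddAbove u) p
  calc |u.1 p| = (Real.exp (-r * (p.2 : ℝ)) * |u.1 p|) * Real.exp (r * p.2) := by
        rw [mul_right_comm, ← Real.exp_add]; simp
    _ ≤ _ := by gcongr

theorem growthNorm_nonneg (u : CSpace r T) : 0 ≤ growthNorm u :=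
  Real.iSup_nonneg fun _ => by positivity

/-- An integral over the time interval `[0,t] ⊆ [0,T]`, written over the subtype, as an interval
integral. -/
theorem integral_Iic_subtype (t : Icc (0 : ℝ) T) (g : ℝ → ℝ) :
    ∫ s in Iic t, g s = ∫ s in (0 : ℝ)..t, g s := by
  have he : MeasurableEmbedding (Subtype.val : Icc (0 : ℝ) T → ℝ) :=
    MeasurableEmbedding.subtype_coe measurableSet_Icc
  have h1 := he.setIntegral_map (μ := (volume : Measure (Icc (0 : ℝ) T))) g (Iic (t : ℝ))
  have h2 : Measure.map (Subtype.val : Icc (0 : ℝ) T → ℝ) volume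
      = volume.restrict (Icc (0 : ℝ) T) := map_comap_subtype_coe measurableSet_Icc volume
  rw [h2, Measure.restrict_restrict measurableSet_Iic] at h1
  have h3 : Iic (t : ℝ) ∩ Icc 0 T = Icc 0 (t : ℝ) := by
    ext s
    simp only [mem_inter_iff, mem_Iic, mem_Icc]
    exact ⟨fun h => ⟨h.2.1, h.1⟩, fun h => ⟨h.2, h.1, h.2.trans t.2.2⟩⟩
  rw [h3] at h1
  rw [intervalIntegral.integral_of_le t.2.1, ← integral_Icc_eq_integral_Ioc, h1]
  rfl

theorem integral_Ici_subtype (g : ℝ → ℝ) :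
    ∫ x : Ici (0 : ℝ), g x = ∫ x in Ioi (0 : ℝ), g x := by
  rw [← integral_Ici_eq_integral_Ioi]
  exact integral_subtype measurableSet_Ici g

/-- The weak heat equation in terms of the extension to the plane. -/
theorem weak_iff_extend (hT : 0 ≤ T) (z : CSpace r T) (η : Measure (ReflDomain T)) (φ : ℝ → ℝ)
    (t : Icc (0 : ℝ) T) :
    (∫ x : Ici (0 : ℝ), z.1 (t, x) * φ x =
      (∫ s in Iic t, ∫ x : Ici (0 : ℝ), z.1 (s, x) * iteratedDeriv 2 φ x) +
        ∫ p in {p : ReflDomain T | p.2 ≤ t}, φ p.1 ∂η) ↔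
    (∫ x in Ioi (0 : ℝ), extend hT z t x * φ x =
      (∫ s in (0 : ℝ)..t, ∫ x in Ioi (0 : ℝ), extend hT z s x * iteratedDeriv 2 φ x) +
        ∫ p in {p : ReflDomain T | p.2 ≤ t}, φ p.1 ∂η) := by
  have h (s : Icc (0 : ℝ) T) (ψ : ℝ → ℝ) :
      ∫ x : Ici (0 : ℝ), z.1 (s, x) * ψ x = ∫ x in Ioi (0 : ℝ), extend hT z s x * ψ x := by
    rw [← integral_Ici_subtype fun x => extend hT z s x * ψ x]
    exact integral_congr_ae (Eventually.of_forall fun x => by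
      simp only [← extend_coe hT z (s, x)])
  simp only [h]
  rw [← integral_Iic_subtype t fun s => ∫ x in Ioi (0 : ℝ), extend hT z s x * iteratedDeriv 2 φ x]

/-! ### A maximum principle for continuous weak subsolutions -/

theorem second_deriv_nonpos_of_isLocalMax {g g₁ : ℝ → ℝ} {g₂ x₀ : ℝ}
    (h₁ : ∀ x, HasDerivAt g (g₁ x) x) (h₂ : HasDerivAt g₁ g₂ x₀) (hmax : IsLocalMax g x₀) :
    g₂ ≤ 0 := by
  by_contra! hpos
  have e₁ : deriv g = g₁ := funext fun x => (h₁ x).deriv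
  have e₂ : deriv (deriv g) x₀ = g₂ := by rw [e₁]; exact h₂.deriv
  have hmin : IsLocalMin g x₀ :=
    isLocalMin_of_deriv_deriv_pos (by rwa [e₂]) hmax.deriv_eq_zero (h₁ x₀).continuousAt
  have hconst : g =ᶠ[𝓝 x₀] fun _ => g x₀ := by
    filter_upwards [hmax, hmin] with x h h' using le_antisymm h h'
  have h0 : deriv (deriv g) x₀ = 0 := by
    have := hconst.deriv.deriv.eq_of_nhds
    simpa using this
  linarith

theorem deriv_nonneg_of_left_max {H : ℝ → ℝ} {h t₁ : ℝ} (hH : HasDerivAt H h t₁)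
    (hmax : ∀ᶠ s in 𝓝[<] t₁, H s ≤ H t₁) : 0 ≤ h := by
  have h1 : Tendsto (slope H t₁) (𝓝[<] t₁) (𝓝 h) :=
    (hasDerivAt_iff_tendsto_slope.1 hH).mono_left
      (nhdsWithin_mono _ fun s (hs : s < t₁) => hs.ne)
  refine ge_of_tendsto h1 ?_
  filter_upwards [hmax, self_mem_nhdsWithin] with s hs (hlt : s < t₁)
  rw [slope_def_field]
  exact div_nonneg_of_nonpos (by linarith) (by linarith)

theorem hasDerivAt_integral_mul_comp_sub {f w : ℝ → ℝ} (hf : Continuous f)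
    (hw : ContDiff ℝ 1 w) (hc : HasCompactSupport w) (x : ℝ) :
    HasDerivAt (fun x => ∫ y, f y * w (x - y)) (∫ y, f y * deriv w (x - y)) x :=
  hc.hasDerivAt_convolution_right (ContinuousLinearMap.mul ℝ ℝ) (μ := volume)
    hf.locallyIntegrable hw x

theorem continuous_integral_mul_comp_sub {u : ℝ → ℝ → ℝ} {w : ℝ → ℝ}
    (hu : Continuous fun p : ℝ × ℝ => u p.1 p.2) (hw : Continuous w) (hc : HasCompactSupport w) :
    Continuous fun p : ℝ × ℝ => ∫ y, u p.1 y * w (p.2 - y) := by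
  have h (p : ℝ × ℝ) : ∫ y, u p.1 y * w (p.2 - y) = ∫ y in tsupport w, u p.1 (p.2 - y) * w y := by
    rw [setIntegral_eq_integral_of_forall_compl_eq_zero fun y hy => by
      rw [image_eq_zero_of_notMem_tsupport hy, mul_zero],
      ← integral_sub_left_eq_self _ volume p.2]
    simp
  simp only [h]
  refine continuous_parametric_integral_of_continuous
    (f := fun (p : ℝ × ℝ) (y : ℝ) => u p.1 (p.2 - y) * w y) ?_ hc
  refine Continuous.mul ?_ (by fun_prop)
  exact hu.comp (f := fun q : (ℝ × ℝ) × ℝ => (q.1.1, q.1.2 - q.2)) (by fun_prop)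

theorem reflect_of_support_subset_ball {w : ℝ → ℝ} {ρ x₁ : ℝ} (hw : ContDiff ℝ ∞ w)
    (hρ : Function.support w ⊆ Metric.ball 0 ρ) :
    ContDiff ℝ ∞ (fun y => w (x₁ - y)) ∧ HasCompactSupport (fun y => w (x₁ - y)) ∧
      tsupport (fun y => w (x₁ - y)) ⊆ Icc (x₁ - ρ) (x₁ + ρ) := by
  have h : tsupport (fun y => w (x₁ - y)) ⊆ Icc (x₁ - ρ) (x₁ + ρ) := by
    refine closure_minimal (fun y hy => ?_) isClosed_Icc
    have := hρ (show x₁ - y ∈ Function.support w from hy)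
    rw [Metric.mem_ball, dist_zero_right, Real.norm_eq_abs, abs_lt] at this
    constructor <;> linarith
  exact ⟨by fun_prop, isCompact_Icc.of_isClosed_subset (isClosed_tsupport _) h, h⟩

/-- A continuous weak subsolution `u` of the heat equation, on a box that reaches back in time from
`t₀`, cannot exceed a strict classical supersolution `B` by more at `(t₀, x₀)` than on the parabolic
boundary of the box. A mollification of `u` in space only is smooth enough for the derivative tests
at a maximum over the box, in space and backwards in time. -/
theorem no_interior_max {u B Bt Bx Bxx : ℝ → ℝ → ℝ} {t₀ x₀ d m : ℝ}
    (hu : Continuous fun p : ℝ × ℝ => u p.1 p.2) (hB : Continuous fun p : ℝ × ℝ => B p.1 p.2)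
    (hBt : ∀ t x, HasDerivAt (fun t => B t x) (Bt t x) t)
    (hBx : ∀ t x, HasDerivAt (B t) (Bx t x) x)
    (hBxx : ∀ t x, HasDerivAt (Bx t) (Bxx t x) x) (hd : 0 < d)
    (hsub : ∀ φ : ℝ → ℝ, ContDiff ℝ ∞ φ → HasCompactSupport φ → (∀ x, 0 ≤ φ x) →
      tsupport φ ⊆ Icc (x₀ - 2 * d) (x₀ + 2 * d) → ∀ s t, t₀ - d ≤ s → s ≤ t → t ≤ t₀ →
      (∫ x, u t x * φ x) - ∫ x, u s x * φ x ≤ ∫ τ in s..t, ∫ x, u τ x * iteratedDeriv 2 φ x)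
    (hstrict : ∀ t ∈ Icc (t₀ - d) t₀, ∀ x ∈ Icc (x₀ - d) (x₀ + d), Bxx t x < Bt t x)
    (hside : ∀ t ∈ Icc (t₀ - d) t₀, ∀ x ∈ Icc (x₀ - d) (x₀ + d),
      (t = t₀ - d ∨ x = x₀ - d ∨ x = x₀ + d) → u t x - B t x ≤ m)
    (hm : m < u t₀ x₀ - B t₀ x₀) : False := by
  obtain ⟨e, he, hem⟩ : ∃ e > 0, m + 4 * e = u t₀ x₀ - B t₀ x₀ :=
    ⟨(u t₀ x₀ - B t₀ x₀ - m) / 4, by linarith, by ring⟩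
  -- The mollification scale.
  have hK : IsCompact (Icc (t₀ - d) t₀ ×ˢ Icc (x₀ - 2 * d) (x₀ + 2 * d)) :=
    isCompact_Icc.prod isCompact_Icc
  obtain ⟨ρ, hρ, hρu⟩ := Metric.uniformContinuousOn_iff_le.1
    (hK.uniformContinuousOn_of_continuous hu.continuousOn) e he
  have hmin : 0 < min ρ d := lt_min hρ hd
  let b : ContDiffBump (0 : ℝ) := ⟨min ρ d / 2, min ρ d, by positivity, by linarith⟩
  set w : ℝ → ℝ := b.normed volume with hw_def
  have hw : ContDiff ℝ ∞ w := b.contDiff_normed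
  have hwc : HasCompactSupport w := b.hasCompactSupport_normed
  have hws : Function.support w ⊆ Metric.ball 0 (min ρ d) := b.support_normed_eq.subset
  have hut (t : ℝ) : Continuous (u t) := hu.comp (by fun_prop : Continuous fun x : ℝ => (t, x))
  set U : ℝ → ℝ → ℝ := fun t x => ∫ y, u t y * w (x - y) with hU
  have hUcont : Continuous fun p : ℝ × ℝ => U p.1 p.2 :=
    continuous_integral_mul_comp_sub hu hw.continuous hwc
  have hUu : ∀ t ∈ Icc (t₀ - d) t₀, ∀ x ∈ Icc (x₀ - d) (x₀ + d), |U t x - u t x| ≤ e := by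
    intro t ht x hx
    have h1 := b.dist_normed_convolution_le (μ := volume) (g := u t) (x₀ := x) (ε := e)
      (hut t).aestronglyMeasurable (fun y hy => ?_)
    · rw [convolution_lsmul_swap, Real.dist_eq] at h1
      convert h1 using 4
      ext y
      rw [smul_eq_mul, mul_comm]
    · have hy' : |y - x| < min ρ d := Metric.mem_ball.1 hy
      have hy2 := abs_lt.1 (hy'.trans_le (min_le_right _ _))
      have := hρu (t, y) ⟨ht, by constructor <;> linarith [hx.1, hx.2]⟩ (t, x)
        ⟨ht, by constructor <;> linarith [hx.1, hx.2]⟩ ?_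
      · simpa using this
      · rw [Prod.dist_eq, dist_self, Real.dist_eq]
        exact max_le hρ.le (hy'.le.trans (min_le_left _ _))
  -- The maximum of the mollified difference over the box.
  have hbox : IsCompact (Icc (t₀ - d) t₀ ×ˢ Icc (x₀ - d) (x₀ + d)) :=
    isCompact_Icc.prod isCompact_Icc
  have h0 : (t₀, x₀) ∈ Icc (t₀ - d) t₀ ×ˢ Icc (x₀ - d) (x₀ + d) :=
    ⟨⟨by linarith, le_rfl⟩, by linarith, by linarith⟩
  obtain ⟨⟨t₁, x₁⟩, ⟨ht₁, hx₁⟩, hmax⟩ := hbox.exists_isMaxOn ⟨_, h0⟩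
    (hUcont.sub hB).continuousOn
  simp only at ht₁ hx₁
  have hmax' : ∀ t ∈ Icc (t₀ - d) t₀, ∀ x ∈ Icc (x₀ - d) (x₀ + d),
      U t x - B t x ≤ U t₁ x₁ - B t₁ x₁ := fun t ht x hx => hmax (show (t, x) ∈ _ from ⟨ht, hx⟩)
  have hnot : ¬ (t₁ = t₀ - d ∨ x₁ = x₀ - d ∨ x₁ = x₀ + d) := by
    intro hor
    have h1 := hside t₁ ht₁ x₁ hx₁ hor
    have h2 := hmax' t₀ h0.1 x₀ h0.2
    have h3 := abs_le.1 (hUu t₀ h0.1 x₀ h0.2)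
    have h4 := abs_le.1 (hUu t₁ ht₁ x₁ hx₁)
    linarith [h3.1, h4.2]
  push Not at hnot
  have ht₁' : t₀ - d < t₁ := lt_of_le_of_ne ht₁.1 (Ne.symm hnot.1)
  have hx₁l : x₀ - d < x₁ := lt_of_le_of_ne hx₁.1 (Ne.symm hnot.2.1)
  have hx₁r : x₁ < x₀ + d := lt_of_le_of_ne hx₁.2 hnot.2.2
  have hw1 : ContDiff ℝ ∞ (deriv w) := ((contDiff_infty_iff_deriv (f := w)).1 hw).2
  have hw2 : ContDiff ℝ ∞ (deriv (deriv w)) := ((contDiff_infty_iff_deriv (f := deriv w)).1 hw1).2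
  -- The derivative test in space.
  have hxx : (∫ y, u t₁ y * deriv (deriv w) (x₁ - y)) - Bxx t₁ x₁ ≤ 0 := by
    refine second_deriv_nonpos_of_isLocalMax (g := fun x => U t₁ x - B t₁ x)
      (g₁ := fun x => (∫ y, u t₁ y * deriv w (x - y)) - Bx t₁ x) (x₀ := x₁) (fun x => ?_) ?_ ?_
    · exact (hasDerivAt_integral_mul_comp_sub (hut t₁) (hw.of_le (by simp)) hwc x).sub (hBx t₁ x)
    · exact (hasDerivAt_integral_mul_comp_sub (hut t₁) (hw1.of_le (by simp)) hwc.deriv x₁).sub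
        (hBxx t₁ x₁)
    · filter_upwards [Icc_mem_nhds hx₁l hx₁r] with x hx using hmax' t₁ ht₁ x hx
  -- The derivative test backwards in time.
  obtain ⟨hφ, hφc, hφs⟩ := reflect_of_support_subset_ball (x₁ := x₁) hw hws
  have hD : Continuous fun τ => ∫ y, u τ y * deriv (deriv w) (x₁ - y) :=
    (continuous_integral_mul_comp_sub hu hw2.continuous hwc.deriv.deriv).comp
      (by fun_prop : Continuous fun τ : ℝ => (τ, x₁))
  have htt : 0 ≤ (∫ y, u t₁ y * deriv (deriv w) (x₁ - y)) - Bt t₁ x₁ := by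
    refine deriv_nonneg_of_left_max (t₁ := t₁)
      (H := fun t => (∫ τ in t₁..t, ∫ y, u τ y * deriv (deriv w) (x₁ - y)) - B t x₁) ?_ ?_
    · exact (intervalIntegral.integral_hasDerivAt_right (hD.intervalIntegrable _ _)
        (hD.stronglyMeasurableAtFilter _ _) hD.continuousAt).sub (hBt t₁ x₁)
    · filter_upwards [Ico_mem_nhdsLT ht₁'] with s hs
      have h1 := hsub _ hφ hφc (fun y => b.nonneg_normed _) (hφs.trans (Icc_subset_Icc
        (by linarith [min_le_right ρ d]) (by linarith [min_le_right ρ d]))) s t₁ hs.1 hs.2.le ht₁.2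
      have h2 := hmax' s ⟨hs.1, hs.2.le.trans ht₁.2⟩ x₁ hx₁
      have h3 (y : ℝ) : iteratedDeriv 2 (fun y => w (x₁ - y)) y = deriv (deriv w) (x₁ - y) := by
        rw [iteratedDeriv_comp_const_sub]
        simp [iteratedDeriv_succ]
      simp only [h3] at h1
      simp only [intervalIntegral.integral_same]
      rw [intervalIntegral.integral_symm]
      simp only [hU] at h2
      linarith
  linarith [hstrict t₁ ht₁ x₁ hx₁]

/-! ### Comparison of solutions -/

theorem iteratedDeriv_two_eq (φ : ℝ → ℝ) : iteratedDeriv 2 φ = deriv (deriv φ) := by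
  simp [iteratedDeriv_succ]

theorem IsTestFunction.continuous_iteratedDeriv {φ : ℝ → ℝ} (hφ : IsTestFunction φ) :
    Continuous (iteratedDeriv 2 φ) :=
  hφ.smooth.continuous_iteratedDeriv 2 (WithTop.coe_le_coe.2 le_top)

theorem IsTestFunction.hasCompactSupport_iteratedDeriv {φ : ℝ → ℝ} (hφ : IsTestFunction φ) :
    HasCompactSupport (iteratedDeriv 2 φ) := by
  rw [iteratedDeriv_two_eq]
  exact hφ.compactSupport.deriv.deriv

theorem continuous_setIntegral_mul {u : ℝ → ℝ → ℝ} {ψ : ℝ → ℝ}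
    (hu : Continuous fun p : ℝ × ℝ => u p.1 p.2) (hψ : Continuous ψ) (hc : HasCompactSupport ψ) :
    Continuous fun t => ∫ x in Ioi (0 : ℝ), u t x * ψ x := by
  have h (t : ℝ) : ∫ x in Ioi (0 : ℝ), u t x * ψ x
      = ∫ x in tsupport ψ, u t x * ψ x ∂(volume.restrict (Ioi (0 : ℝ))) := by
    refine (setIntegral_eq_integral_of_forall_compl_eq_zero fun y hy => ?_).symm
    rw [image_eq_zero_of_notMem_tsupport hy, mul_zero]
  simp only [h]
  exact continuous_parametric_integral_of_continuous
    (f := fun (t : ℝ) (y : ℝ) => u t y * ψ y) (by fun_prop) hc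

theorem integrableOn_mul_of_continuous {f ψ : ℝ → ℝ} (hf : Continuous f) (hψ : Continuous ψ)
    (hc : HasCompactSupport ψ) (s : Set ℝ) : IntegrableOn (fun x => f x * ψ x) s :=
  ((hf.mul hψ).integrable_of_hasCompactSupport hc.mul_left).integrableOn

theorem setIntegral_Ioi_eq_of_tsupport {f φ : ℝ → ℝ} (hφ : ∀ x ≤ 0, φ x = 0) :
    ∫ x in Ioi (0 : ℝ), f x * φ x = ∫ x, f x * φ x :=
  setIntegral_eq_integral_of_forall_compl_eq_zero fun x hx => by
    rw [hφ x (not_lt.1 hx), mul_zero]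

theorem measurableSet_time_Ioc (s t : Icc (0 : ℝ) T) :
    MeasurableSet {p : ReflDomain T | s < p.2 ∧ p.2 ≤ t} :=
  measurableSet_Ioc.preimage measurable_snd

theorem IsSolution.weak_sub {v z : CSpace r T} {η : Measure (ReflDomain T)}
    (h : IsSolution v z η) (hT : 0 ≤ T) {φ : ℝ → ℝ} (hφ : IsTestFunction φ) {s t : Icc (0 : ℝ) T}
    (hst : s ≤ t) :
    (∫ x in Ioi (0 : ℝ), extend hT z t x * φ x) - ∫ x in Ioi (0 : ℝ), extend hT z s x * φ x =
      (∫ τ in (s : ℝ)..t, ∫ x in Ioi (0 : ℝ), extend hT z τ x * iteratedDeriv 2 φ x) +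
        ∫ p in {p : ReflDomain T | s < p.2 ∧ p.2 ≤ t}, φ p.1 ∂η := by
  rw [(weak_iff_extend hT z η φ t).1 (h.weak t φ hφ),
    (weak_iff_extend hT z η φ s).1 (h.weak s φ hφ)]
  have hc := continuous_setIntegral_mul (continuous_extend hT z) hφ.continuous_iteratedDeriv
    hφ.hasCompactSupport_iteratedDeriv
  have hset : {p : ReflDomain T | p.2 ≤ t} =
      {p : ReflDomain T | p.2 ≤ s} ∪ {p : ReflDomain T | s < p.2 ∧ p.2 ≤ t} := by
    ext p
    simp only [mem_ofPred_eq, mem_union]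
    constructor
    · intro hp
      rcases le_or_gt p.2 s with h | h
      exacts [Or.inl h, Or.inr ⟨h, hp⟩]
    · rintro (hp | hp)
      exacts [hp.trans hst, hp.2]
  rw [hset, setIntegral_union ?_ (measurableSet_time_Ioc s t) (h.integrable φ hφ).integrableOn
    (h.integrable φ hφ).integrableOn,
    ← intervalIntegral.integral_interval_sub_left (hc.intervalIntegrable 0 t)
      (hc.intervalIntegrable 0 s)]
  · ring
  · rw [Set.disjoint_left]
    intro p (hp : p.2 ≤ s) hp'
    exact absurd hp (not_le.2 hp'.1)

/-- The reflection measure does not charge the set where the solution is above the obstacle. -/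
theorem IsSolution.ae_le {v z : CSpace r T} {η : Measure (ReflDomain T)}
    (h : IsSolution v z η) (hT : 0 ≤ T) : ∀ᵐ p ∂η, z.1 p.toDomain ≤ v.1 p.toDomain := by
  have h1 := h.contact ⟨T, hT, le_rfl⟩
  have h2 : {p : ReflDomain T | p.2 ≤ ⟨T, hT, le_rfl⟩} = univ :=
    eq_univ_of_forall fun p => p.2.2.2
  have hcont : Continuous (ReflDomain.toDomain (T := T)) := by
    unfold ReflDomain.toDomain
    fun_prop
  rw [h2, setLIntegral_univ, lintegral_eq_zero_iff] at h1
  · filter_upwards [h1] with p hp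
    simpa using hp
  · exact ENNReal.measurable_ofReal.comp
      (((z.1.continuous.comp hcont).sub (v.1.continuous.comp hcont)).measurable)

theorem exp_growth_le {M κ r a x : ℝ} (hκ : 0 < κ) (hM : 0 ≤ M) (ha : r + 1 ≤ a) (hx : M / κ ≤ x) :
    M * Real.exp (r * x) ≤ κ * Real.exp (a * x) := by
  have hx0 : 0 ≤ x := (div_nonneg hM hκ.le).trans hx
  have h1 : M ≤ κ * x := by rwa [div_le_iff₀' hκ] at hx
  calc M * Real.exp (r * x) ≤ κ * Real.exp x * Real.exp (r * x) := by
        gcongr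
        exact h1.trans (by gcongr; linarith [Real.add_one_le_exp x])
    _ = κ * Real.exp (x + r * x) := by rw [mul_assoc, ← Real.exp_add]
    _ ≤ κ * Real.exp (a * x) := by
        gcongr
        nlinarith

/-- If the obstacles satisfy `v₁ ≤ v₂ + ε e^{rx}`, the solutions satisfy
`z₁ ≤ z₂ + ε e^{rx + r²t}`: the added function solves the heat equation, and where the inequality
fails `z₁` lies strictly above `v₁`, so that there `z₁ - z₂` is a subsolution. The small multiple
of `e^{ax + (a²+1)t}`, with `a > r`, makes the comparison function a strict supersolution and
confines the maximum to a compact set. -/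
theorem IsSolution.le_add_exp (hT : 0 ≤ T) {v₁ v₂ z₁ z₂ : CSpace r T}
    {η₁ η₂ : Measure (ReflDomain T)} (h₁ : IsSolution v₁ z₁ η₁) (h₂ : IsSolution v₂ z₂ η₂) {ε : ℝ}
    (hε : 0 ≤ ε) (hv : ∀ p : Domain T, v₁.1 p ≤ v₂.1 p + ε * Real.exp (r * p.2)) (p : Domain T) :
    z₁.1 p ≤ z₂.1 p + ε * Real.exp (r * p.2 + r ^ 2 * p.1) := by
  set a : ℝ := |r| + 1 with ha
  have ha1 : 1 ≤ a := by linarith [abs_nonneg r]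
  have har : r + 1 ≤ a := by linarith [le_abs_self r]
  set u : ℝ → ℝ → ℝ := extend hT (z₁ - z₂) with hu_def
  have hu : Continuous fun p : ℝ × ℝ => u p.1 p.2 := continuous_extend hT _
  suffices H : ∀ κ > 0, u p.1 p.2 ≤
      ε * Real.exp (r * p.2 + r ^ 2 * p.1) + κ * Real.exp (a * p.2 + (a ^ 2 + 1) * p.1) by
    have h : u p.1 p.2 ≤ ε * Real.exp (r * p.2 + r ^ 2 * p.1) := by
      refine le_of_forall_pos_le_add fun e he => ?_
      have := H (e / Real.exp (a * p.2 + (a ^ 2 + 1) * p.1)) (by positivity)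
      rwa [div_mul_cancel₀ _ (Real.exp_pos _).ne'] at this
    have h' : u p.1 p.2 = z₁.1 p - z₂.1 p := extend_coe hT (z₁ - z₂) p
    linarith
  intro κ hκ
  by_contra! hpos
  set B : ℝ → ℝ → ℝ := fun t x =>
    ε * Real.exp (r * x + r ^ 2 * t) + κ * Real.exp (a * x + (a ^ 2 + 1) * t) with hB_def
  have hB : Continuous fun p : ℝ × ℝ => B p.1 p.2 := by
    simp only [hB_def]
    fun_prop
  have hBpos (t x : ℝ) : 0 < B t x := by positivity
  obtain ⟨M, hM0, hM⟩ := exists_extend_bound hT (z₁ - z₂)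
  have hfar : ∀ t ∈ Icc 0 T, ∀ x, M / κ ≤ x → u t x ≤ B t x := by
    intro t ht x hx
    have hx0 : 0 ≤ x := (div_nonneg hM0 hκ.le).trans hx
    calc u t x ≤ M * Real.exp (r * x) := (le_abs_self _).trans (hM t x hx0)
      _ ≤ κ * Real.exp (a * x) := exp_growth_le hκ hM0 har hx
      _ ≤ κ * Real.exp (a * x + (a ^ 2 + 1) * t) := by
          gcongr
          have := mul_nonneg (by positivity : 0 ≤ a ^ 2 + 1) ht.1
          linarith
      _ ≤ B t x := le_add_of_nonneg_left (by positivity)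
  -- A maximum over the whole domain.
  set R : ℝ := max (M / κ) p.2 with hR
  have hp0 : ((p.1 : ℝ), (p.2 : ℝ)) ∈ Icc (0 : ℝ) T ×ˢ Icc (0 : ℝ) R :=
    ⟨p.1.2, p.2.2, le_max_right _ _⟩
  obtain ⟨⟨t₀, x₀⟩, ⟨ht₀, hx₀⟩, hmaxK⟩ := (isCompact_Icc.prod isCompact_Icc).exists_isMaxOn
    ⟨_, hp0⟩ (hu.sub hB).continuousOn
  simp only at ht₀ hx₀
  set W₀ := u t₀ x₀ - B t₀ x₀ with hW₀_def
  have hW₀ : 0 < W₀ := by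
    have h1 : u p.1 p.2 - B p.1 p.2 ≤ W₀ := hmaxK hp0
    have h2 : B p.1 p.2 = ε * Real.exp (r * p.2 + r ^ 2 * p.1) +
      κ * Real.exp (a * p.2 + (a ^ 2 + 1) * p.1) := rfl
    linarith
  have hmax : ∀ t ∈ Icc 0 T, ∀ x, 0 ≤ x → u t x - B t x ≤ W₀ := by
    intro t ht x hx
    rcases le_total x R with h | h
    · exact hmaxK (show (t, x) ∈ _ from ⟨ht, hx, h⟩)
    · linarith [hfar t ht x ((le_max_left _ _).trans h)]
  have hx₀pos : 0 < x₀ := by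
    refine hx₀.1.lt_of_ne fun h => ?_
    have h1 : u t₀ x₀ = 0 := by
      rw [hu_def, extend_of_mem hT _ ht₀ hx₀.1]
      have e1 := h₁.boundary ⟨t₀, ht₀⟩ ⟨x₀, hx₀.1⟩ h.symm
      have e2 := h₂.boundary ⟨t₀, ht₀⟩ ⟨x₀, hx₀.1⟩ h.symm
      change z₁.1 _ - z₂.1 _ = 0
      rw [e1, e2, sub_zero]
    linarith [hBpos t₀ x₀]
  have ht₀pos : 0 < t₀ := by
    refine ht₀.1.lt_of_ne fun h => ?_
    have h1 : u t₀ x₀ = 0 := by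
      rw [hu_def, extend_of_mem hT _ ht₀ hx₀.1]
      have e1 := h₁.initial ⟨t₀, ht₀⟩ ⟨x₀, hx₀.1⟩ h.symm
      have e2 := h₂.initial ⟨t₀, ht₀⟩ ⟨x₀, hx₀.1⟩ h.symm
      change z₁.1 _ - z₂.1 _ = 0
      rw [e1, e2, sub_zero]
    linarith [hBpos t₀ x₀]
  -- A box around the maximum on which `u > B`.
  obtain ⟨d, hd, hdt, hdx, hbox⟩ : ∃ d > 0, d ≤ t₀ ∧ 4 * d ≤ x₀ ∧
      ∀ t ∈ Icc (t₀ - d) t₀, ∀ x ∈ Icc (x₀ - 2 * d) (x₀ + 2 * d), B t x < u t x := by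
    have hev : ∀ᶠ q : ℝ × ℝ in 𝓝 (t₀, x₀), B q.1 q.2 < u q.1 q.2 :=
      hB.continuousAt.eventually_lt hu.continuousAt (by simp only; linarith)
    obtain ⟨ρ, hρ, hρ'⟩ := Metric.eventually_nhds_iff.1 hev
    refine ⟨min (ρ / 4) (min t₀ (x₀ / 4)), by positivity, ?_, ?_, fun t ht x hx => ?_⟩
    · exact (min_le_right _ _).trans (min_le_left _ _)
    · linarith [(min_le_right (ρ / 4) (min t₀ (x₀ / 4))).trans (min_le_right _ _)]
    · refine hρ' (y := (t, x)) ?_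
      have := min_le_left (ρ / 4) (min t₀ (x₀ / 4))
      rw [Prod.dist_eq, max_lt_iff, Real.dist_eq, Real.dist_eq, abs_lt, abs_lt]
      refine ⟨⟨?_, ?_⟩, ?_, ?_⟩ <;> simp only <;> linarith [ht.1, ht.2, hx.1, hx.2]
  set θ : ℝ := κ / (4 * (T + 1)) with hθ_def
  have hT1 : 0 < T + 1 := by linarith
  have hθ : 0 < θ := by positivity
  have hθκ : 4 * (θ * (T + 1)) = κ := by rw [hθ_def]; field_simp
  -- The quadratic term makes the maximum strict.
  refine no_interior_max (u := u) (t₀ := t₀) (x₀ := x₀) (d := d) (m := W₀ - θ * d ^ 2)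
    (B := fun t x => B t x + θ * ((x - x₀) ^ 2 + (t - t₀) ^ 2))
    (Bt := fun t x => ε * (Real.exp (r * x + r ^ 2 * t) * r ^ 2) +
      κ * (Real.exp (a * x + (a ^ 2 + 1) * t) * (a ^ 2 + 1)) + θ * (2 * (t - t₀)))
    (Bx := fun t x => ε * (Real.exp (r * x + r ^ 2 * t) * r) +
      κ * (Real.exp (a * x + (a ^ 2 + 1) * t) * a) + θ * (2 * (x - x₀)))
    (Bxx := fun t x => ε * (Real.exp (r * x + r ^ 2 * t) * r * r) +
      κ * (Real.exp (a * x + (a ^ 2 + 1) * t) * a * a) + θ * 2)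
    hu (by fun_prop) (fun t x => ?_) (fun t x => ?_) (fun t x => ?_) hd ?_ ?_ ?_ ?_
  · have e (b c : ℝ) : HasDerivAt (fun t => Real.exp (b * x + c * t))
        (Real.exp (b * x + c * t) * c) t := by
      simpa using (((hasDerivAt_id t).const_mul c).const_add (b * x)).exp
    have q : HasDerivAt (fun t => (x - x₀) ^ 2 + (t - t₀) ^ 2) (2 * (t - t₀)) t := by
      simpa using (((hasDerivAt_id t).sub_const t₀).pow 2).const_add ((x - x₀) ^ 2)
    exact (((e r (r ^ 2)).const_mul ε).add ((e a (a ^ 2 + 1)).const_mul κ)).add (q.const_mul θ)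
  · have e (b c : ℝ) : HasDerivAt (fun x => Real.exp (b * x + c * t))
        (Real.exp (b * x + c * t) * b) x := by
      simpa using (((hasDerivAt_id x).const_mul b).add_const (c * t)).exp
    have q : HasDerivAt (fun x => (x - x₀) ^ 2 + (t - t₀) ^ 2) (2 * (x - x₀)) x := by
      simpa using (((hasDerivAt_id x).sub_const x₀).pow 2).add_const ((t - t₀) ^ 2)
    exact (((e r (r ^ 2)).const_mul ε).add ((e a (a ^ 2 + 1)).const_mul κ)).add (q.const_mul θ)
  · have e (b c : ℝ) : HasDerivAt (fun x => Real.exp (b * x + c * t) * b)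
        (Real.exp (b * x + c * t) * b * b) x := by
      simpa using (((hasDerivAt_id x).const_mul b).add_const (c * t)).exp.mul_const b
    have q : HasDerivAt (fun x => 2 * (x - x₀)) 2 x := by
      simpa using ((hasDerivAt_id x).sub_const x₀).const_mul 2
    exact (((e r (r ^ 2)).const_mul ε).add ((e a (a ^ 2 + 1)).const_mul κ)).add (q.const_mul θ)
  · -- `u` is a weak subsolution on the box.
    intro φ hφ hφc hφ0 hφs s t hs hst ht
    have hvanish : ∀ x, x ∉ Icc (x₀ - 2 * d) (x₀ + 2 * d) → φ x = 0 := fun x hx =>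
      image_eq_zero_of_notMem_tsupport fun h => hx (hφs h)
    have hneg : ∀ x ≤ 0, φ x = 0 := fun x hx => hvanish x fun h => by linarith [h.1]
    have hφt : IsTestFunction φ := ⟨hφ, hφc, hneg 0 le_rfl⟩
    have hneg2 : ∀ x ≤ 0, iteratedDeriv 2 φ x = 0 := fun x hx => by
      rw [iteratedDeriv_two_eq]
      refine image_eq_zero_of_notMem_tsupport fun h => ?_
      have := hφs (tsupport_deriv_subset (tsupport_deriv_subset h))
      linarith [this.1]
    have hs' : s ∈ Icc 0 T := ⟨by linarith, by linarith [ht₀.2]⟩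
    have ht' : t ∈ Icc 0 T := ⟨by linarith, by linarith [ht₀.2]⟩
    have hst' : (⟨s, hs'⟩ : Icc (0 : ℝ) T) ≤ ⟨t, ht'⟩ := hst
    have w₁ := h₁.weak_sub hT hφt hst'
    have w₂ := h₂.weak_sub hT hφt hst'
    have hz : ∫ p in {p : ReflDomain T | (⟨s, hs'⟩ : Icc (0 : ℝ) T) < p.2 ∧ p.2 ≤ ⟨t, ht'⟩},
        φ p.1 ∂η₁ = 0 := by
      refine integral_eq_zero_of_ae ?_
      filter_upwards [ae_restrict_of_ae (h₁.ae_le hT), 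
        ae_restrict_mem (measurableSet_time_Ioc _ _)] with q hq hqs
      by_contra hne
      have hqx : (q.1 : ℝ) ∈ Icc (x₀ - 2 * d) (x₀ + 2 * d) := by
        by_contra h
        exact hne (hvanish _ h)
      have hqt : (q.2 : ℝ) ∈ Icc (t₀ - d) t₀ := ⟨hs.trans (le_of_lt hqs.1), le_trans hqs.2 ht⟩
      have hb := hbox q.2 hqt q.1 hqx
      have hu' : u q.2 q.1 = z₁.1 q.toDomain - z₂.1 q.toDomain :=
        extend_coe hT (z₁ - z₂) q.toDomain
      have hv' := hv q.toDomain
      have ha' := h₂.above q.toDomain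
      have hexp : ε * Real.exp (r * q.1) ≤ B q.2 q.1 := by
        calc ε * Real.exp (r * q.1) ≤ ε * Real.exp (r * q.1 + r ^ 2 * q.2) := by
              gcongr
              have := mul_nonneg (sq_nonneg r) q.2.2.1
              linarith
          _ ≤ B q.2 q.1 := le_add_of_nonneg_right (by positivity)
      have hcoe : ((q.toDomain.2 : Ici (0 : ℝ)) : ℝ) = q.1 := rfl
      rw [hcoe] at hv'
      linarith
    have hz₂ : 0 ≤ ∫ p in {p : ReflDomain T | (⟨s, hs'⟩ : Icc (0 : ℝ) T) < p.2 ∧ p.2 ≤ ⟨t, ht'⟩},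
        φ p.1 ∂η₂ := integral_nonneg fun p => hφ0 _
    rw [hz, add_zero] at w₁
    have split (τ : ℝ) {ψ : ℝ → ℝ} (hψ : Continuous ψ) (hψc : HasCompactSupport ψ)
        (hψ0 : ∀ x ≤ 0, ψ x = 0) : ∫ x, u τ x * ψ x =
        (∫ x in Ioi (0 : ℝ), extend hT z₁ τ x * ψ x) -
          ∫ x in Ioi (0 : ℝ), extend hT z₂ τ x * ψ x := by
      have hc (z : CSpace r T) : Continuous (extend hT z τ) :=
        (continuous_extend hT z).comp (by fun_prop : Continuous fun x : ℝ => (τ, x))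
      rw [← setIntegral_Ioi_eq_of_tsupport hψ0, ← integral_sub
        (integrableOn_mul_of_continuous (hc z₁) hψ hψc _)
        (integrableOn_mul_of_continuous (hc z₂) hψ hψc _)]
      simp only [hu_def, extend_sub, sub_mul]
    have hψ := hφt.continuous_iteratedDeriv
    have hψc := hφt.hasCompactSupport_iteratedDeriv
    rw [split t hφ.continuous hφc hneg, split s hφ.continuous hφc hneg]
    simp only [split _ hψ hψc hneg2]
    rw [intervalIntegral.integral_sub
      ((continuous_setIntegral_mul (continuous_extend hT z₁) hψ hψc).intervalIntegrable _ _)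
      ((continuous_setIntegral_mul (continuous_extend hT z₂) hψ hψc).intervalIntegrable _ _)]
    linarith
  · intro t ht x hx
    have hx0 : 0 ≤ x := by linarith [hx.1]
    have ht0 : 0 ≤ t := by linarith [ht.1]
    have hexp : 1 ≤ Real.exp (a * x + (a ^ 2 + 1) * t) := Real.one_le_exp (by positivity)
    have h1 : κ ≤ κ * Real.exp (a * x + (a ^ 2 + 1) * t) := le_mul_of_one_le_right hκ.le hexp
    have h2 : -(θ * T) ≤ θ * (t - t₀) := by nlinarith [ht₀.2]
    nlinarith
  · intro t ht x hx hor
    have hx0 : 0 ≤ x := by linarith [hx.1]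
    have hm := hmax t ⟨by linarith [ht.1], ht.2.trans ht₀.2⟩ x hx0
    have hq : d ^ 2 ≤ (x - x₀) ^ 2 + (t - t₀) ^ 2 := by
      rcases hor with h | h | h <;> rw [h] <;> nlinarith [sq_nonneg (x - x₀), sq_nonneg (t - t₀)]
    have := mul_le_mul_of_nonneg_left hq hθ.le
    linarith
  · have : 0 < θ * d ^ 2 := by positivity
    simp only [sub_self]
    linarith

theorem IsSolution.abs_sub_le (hT : 0 ≤ T) {v₁ v₂ z₁ z₂ : CSpace r T}
    {η₁ η₂ : Measure (ReflDomain T)} (h₁ : IsSolution v₁ z₁ η₁) (h₂ : IsSolution v₂ z₂ η₂)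
    (p : Domain T) :
    |z₁.1 p - z₂.1 p| ≤ growthNorm (v₁ - v₂) * Real.exp (r * p.2 + r ^ 2 * p.1) := by
  have hv (p : Domain T) : |v₁.1 p - v₂.1 p| ≤ growthNorm (v₁ - v₂) * Real.exp (r * p.2) :=
    abs_le_growthNorm (v₁ - v₂) p
  have hn := growthNorm_nonneg (v₁ - v₂)
  have e₁ := h₁.le_add_exp hT h₂ hn (fun p => by linarith [(abs_le.1 (hv p)).2]) p
  have e₂ := h₂.le_add_exp hT h₁ hn (fun p => by linarith [(abs_le.1 (hv p)).1]) p
  exact abs_le.2 ⟨by linarith, by linarith⟩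

/-- The Lipschitz estimate, with constant `e^{r²T}`. -/
theorem IsSolution.growthNorm_sub_le (hT : 0 ≤ T) {v₁ v₂ z₁ z₂ : CSpace r T}
    {η₁ η₂ : Measure (ReflDomain T)} (h₁ : IsSolution v₁ z₁ η₁) (h₂ : IsSolution v₂ z₂ η₂) :
    growthNorm (z₁ - z₂) ≤ Real.exp (r ^ 2 * T) * growthNorm (v₁ - v₂) := by
  have : Nonempty (Domain T) := ⟨(⟨0, le_rfl, hT⟩, ⟨0, self_mem_Ici⟩)⟩
  refine ciSup_le fun p => ?_
  have h : |(z₁ - z₂).1 p| ≤ growthNorm (v₁ - v₂) * Real.exp (r * p.2 + r ^ 2 * p.1) :=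
    h₁.abs_sub_le hT h₂ p
  have hn := growthNorm_nonneg (v₁ - v₂)
  calc Real.exp (-r * (p.2 : ℝ)) * |(z₁ - z₂).1 p|
      ≤ Real.exp (-r * (p.2 : ℝ)) *
        (growthNorm (v₁ - v₂) * Real.exp (r * p.2 + r ^ 2 * p.1)) := by gcongr
    _ = Real.exp (r ^ 2 * p.1) * growthNorm (v₁ - v₂) := by
        rw [mul_left_comm, ← Real.exp_add]
        ring_nf
    _ ≤ Real.exp (r ^ 2 * T) * growthNorm (v₁ - v₂) := by
        gcongr
        exact p.1.2.2

theorem IsSolution.eq_of_same_obstacle (hT : 0 ≤ T) {v z₁ z₂ : CSpace r T}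
    {η₁ η₂ : Measure (ReflDomain T)} (h₁ : IsSolution v z₁ η₁) (h₂ : IsSolution v z₂ η₂) :
    z₁ = z₂ := by
  refine Subtype.ext (ContinuousMap.ext fun p => ?_)
  have h := h₁.abs_sub_le hT h₂ p
  have h0 : growthNorm (v - v) = 0 := by
    simp [growthNorm]
  rw [h0, zero_mul] at h
  exact sub_eq_zero.1 (abs_nonpos_iff.1 h)

/-! ### Smooth cutoffs and uniqueness of the reflection measure -/

/-- A smooth cutoff with values in `[0,1]`: it vanishes to the left of `a`, rises to `1` on
`[a, a + 1/m]`, and descends to `0` on `[b, b + 1/n]`. -/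
noncomputable def cutoff (m n a b x : ℝ) : ℝ :=
  Real.smoothTransition (m * (x - a)) * Real.smoothTransition (1 - n * (x - b))

theorem contDiff_cutoff (m n a b : ℝ) : ContDiff ℝ ∞ (cutoff m n a b) := by
  unfold cutoff
  exact (Real.smoothTransition.contDiff.comp (by fun_prop)).mul
    (Real.smoothTransition.contDiff.comp (by fun_prop))

theorem cutoff_nonneg (m n a b x : ℝ) : 0 ≤ cutoff m n a b x :=
  mul_nonneg (Real.smoothTransition.nonneg _) (Real.smoothTransition.nonneg _)

theorem cutoff_le_one (m n a b x : ℝ) : cutoff m n a b x ≤ 1 :=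
  mul_le_one₀ (Real.smoothTransition.le_one _) (Real.smoothTransition.nonneg _)
    (Real.smoothTransition.le_one _)

theorem cutoff_of_le {m n a b x : ℝ} (hm : 0 ≤ m) (hx : x ≤ a) : cutoff m n a b x = 0 := by
  rw [cutoff, Real.smoothTransition.zero_of_nonpos, zero_mul]
  exact mul_nonpos_of_nonneg_of_nonpos hm (by linarith)

theorem cutoff_of_ge {m n a b x : ℝ} (hx : 1 ≤ n * (x - b)) : cutoff m n a b x = 0 := by
  rw [cutoff, Real.smoothTransition.zero_of_nonpos (x := 1 - _), mul_zero]
  linarith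

theorem cutoff_eq_one {m n a b x : ℝ} (hx : 1 ≤ m * (x - a)) (hn : 0 ≤ n) (hb : x ≤ b) :
    cutoff m n a b x = 1 := by
  rw [cutoff, Real.smoothTransition.one_of_one_le hx, Real.smoothTransition.one_of_one_le, mul_one]
  nlinarith

theorem tsupport_cutoff_subset {m n a b : ℝ} (hm : 0 ≤ m) (hn : 1 ≤ n) :
    tsupport (cutoff m n a b) ⊆ Icc a (b + 1) := by
  refine closure_minimal (fun x hx => ?_) isClosed_Icc
  by_contra h
  rw [mem_Icc, not_and_or, not_le, not_le] at h
  rcases h with h | h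
  · exact hx (cutoff_of_le hm h.le)
  · exact hx (cutoff_of_ge (by nlinarith))

theorem isTestFunction_cutoff {m n a b : ℝ} (hm : 0 ≤ m) (hn : 1 ≤ n) (ha : 0 ≤ a) :
    IsTestFunction (cutoff m n a b) where
  smooth := contDiff_cutoff _ _ _ _
  compactSupport := isCompact_Icc.of_isClosed_subset (isClosed_tsupport _)
    (tsupport_cutoff_subset hm hn)
  zero := cutoff_of_le hm ha

theorem tendsto_cutoff (a b x : ℝ) :
    Tendsto (fun n : ℕ => cutoff (n + 1) (n + 1) a b x) atTop
      (𝓝 ((Ioc a b).indicator (fun _ => 1) x)) := by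
  have hbig {y : ℝ} (hy : 0 < y) : ∀ᶠ n : ℕ in atTop, 1 ≤ ((n : ℝ) + 1) * y := by
    have h := (tendsto_natCast_atTop_atTop (R := ℝ)).atTop_mul_const hy
    filter_upwards [h.eventually_ge_atTop 1] with n hn
    linarith
  refine tendsto_const_nhds.congr' ?_
  by_cases h : x ∈ Ioc a b
  · filter_upwards [hbig (sub_pos.2 h.1)] with n hn
    rw [indicator_of_mem h, cutoff_eq_one hn (by positivity) h.2]
  · rw [indicator_of_notMem h]
    rw [mem_Ioc, not_and_or, not_lt, not_le] at h
    rcases h with h | h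
    · exact Eventually.of_forall fun n => (cutoff_of_le (by positivity) h).symm
    · filter_upwards [hbig (sub_pos.2 h)] with n hn
      exact (cutoff_of_ge hn).symm

theorem cutoff_le_cutoff {a b : ℝ} (ha : 0 < a) (n : ℕ) (x : ℝ) :
    cutoff (n + 1) (n + 1) a b x ≤ cutoff (2 / a) 1 (a / 2) (b + 1) x := by
  have hn : (0 : ℝ) ≤ n := Nat.cast_nonneg n
  rcases le_or_gt x a with h | h
  · rw [cutoff_of_le (by positivity) h]
    exact cutoff_nonneg _ _ _ _ _
  rcases le_or_gt x (b + 1) with h' | h'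
  · rw [cutoff_eq_one (m := 2 / a) _ zero_le_one h']
    · exact cutoff_le_one _ _ _ _ _
    · rw [div_mul_eq_mul_div, le_div_iff₀ ha]
      linarith
  · rw [cutoff_of_ge (by nlinarith)]
    exact cutoff_nonneg _ _ _ _ _

theorem IsSolution.measure_box_lt_top {v z : CSpace r T} {η : Measure (ReflDomain T)}
    (h : IsSolution v z η) (a b : Ioi (0 : ℝ)) (t : Icc (0 : ℝ) T) :
    η (Ioc a b ×ˢ Iic t) < ⊤ := by
  have ha : (0 : ℝ) < a := a.2
  have hi := h.integrable _ (isTestFunction_cutoff (m := 2 / a) (n := 1) (a := a / 2) (b := b)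
    (by positivity) le_rfl (by positivity))
  refine (measure_mono fun p hp => ?_).trans_lt (hi.measure_norm_ge_lt_top zero_lt_one)
  have hx : (a : ℝ) < p.1 := hp.1.1
  have hx' : (p.1 : ℝ) ≤ b := hp.1.2
  rw [mem_ofPred_eq, cutoff_eq_one _ zero_le_one hx', norm_one]
  rw [div_mul_eq_mul_div, le_div_iff₀ ha]
  linarith

theorem IsSolution.tendsto_measure_box {v z : CSpace r T} {η : Measure (ReflDomain T)}
    (h : IsSolution v z η) (a b : Ioi (0 : ℝ)) (t : Icc (0 : ℝ) T) :
    Tendsto (fun n : ℕ => ∫ p in {p : ReflDomain T | p.2 ≤ t}, cutoff (n + 1) (n + 1) a b p.1 ∂η)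
      atTop (𝓝 (η.real (Ioc a b ×ˢ Iic t))) := by
  have ha : (0 : ℝ) < a := a.2
  have hlim : η.real (Ioc a b ×ˢ Iic t) =
      ∫ p in {p : ReflDomain T | p.2 ≤ t}, (Ioc (a : ℝ) b).indicator (fun _ => 1) (p.1 : ℝ) ∂η := by
    have hm : MeasurableSet (Ioc a b ×ˢ (univ : Set (Icc (0 : ℝ) T))) :=
      measurableSet_Ioc.prod MeasurableSet.univ
    have e : (fun p : ReflDomain T => (Ioc (a : ℝ) b).indicator (fun _ => (1 : ℝ)) (p.1 : ℝ)) =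
        (Ioc a b ×ˢ (univ : Set (Icc (0 : ℝ) T))).indicator fun _ => (1 : ℝ) := by
      ext p
      by_cases hp : p.1 ∈ Ioc a b
      · rw [indicator_of_mem (show (p.1 : ℝ) ∈ Ioc (a : ℝ) b from hp),
          indicator_of_mem (mem_prod.2 ⟨hp, mem_univ _⟩)]
      · rw [indicator_of_notMem (show (p.1 : ℝ) ∉ Ioc (a : ℝ) b from hp),
          indicator_of_notMem fun h' => hp h'.1]
    rw [e, integral_indicator hm, Measure.restrict_restrict hm, setIntegral_const, smul_eq_mul,
      mul_one]
    congr 1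
    ext p
    simp only [mem_prod, mem_inter_iff, mem_univ, and_true, mem_ofPred_eq, mem_Iic]
  rw [hlim]
  have hi := h.integrable _ (isTestFunction_cutoff (m := 2 / a) (n := 1) (a := a / 2) (b := b + 1)
    (by positivity) le_rfl (by positivity))
  refine tendsto_integral_of_dominated_convergence
    (fun p => cutoff (2 / a) 1 (a / 2) (b + 1) p.1) (fun n => ?_) hi.integrableOn (fun n => ?_) ?_
  · refine Continuous.aestronglyMeasurable ?_
    exact (contDiff_cutoff _ _ _ _).continuous.comp (continuous_subtype_val.comp continuous_fst)
  · refine Eventually.of_forall fun p => ?_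
    rw [Real.norm_of_nonneg (cutoff_nonneg _ _ _ _ _)]
    exact cutoff_le_cutoff ha n _
  · exact Eventually.of_forall fun p => tendsto_cutoff _ _ _

theorem exists_between_pos (x : Ioi (0 : ℝ)) :
    ∃ n : ℕ, 1 / ((n : ℝ) + 1) < x ∧ (x : ℝ) ≤ n + 1 := by
  obtain ⟨n, hn⟩ := exists_nat_one_div_lt (show (0 : ℝ) < x from x.2)
  obtain ⟨m, hm⟩ := exists_nat_ge (x : ℝ)
  refine ⟨max n m, lt_of_le_of_lt ?_ hn, hm.trans ?_⟩
  · exact one_div_le_one_div_of_le (by positivity) (by simp)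
  · have : (m : ℝ) ≤ (max n m : ℕ) := by exact_mod_cast le_max_right n m
    linarith

/-- The solution determines the reflection measure: its values on boxes `(a,b] × [0,t]` are limits
of integrals of test functions, which the weak equation expresses in terms of `z`. -/
theorem IsSolution.measure_unique (hT : 0 ≤ T) {v z : CSpace r T} {η₁ η₂ : Measure (ReflDomain T)}
    (h₁ : IsSolution v z η₁) (h₂ : IsSolution v z η₂) : η₁ = η₂ := by
  set C : Set (Set (Ioi (0 : ℝ))) := {S | ∃ l u, l < u ∧ Ioc l u = S} with hC
  set D : Set (Set (Icc (0 : ℝ) T)) := range Iic with hD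
  have hCs : IsCountablySpanning C := by
    refine ⟨fun n : ℕ => Ioc ⟨1 / ((n : ℝ) + 2), mem_Ioi.2 (by positivity)⟩
      ⟨(n : ℝ) + 2, mem_Ioi.2 (by positivity)⟩, fun n => ⟨_, _, ?_, rfl⟩, ?_⟩
    · refine Subtype.mk_lt_mk.2 ?_
      rw [div_lt_iff₀ (by positivity)]
      nlinarith [Nat.cast_nonneg (α := ℝ) n]
    · refine eq_univ_of_forall fun x => mem_iUnion.2 ?_
      obtain ⟨n, hn, hn'⟩ := exists_between_pos x
      refine ⟨n, Subtype.mk_lt_mk.2 (lt_of_le_of_lt ?_ hn), Subtype.mk_le_mk.2 (hn'.trans ?_)⟩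
      · exact one_div_le_one_div_of_le (by positivity) (by linarith)
      · linarith
  have hDs : IsCountablySpanning D :=
    ⟨fun _ => Iic ⟨T, hT, le_rfl⟩, fun _ => ⟨_, rfl⟩,
      eq_univ_of_forall fun t => mem_iUnion.2 ⟨0, t.2.2⟩⟩
  have hCg : MeasurableSpace.generateFrom C = (inferInstance : MeasurableSpace (Ioi (0 : ℝ))) := by
    rw [hC, ← borel_eq_generateFrom_Ioc, ← BorelSpace.measurable_eq]
  have hDg : MeasurableSpace.generateFrom D =
      (inferInstance : MeasurableSpace (Icc (0 : ℝ) T)) := by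
    rw [hD, ← borel_eq_generateFrom_Iic, ← BorelSpace.measurable_eq]
  have heq (a b : Ioi (0 : ℝ)) (t : Icc (0 : ℝ) T) :
      η₁ (Ioc a b ×ˢ Iic t) = η₂ (Ioc a b ×ˢ Iic t) := by
    rw [← measureReal_eq_measureReal_iff (h₁.measure_box_lt_top a b t).ne
      (h₂.measure_box_lt_top a b t).ne]
    refine tendsto_nhds_unique (h₁.tendsto_measure_box a b t) ?_
    refine (h₂.tendsto_measure_box a b t).congr fun n => ?_
    have hn : (1 : ℝ) ≤ n + 1 := by linarith [Nat.cast_nonneg (α := ℝ) n]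
    have hφ : IsTestFunction (cutoff (n + 1) (n + 1) a b) :=
      isTestFunction_cutoff (by positivity) hn (le_of_lt a.2)
    exact add_left_cancel ((h₂.weak t _ hφ).symm.trans (h₁.weak t _ hφ))
  have hBs := hCs.prod hDs
  obtain ⟨S, hS, hSu⟩ := hBs
  refine Measure.ext_of_generateFrom_of_iUnion (image2 (· ×ˢ ·) C D) S
    (generateFrom_eq_prod hCg hDg hCs hDs).symm
    ((isPiSystem_Ioc id id).prod isPiSystem_Iic) hSu hS (fun i => ?_) ?_
  · obtain ⟨_, ⟨a, b, -, rfl⟩, _, ⟨t, rfl⟩, h⟩ := hS i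
    rw [← h]
    exact (h₁.measure_box_lt_top a b t).ne
  · rintro _ ⟨_, ⟨a, b, -, rfl⟩, _, ⟨t, rfl⟩, rfl⟩
    exact heq a b t

/-! ### The random walk scheme -/

/-- One step of the symmetric random walk with step size `δ`. -/
noncomputable def walk (δ : ℝ) (f : ℝ → ℝ) (x : ℝ) : ℝ := (f (x + δ) + f (x - δ)) / 2

/-- The duration of a step of the random walk of step size `δ`, for which `walk δ - 1` approximates
`timeStep δ` times the second derivative. -/
noncomputable def timeStep (δ : ℝ) : ℝ := δ ^ 2 / 2

/-- The discrete obstacle problem: at every step, the values are averaged along the random walk and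
raised to the obstacle `V`. The walk is killed on `(-∞, 0]`. -/
noncomputable def scheme (V : ℝ → ℝ → ℝ) (δ : ℝ) : ℕ → ℝ → ℝ
  | 0 => fun _ => 0
  | k + 1 => fun x => if x ≤ 0 then 0 else
      max (V ((k + 1 : ℕ) * timeStep δ) x) (walk δ (scheme V δ k) x)

section scheme

variable {V : ℝ → ℝ → ℝ} {δ : ℝ}

theorem timeStep_pos (hδ : 0 < δ) : 0 < timeStep δ := by
  unfold timeStep
  positivity

theorem scheme_zero (x : ℝ) : scheme V δ 0 x = 0 := rfl

theorem scheme_succ_of_pos (k : ℕ) {x : ℝ} (hx : 0 < x) : scheme V δ (k + 1) x =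
    max (V ((k + 1 : ℕ) * timeStep δ) x) (walk δ (scheme V δ k) x) :=
  if_neg (not_le.2 hx)

theorem scheme_of_nonpos (k : ℕ) {x : ℝ} (hx : x ≤ 0) : scheme V δ k x = 0 := by
  cases k with
  | zero => rfl
  | succ k => exact if_pos hx

theorem scheme_nonneg (k : ℕ) (x : ℝ) : 0 ≤ scheme V δ k x := by
  induction k generalizing x with
  | zero => exact le_rfl
  | succ k ih =>
    rcases le_or_gt x 0 with hx | hx
    · rw [scheme_of_nonpos _ hx]
    · rw [scheme_succ_of_pos k hx]
      exact le_max_of_le_right (div_nonneg (add_nonneg (ih _) (ih _)) zero_le_two)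

theorem measurable_scheme (hV : ∀ t, Continuous (V t)) (k : ℕ) : Measurable (scheme V δ k) := by
  induction k with
  | zero => exact measurable_const
  | succ k ih =>
    refine Measurable.ite measurableSet_Iic measurable_const ((hV _).measurable.max ?_)
    exact ((ih.comp (measurable_id.add_const δ)).add
      (ih.comp (measurable_id.sub_const δ))).div_const 2

/-- The comparison principle for the discrete obstacle problem with obstacle `O`: a subsolution `A`
stays below a supersolution `w` that dominates the obstacle, the initial values, and the values on
the strip `(-δ, 0]`, where the walk may land when it leaves `(0,∞)`. -/
theorem discrete_comparison {A w O : ℕ → ℝ → ℝ} (hδ : 0 < δ)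
    (hA : ∀ k x, 0 < x → A (k + 1) x ≤ max (O k x) (walk δ (A k) x))
    (h0 : ∀ x, -δ < x → A 0 x ≤ w 0 x) (hb : ∀ k x, -δ < x → x ≤ 0 → A k x ≤ w k x)
    (hO : ∀ k x, 0 < x → O k x ≤ w (k + 1) x)
    (hw : ∀ k x, 0 < x → walk δ (w k) x ≤ w (k + 1) x) (k : ℕ) {x : ℝ} (hx : -δ < x) :
    A k x ≤ w k x := by
  induction k generalizing x with
  | zero => exact h0 x hx
  | succ k ih =>
    rcases le_or_gt x 0 with hx0 | hx0
    · exact hb _ x hx hx0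
    · refine (hA k x hx0).trans (max_le (hO k x hx0) (le_trans ?_ (hw k x hx0)))
      unfold walk
      have h1 := ih (x := x + δ) (by linarith)
      have h2 := ih (x := x - δ) (by linarith)
      linarith

theorem walk_exp_le (a t δ x : ℝ) : walk δ (fun x => Real.exp (a * x + a ^ 2 * t)) x ≤
    Real.exp (a * x + a ^ 2 * (t + timeStep δ)) := by
  have h := Real.cosh_le_exp_half_sq (a * δ)
  have e : walk δ (fun x => Real.exp (a * x + a ^ 2 * t)) x =
      Real.exp (a * x + a ^ 2 * t) * Real.cosh (a * δ) := by
    rw [walk, Real.cosh_eq, mul_div_assoc', mul_add (Real.exp _), ← Real.exp_add, ← Real.exp_add]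
    ring_nf
  rw [e]
  calc Real.exp (a * x + a ^ 2 * t) * Real.cosh (a * δ)
      ≤ Real.exp (a * x + a ^ 2 * t) * Real.exp ((a * δ) ^ 2 / 2) := by gcongr
    _ = _ := by
      rw [← Real.exp_add, timeStep]
      ring_nf

/-- Exponential functions plus affine functions are supersolutions of the walk. -/
theorem walk_barrier_le {ε : ℝ} (hε : 0 ≤ ε) (a c c' δ x : ℝ) (k : ℕ) :
    walk δ (fun x => ε * Real.exp (a * x + a ^ 2 * (k * timeStep δ)) + (c * x + c')) x ≤
      ε * Real.exp (a * x + a ^ 2 * ((k + 1 : ℕ) * timeStep δ)) + (c * x + c') := by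
  have h := mul_le_mul_of_nonneg_left (walk_exp_le a (k * timeStep δ) δ x) hε
  have e : ((k + 1 : ℕ) : ℝ) * timeStep δ = k * timeStep δ + timeStep δ := by push_cast; ring
  rw [e]
  unfold walk at h ⊢
  linarith

theorem walk_add (f g : ℝ → ℝ) (x : ℝ) :
    walk δ (fun x => f x + g x) x = walk δ f x + walk δ g x := by
  unfold walk
  ring

theorem walk_scheme_le (k : ℕ) {x : ℝ} (hx : 0 < x) :
    walk δ (scheme V δ k) x ≤ scheme V δ (k + 1) x := by
  rw [scheme_succ_of_pos k hx]
  exact le_max_right _ _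

theorem obstacle_le_scheme (k : ℕ) {x : ℝ} (hx : 0 < x) :
    V ((k + 1 : ℕ) * timeStep δ) x ≤ scheme V δ (k + 1) x := by
  rw [scheme_succ_of_pos k hx]
  exact le_max_left _ _

theorem scheme_le_exp (hδ : 0 < δ) {M : ℝ} (hM : 0 ≤ M)
    (hV : ∀ t x, 0 < x → V t x ≤ M * Real.exp (r * x)) (k : ℕ) {x : ℝ} (hx : -δ < x) :
    scheme V δ k x ≤ M * Real.exp (r * x + r ^ 2 * (k * timeStep δ)) := by
  have hh := (timeStep_pos hδ).le
  refine discrete_comparison (w := fun k x => M * Real.exp (r * x + r ^ 2 * (k * timeStep δ))) hδ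
    (fun k x hx => (scheme_succ_of_pos k hx).le) (fun x _ => ?_) (fun k x _ hx => ?_)
    (fun k x hx => ?_) (fun k x _ => ?_) k hx
  · rw [scheme_zero]; positivity
  · rw [scheme_of_nonpos k hx]; positivity
  · refine (hV _ _ hx).trans ?_
    gcongr
    exact le_add_of_nonneg_right (by positivity)
  · simpa using walk_barrier_le hM r 0 0 δ x k

/-- The modulus of continuity of functions of growth less than `e^{ax}`, in a form that is stable
under the comparison principle: the first term is small compared with `e^{ax}`, and the second is a
supersolution of the walk. -/
def HasModulus (a ε C : ℝ) (V : ℝ → ℝ → ℝ) : Prop :=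
  ∀ t t' x x', x ≤ x' → |V t x - V t' x'| ≤ ε * Real.exp (a * x') + C * (|t - t'| + (x' - x))

variable {a ε C : ℝ}

/-- The scheme is small near the boundary, because the obstacle vanishes there. -/
theorem scheme_le_space_barrier (hδ : 0 < δ) (hε : 0 ≤ ε) (hC : 0 ≤ C) (hm : HasModulus a ε C V)
    (hV0 : ∀ t x, x ≤ 0 → V t x = 0) (k : ℕ) {x : ℝ} (hx : -δ < x) :
    scheme V δ k x ≤ ε * Real.exp (a * x + a ^ 2 * (k * timeStep δ)) + C * (x + δ) := by
  have hh := (timeStep_pos hδ).le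
  refine discrete_comparison
    (w := fun k x => ε * Real.exp (a * x + a ^ 2 * (k * timeStep δ)) + C * (x + δ)) hδ
    (fun k x hx => (scheme_succ_of_pos k hx).le) (fun x hx => ?_) (fun k x hx hx' => ?_)
    (fun k x hx => ?_) (fun k x hx => ?_) k hx
  · have := mul_nonneg hC (by linarith : 0 ≤ x + δ)
    rw [scheme_zero]; positivity
  · have := mul_nonneg hC (by linarith : 0 ≤ x + δ)
    rw [scheme_of_nonpos k hx']; positivity
  · have h1 := hm ((k + 1 : ℕ) * timeStep δ) ((k + 1 : ℕ) * timeStep δ) 0 x hx.le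
    rw [hV0 _ 0 le_rfl, sub_self, abs_zero, zero_sub, abs_neg] at h1
    have h2 := (le_abs_self _).trans h1
    have h3 : Real.exp (a * x) ≤ Real.exp (a * x + a ^ 2 * ((k + 1 : ℕ) * timeStep δ)) :=
      Real.exp_le_exp.2 (le_add_of_nonneg_right (by positivity))
    have h4 := mul_le_mul_of_nonneg_left h3 hε
    have h5 := mul_nonneg hC hδ.le
    linarith
  · have := walk_barrier_le hε a C (C * δ) δ x k
    simpa only [mul_add] using this

/-- The scheme is small near the initial time, because the obstacle is nonpositive there. -/
theorem scheme_le_time_barrier (hδ : 0 < δ) (hε : 0 ≤ ε) (hC : 0 ≤ C) (hm : HasModulus a ε C V)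
    (hVi : ∀ x, V 0 x ≤ 0) (k : ℕ) {x : ℝ} (hx : -δ < x) :
    scheme V δ k x ≤ ε * Real.exp (a * x + a ^ 2 * (k * timeStep δ)) + C * (k * timeStep δ) := by
  have hh := (timeStep_pos hδ).le
  refine discrete_comparison
    (w := fun k x => ε * Real.exp (a * x + a ^ 2 * (k * timeStep δ)) + C * (k * timeStep δ)) hδ
    (fun k x hx => (scheme_succ_of_pos k hx).le) (fun x hx => ?_) (fun k x hx hx' => ?_)
    (fun k x hx => ?_) (fun k x hx => ?_) k hx
  · rw [scheme_zero]; positivity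
  · rw [scheme_of_nonpos k hx']; positivity
  · have h1 := hm ((k + 1 : ℕ) * timeStep δ) 0 x x le_rfl
    rw [sub_zero, sub_self, add_zero,
      abs_of_nonneg (by positivity : 0 ≤ ((k + 1 : ℕ) : ℝ) * timeStep δ)] at h1
    have h2 := (le_abs_self _).trans h1
    have h3 : Real.exp (a * x) ≤ Real.exp (a * x + a ^ 2 * ((k + 1 : ℕ) * timeStep δ)) :=
      Real.exp_le_exp.2 (le_add_of_nonneg_right (by positivity))
    have h4 := mul_le_mul_of_nonneg_left h3 hε
    linarith [hVi x]
  · have h1 := walk_barrier_le hε a 0 (C * (k * timeStep δ)) δ x k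
    have h2 : C * (k * timeStep δ) ≤ C * ((k + 1 : ℕ) * timeStep δ) := by
      gcongr; simp
    simp only [zero_mul, zero_add] at h1
    linarith

/-- Comparison of the scheme with itself shifted in time. The error `E` is a supersolution of the
walk that dominates the variation of the obstacle. -/
theorem abs_scheme_time_sub_le (hδ : 0 < δ) (hε : 0 ≤ ε) (hC : 0 ≤ C) (hm : HasModulus a ε C V)
    (hVi : ∀ x, V 0 x ≤ 0) (j k : ℕ) {x : ℝ} (hx : -δ < x) :
    |scheme V δ (k + j) x - scheme V δ k x| ≤
      ε * Real.exp (a * x + a ^ 2 * ((k + j : ℕ) * timeStep δ)) + C * (j * timeStep δ) := by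
  have hh := (timeStep_pos hδ).le
  set c : ℝ := ε * Real.exp (a ^ 2 * (j * timeStep δ)) with hc_def
  have hc : 0 ≤ c := by positivity
  set E : ℕ → ℝ → ℝ := fun k x => c * Real.exp (a * x + a ^ 2 * (k * timeStep δ)) +
    (0 * x + C * (j * timeStep δ)) with hE_def
  have hE (k : ℕ) (x : ℝ) : E k x = ε * Real.exp (a * x + a ^ 2 * ((k + j : ℕ) * timeStep δ)) +
      C * (j * timeStep δ) := by
    simp only [hE_def, hc_def]
    rw [zero_mul, zero_add, mul_assoc, ← Real.exp_add]
    push_cast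
    ring_nf
  have hE0 (k : ℕ) (x : ℝ) : 0 ≤ E k x := by
    rw [hE]; positivity
  have hEw (k : ℕ) (x : ℝ) : walk δ (E k) x ≤ E (k + 1) x := walk_barrier_le hc a 0 _ δ x k
  have hEV (k : ℕ) (x : ℝ) : |V ((k + j + 1 : ℕ) * timeStep δ) x - V ((k + 1 : ℕ) * timeStep δ) x| ≤
      E (k + 1) x := by
    refine (hm _ _ x x le_rfl).trans ?_
    have e : ((k + j + 1 : ℕ) : ℝ) * timeStep δ - ((k + 1 : ℕ) : ℝ) * timeStep δ =
        j * timeStep δ := by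
      push_cast; ring
    rw [e, hE, sub_self, add_zero, abs_of_nonneg (by positivity : 0 ≤ (j : ℝ) * timeStep δ)]
    gcongr
    exact le_add_of_nonneg_right (by positivity)
  rw [abs_sub_le_iff, ← hE]
  constructor
  · have := discrete_comparison (A := fun k => scheme V δ (k + j))
      (w := fun k x => scheme V δ k x + E k x) (O := fun k => V ((k + j + 1 : ℕ) * timeStep δ)) hδ
      (fun k x hx => ?_) (fun x hx => ?_) (fun k x hx hx' => ?_)
      (fun k x hx => ?_) (fun k x hx => ?_) k hx
    · linarith
    · rw [show k + 1 + j = k + j + 1 by ring]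
      exact (scheme_succ_of_pos _ hx).le
    · rw [zero_add, scheme_zero, zero_add, hE, zero_add]
      exact scheme_le_time_barrier hδ hε hC hm hVi j hx
    · rw [scheme_of_nonpos _ hx', scheme_of_nonpos _ hx', zero_add]
      exact hE0 k x
    · linarith [(abs_le.1 (hEV k x)).2, obstacle_le_scheme (V := V) (δ := δ) k hx]
    · rw [walk_add]
      exact add_le_add (walk_scheme_le k hx) (hEw k x)
  · have := discrete_comparison (A := scheme V δ)
      (w := fun k x => scheme V δ (k + j) x + E k x) (O := fun k => V ((k + 1 : ℕ) * timeStep δ)) hδ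
      (fun k x hx => (scheme_succ_of_pos _ hx).le) (fun x hx => ?_) (fun k x hx hx' => ?_)
      (fun k x hx => ?_) (fun k x hx => ?_) k hx
    · linarith
    · rw [scheme_zero]
      exact add_nonneg (scheme_nonneg _ _) (hE0 _ _)
    · rw [scheme_of_nonpos _ hx']
      exact add_nonneg (scheme_nonneg _ _) (hE0 _ _)
    · have := obstacle_le_scheme (V := V) (δ := δ) (k + j) hx
      rw [show k + 1 + j = k + j + 1 by ring]
      linarith [(abs_le.1 (hEV k x)).1]
    · rw [walk_add, show k + 1 + j = k + j + 1 by ring]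
      exact add_le_add (walk_scheme_le (k + j) hx) (hEw k x)

/-- Comparison of the scheme with itself shifted in space. The shifted scheme need not vanish at
the boundary, but is small there by `scheme_le_space_barrier`. -/
theorem abs_scheme_space_sub_le (hδ : 0 < δ) (hε : 0 ≤ ε) (hC : 0 ≤ C) (hm : HasModulus a ε C V)
    (hV0 : ∀ t x, x ≤ 0 → V t x = 0) (k : ℕ) {x y : ℝ} (hy : 0 ≤ y) (hx : -δ < x) :
    |scheme V δ k (x + y) - scheme V δ k x| ≤
      ε * Real.exp (a * (x + y) + a ^ 2 * (k * timeStep δ)) + C * (y + δ) := by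
  have hh := (timeStep_pos hδ).le
  set c : ℝ := ε * Real.exp (a * y) with hc_def
  have hc : 0 ≤ c := by positivity
  set E : ℕ → ℝ → ℝ := fun k x => c * Real.exp (a * x + a ^ 2 * (k * timeStep δ)) +
    (0 * x + C * (y + δ)) with hE_def
  have hE (k : ℕ) (x : ℝ) : E k x = ε * Real.exp (a * (x + y) + a ^ 2 * (k * timeStep δ)) +
      C * (y + δ) := by
    simp only [hE_def, hc_def]
    rw [zero_mul, zero_add, mul_assoc, ← Real.exp_add]
    ring_nf
  have hE0 (k : ℕ) (x : ℝ) : 0 ≤ E k x := by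
    rw [hE]; positivity
  have hEw (k : ℕ) (x : ℝ) : walk δ (E k) x ≤ E (k + 1) x := walk_barrier_le hc a 0 _ δ x k
  have hEV (k : ℕ) (x : ℝ) :
      |V ((k + 1 : ℕ) * timeStep δ) x - V ((k + 1 : ℕ) * timeStep δ) (x + y)| ≤ E (k + 1) x := by
    refine (hm _ _ x (x + y) (by linarith)).trans ?_
    rw [hE, sub_self, abs_zero, zero_add, add_sub_cancel_left]
    gcongr
    · exact le_add_of_nonneg_right (by positivity)
    · linarith
  have hshift (k : ℕ) (x : ℝ) :
      walk δ (fun x => scheme V δ k (x + y)) x = walk δ (scheme V δ k) (x + y) := by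
    unfold walk
    ring_nf
  rw [abs_sub_le_iff, ← hE]
  constructor
  · have := discrete_comparison (A := fun k x => scheme V δ k (x + y))
      (w := fun k x => scheme V δ k x + E k x)
      (O := fun k x => V ((k + 1 : ℕ) * timeStep δ) (x + y)) hδ
      (fun k x hx => ?_) (fun x hx => ?_) (fun k x hx hx' => ?_)
      (fun k x hx => ?_) (fun k x hx => ?_) k hx
    · linarith
    · rw [hshift]
      exact (scheme_succ_of_pos _ (by linarith)).le
    · rw [scheme_zero, scheme_zero, zero_add]
      exact hE0 0 x
    · rw [scheme_of_nonpos _ hx', zero_add, hE]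
      refine (scheme_le_space_barrier hδ hε hC hm hV0 k (x := x + y) (by linarith)).trans ?_
      gcongr
      linarith
    · linarith [(abs_le.1 (hEV k x)).1, obstacle_le_scheme (V := V) (δ := δ) k hx]
    · rw [walk_add]
      exact add_le_add (walk_scheme_le k hx) (hEw k x)
  · have := discrete_comparison (A := scheme V δ)
      (w := fun k x => scheme V δ k (x + y) + E k x)
      (O := fun k => V ((k + 1 : ℕ) * timeStep δ)) hδ
      (fun k x hx => (scheme_succ_of_pos _ hx).le) (fun x hx => ?_) (fun k x hx hx' => ?_)
      (fun k x hx => ?_) (fun k x hx => ?_) k hx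
    · linarith
    · rw [scheme_zero]
      exact add_nonneg (scheme_nonneg _ _) (hE0 _ _)
    · rw [scheme_of_nonpos _ hx']
      exact add_nonneg (scheme_nonneg _ _) (hE0 _ _)
    · have hxy : 0 < x + y := by linarith
      linarith [(abs_le.1 (hEV k x)).2, obstacle_le_scheme (V := V) (δ := δ) k hxy]
    · rw [walk_add, hshift]
      exact add_le_add (walk_scheme_le k (by linarith)) (hEw k x)

/-- The modulus of continuity of the scheme, up to an error due to the lattice. -/
theorem abs_scheme_sub_le (hδ : 0 < δ) (hε : 0 ≤ ε) (hC : 0 ≤ C) (hm : HasModulus a ε C V)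
    (ha : 0 ≤ a) (hV0 : ∀ t x, x ≤ 0 → V t x = 0) (hVi : ∀ x, V 0 x ≤ 0) {S R : ℝ} {k k' : ℕ}
    (hk : k * timeStep δ ≤ S) (hk' : k' * timeStep δ ≤ S) {x x' : ℝ} (hx : x ∈ Icc 0 R)
    (hx' : x' ∈ Icc 0 R) :
    |scheme V δ k x - scheme V δ k' x'| ≤ 2 * ε * Real.exp (a * R + a ^ 2 * S) +
      C * (|k * timeStep δ - k' * timeStep δ| + |x - x'| + δ) := by
  have hh := timeStep_pos hδ
  have hspace : |scheme V δ k' x - scheme V δ k' x'| ≤ ε * Real.exp (a * R + a ^ 2 * S) +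
      C * (|x - x'| + δ) := by
    wlog hxx : x ≤ x' generalizing x x'
    · rw [abs_sub_comm, abs_sub_comm x]
      exact this hx' hx (le_of_not_ge hxx)
    obtain ⟨y, rfl⟩ : ∃ y, x' = x + y := ⟨x' - x, by ring⟩
    have hy : 0 ≤ y := by linarith
    rw [abs_sub_comm]
    refine (abs_scheme_space_sub_le hδ hε hC hm hV0 k' hy (by linarith [hx.1])).trans ?_
    rw [sub_add_cancel_left, abs_neg, abs_of_nonneg hy]
    gcongr
    exact hx'.2
  have htime : |scheme V δ k x - scheme V δ k' x| ≤ ε * Real.exp (a * R + a ^ 2 * S) +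
      C * |k * timeStep δ - k' * timeStep δ| := by
    clear hspace
    wlog hkk : k' ≤ k generalizing k k'
    · rw [abs_sub_comm, abs_sub_comm (k * timeStep δ)]
      exact this hk' hk (le_of_not_ge hkk)
    obtain ⟨j, rfl⟩ := Nat.exists_eq_add_of_le hkk
    refine (abs_scheme_time_sub_le hδ hε hC hm hVi j k' (by linarith [hx.1])).trans ?_
    have e : ((k' + j : ℕ) : ℝ) * timeStep δ - k' * timeStep δ = j * timeStep δ := by
      push_cast; ring
    rw [e]
    gcongr
    · exact hx.2
    · exact le_abs_self _
  refine (abs_sub_le _ (scheme V δ k' x) _).trans ?_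
  linarith

end scheme

/-! ### The limit of the scheme -/

/-- Any rate above `|r|` makes the values far out negligible; on the remaining compact set the
modulus is that of uniform continuity. -/
theorem IsObstacle.exists_hasModulus (hT : 0 ≤ T) {v : CSpace r T} (hv : IsObstacle v) {ε : ℝ}
    (hε : 0 < ε) : ∃ C, 0 ≤ C ∧ HasModulus (|r| + 1) ε C (extend hT v) := by
  obtain ⟨M, hM0, hM⟩ := exists_extend_bound hT v
  set V := extend hT v with hV
  have hM' (t x x' : ℝ) (hxx : x ≤ x') (hx' : 0 ≤ x') : |V t x| ≤ M * Real.exp (|r| * x') := by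
    rcases le_total x 0 with h | h
    · rw [hV, hv.extend_eq_zero hT t h, abs_zero]
      positivity
    · refine (hM t x h).trans ?_
      have h1 : r * x ≤ |r| * x' :=
        (mul_le_mul_of_nonneg_right (le_abs_self r) h).trans (by gcongr)
      gcongr
  set R := 2 * M / ε with hR
  have hR0 : 0 ≤ R := by positivity
  have hV2 : Continuous fun p : ℝ × ℝ => V p.1 p.2 := continuous_extend hT v
  have hK : IsCompact (Icc 0 T ×ˢ Icc 0 R) := isCompact_Icc.prod isCompact_Icc
  obtain ⟨ρ, hρ, hρV⟩ := Metric.uniformContinuousOn_iff_le.1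
    (hK.uniformContinuousOn_of_continuous hV2.continuousOn) ε hε
  refine ⟨2 * (M * Real.exp (|r| * R)) / ρ, by positivity, fun t t' x x' hxx => ?_⟩
  have hCnn : 0 ≤ 2 * (M * Real.exp (|r| * R)) / ρ * (|t - t'| + (x' - x)) :=
    mul_nonneg (by positivity) (add_nonneg (abs_nonneg _) (sub_nonneg.2 hxx))
  rcases le_total x' 0 with hx' | hx'
  · rw [hV, hv.extend_eq_zero hT t (hxx.trans hx'), hv.extend_eq_zero hT t' hx', sub_self, abs_zero]
    positivity
  have htri : |V t x - V t' x'| ≤ |V t x| + |V t' x'| := abs_sub _ _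
  have hb1 := hM' t x x' hxx hx'
  have hb2 := hM' t' x' x' le_rfl hx'
  rcases le_total R x' with hRx | hRx
  · have := exp_growth_le (r := |r|) (a := |r| + 1) hε (by positivity : 0 ≤ 2 * M) le_rfl hRx
    linarith
  · rcases le_or_gt (|t - t'| + (x' - x)) ρ with hd | hd
    · have hx0 : max x 0 ≤ R := max_le (hxx.trans hRx) hR0
      have e1 : V t x = V (projIcc 0 T hT t) (max x 0) := by
        simp only [hV, extend]
        rw [projIcc_val]
        congr 2
        exact Subtype.ext (by simp [projIci, max_comm])
      have e2 : V t' x' = V (projIcc 0 T hT t') x' := by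
        simp only [hV, extend]
        rw [projIcc_val]
      have h1 : |(projIcc 0 T hT t : ℝ) - projIcc 0 T hT t'| ≤ |t - t'| :=
        abs_projIcc_sub_projIcc hT
      have h2 : |max x 0 - x'| ≤ x' - x := by
        rw [abs_le]
        constructor
        · linarith [le_max_left x 0]
        · linarith [max_le hxx hx']
      have h3 := hρV ((projIcc 0 T hT t : ℝ), max x 0)
        ⟨(projIcc 0 T hT t).2, le_max_right _ _, hx0⟩ ((projIcc 0 T hT t' : ℝ), x')
        ⟨(projIcc 0 T hT t').2, hx', hRx⟩ ?_
      · rw [Real.dist_eq] at h3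
        rw [e1, e2]
        have h4 : ε ≤ ε * Real.exp ((|r| + 1) * x') :=
          le_mul_of_one_le_right hε.le (Real.one_le_exp (by positivity))
        linarith
      · rw [Prod.dist_eq, Real.dist_eq, Real.dist_eq]
        exact max_le (by linarith) (by linarith [abs_nonneg (t - t')])
    · have h3 : 2 * (M * Real.exp (|r| * R)) ≤
          2 * (M * Real.exp (|r| * R)) / ρ * (|t - t'| + (x' - x)) := by
        rw [div_mul_eq_mul_div, le_div_iff₀ hρ]
        gcongr
      have h4 : M * Real.exp (|r| * x') ≤ M * Real.exp (|r| * R) := by gcongr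
      have h5 : 0 ≤ ε * Real.exp ((|r| + 1) * x') := by positivity
      linarith

/-- The sequence of step sizes. -/
noncomputable def stepSize (n : ℕ) : ℝ := 1 / ((n : ℝ) + 1)

theorem stepSize_pos (n : ℕ) : 0 < stepSize n := Nat.one_div_pos_of_nat

theorem timeStep_stepSize_pos (n : ℕ) : 0 < timeStep (stepSize n) := timeStep_pos (stepSize_pos n)

theorem timeStep_stepSize_le (n : ℕ) : timeStep (stepSize n) ≤ stepSize n := by
  have h1 : stepSize n ≤ 1 := by
    rw [stepSize, div_le_one (by positivity)]
    linarith [Nat.cast_nonneg (α := ℝ) n]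
  have h0 := stepSize_pos n
  unfold timeStep
  nlinarith

/-- A non-principal ultrafilter on the indices, along which all bounded sequences converge. -/
noncomputable abbrev U : Ultrafilter ℕ := hyperfilter ℕ

theorem tendsto_stepSize : Tendsto stepSize U (𝓝 0) :=
  tendsto_one_div_add_atTop_nhds_zero_nat.mono_left Nat.hyperfilter_le_atTop

theorem tendsto_timeStep : Tendsto (fun n => timeStep (stepSize n)) U (𝓝 0) :=
  squeeze_zero (fun n => (timeStep_stepSize_pos n).le) timeStep_stepSize_le tendsto_stepSize

/-- A sequence that is bounded along the ultrafilter has a limit along it. -/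
theorem exists_tendsto_U {f : ℕ → ℝ} {A B : ℝ} (h : ∀ᶠ n in U, f n ∈ Icc A B) :
    ∃ l, Tendsto f U (𝓝 l) := by
  obtain ⟨l, -, hl⟩ := isCompact_Icc.ultrafilter_le_nhds (U.map f) (le_principal_iff.2 h)
  exact ⟨l, hl⟩

/-- The number of steps of the scheme up to time `t`. -/
noncomputable def steps (n : ℕ) (t : ℝ) : ℕ := ⌊t / timeStep (stepSize n)⌋₊

theorem steps_mul_le (n : ℕ) {t : ℝ} (ht : 0 ≤ t) : steps n t * timeStep (stepSize n) ≤ t := by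
  have h := timeStep_stepSize_pos n
  rw [← le_div_iff₀ h]
  exact Nat.floor_le (by positivity)

theorem lt_steps_succ_mul (n : ℕ) (t : ℝ) : t < (steps n t + 1) * timeStep (stepSize n) := by
  rw [← div_lt_iff₀ (timeStep_stepSize_pos n)]
  exact Nat.lt_floor_add_one _

theorem abs_steps_mul_sub_le (n : ℕ) {t : ℝ} (ht : 0 ≤ t) :
    |steps n t * timeStep (stepSize n) - t| ≤ timeStep (stepSize n) := by
  rw [abs_le]
  constructor <;> linarith [steps_mul_le n ht, lt_steps_succ_mul n t, timeStep_stepSize_pos n]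

/-- The scheme with the `n`-th step size, as a function of time and space. -/
noncomputable def approx (V : ℝ → ℝ → ℝ) (n : ℕ) (t x : ℝ) : ℝ :=
  scheme V (stepSize n) (steps n t) x

/-- The limit of the scheme along the ultrafilter. -/
noncomputable def limitValue (V : ℝ → ℝ → ℝ) (t x : ℝ) : ℝ :=
  limUnder (U : Filter ℕ) fun n => approx V n t x

theorem exists_approx_le (hT : 0 ≤ T) (v : CSpace r T) :
    ∃ M, 0 ≤ M ∧ ∀ n t x, t ∈ Icc 0 T → 0 ≤ x →
      approx (extend hT v) n t x ≤ M * Real.exp (r * x) := by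
  obtain ⟨M, hM0, hM⟩ := exists_extend_bound hT v
  refine ⟨M * Real.exp (r ^ 2 * T), by positivity, fun n t x ht hx => ?_⟩
  refine (scheme_le_exp (r := r) (stepSize_pos n) hM0
    (fun t x hx => (le_abs_self _).trans (hM t x hx.le)) _ (by linarith [stepSize_pos n])).trans ?_
  rw [mul_assoc, ← Real.exp_add, add_comm]
  gcongr
  exact (steps_mul_le n ht.1).trans ht.2

theorem tendsto_approx (hT : 0 ≤ T) {v : CSpace r T} {t x : ℝ} (ht : t ∈ Icc 0 T) (hx : 0 ≤ x) :
    Tendsto (fun n => approx (extend hT v) n t x) U (𝓝 (limitValue (extend hT v) t x)) := by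
  obtain ⟨M, hM0, hM⟩ := exists_approx_le hT v
  exact tendsto_nhds_limUnder (exists_tendsto_U (A := 0) (B := M * Real.exp (r * x))
    (Eventually.of_forall fun n => ⟨scheme_nonneg _ _, hM n t x ht hx⟩))

theorem abs_limitValue_sub_le (hT : 0 ≤ T) {v : CSpace r T} (hv : IsObstacle v)
    {ε C : ℝ} (hε : 0 ≤ ε) (hC : 0 ≤ C) (hm : HasModulus (|r| + 1) ε C (extend hT v))
    {R t t' x x' : ℝ} (ht : t ∈ Icc 0 T) (ht' : t' ∈ Icc 0 T) (hx : x ∈ Icc 0 R)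
    (hx' : x' ∈ Icc 0 R) : |limitValue (extend hT v) t x - limitValue (extend hT v) t' x'| ≤
      2 * ε * Real.exp ((|r| + 1) * R + (|r| + 1) ^ 2 * T) + C * (|t - t'| + |x - x'|) := by
  have h1 := ((tendsto_approx hT (v := v) ht hx.1).sub (tendsto_approx hT (v := v) ht' hx'.1)).abs
  have h2 : Tendsto (fun n => 2 * ε * Real.exp ((|r| + 1) * R + (|r| + 1) ^ 2 * T) +
      C * (|t - t'| + 2 * timeStep (stepSize n) + |x - x'| + stepSize n)) U
      (𝓝 (2 * ε * Real.exp ((|r| + 1) * R + (|r| + 1) ^ 2 * T) +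
        C * (|t - t'| + 2 * 0 + |x - x'| + 0))) :=
    ((((tendsto_timeStep.const_mul 2).const_add |t - t'|).add_const |x - x'|).add
      tendsto_stepSize).const_mul C |>.const_add _
  rw [mul_zero, add_zero, add_zero] at h2
  refine le_of_tendsto_of_tendsto h1 h2 (Eventually.of_forall fun n => ?_)
  refine (abs_scheme_sub_le (stepSize_pos n) hε hC hm (by positivity)
    (fun t x hx => hv.extend_eq_zero hT t hx) (fun x => hv.extend_nonpos hT le_rfl x)
    ((steps_mul_le n ht.1).trans ht.2) ((steps_mul_le n ht'.1).trans ht'.2) hx hx').trans ?_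
  beta_reduce
  have h3 := abs_steps_mul_sub_le n ht.1
  have h4 := abs_steps_mul_sub_le n ht'.1
  have h5 : |steps n t * timeStep (stepSize n) - steps n t' * timeStep (stepSize n)| ≤
      |t - t'| + 2 * timeStep (stepSize n) := by
    rw [abs_le] at h3 h4 ⊢
    constructor <;> linarith [neg_abs_le (t - t'), le_abs_self (t - t')]
  gcongr

/-- The constants of the modulus of continuity for a prescribed error. -/
theorem exists_modulus_const (hT : 0 ≤ T) {v : CSpace r T} (hv : IsObstacle v) (R : ℝ)
    {e : ℝ} (he : 0 < e) : ∃ ε C, 0 ≤ ε ∧ 0 ≤ C ∧ HasModulus (|r| + 1) ε C (extend hT v) ∧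
    2 * ε * Real.exp ((|r| + 1) * R + (|r| + 1) ^ 2 * T) = e := by
  set E := Real.exp ((|r| + 1) * R + (|r| + 1) ^ 2 * T) with hE
  have hE0 : 0 < E := Real.exp_pos _
  obtain ⟨C, hC, hm⟩ := hv.exists_hasModulus hT (ε := e / (2 * E)) (by positivity)
  exact ⟨_, C, by positivity, hC, hm, by field_simp⟩

theorem continuousOn_limitValue (hT : 0 ≤ T) {v : CSpace r T} (hv : IsObstacle v) :
    ContinuousOn (fun p : ℝ × ℝ => limitValue (extend hT v) p.1 p.2) (Icc 0 T ×ˢ Ici 0) := by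
  rintro ⟨t, x⟩ ⟨ht, hx⟩
  refine Metric.continuousWithinAt_iff.2 fun e he => ?_
  obtain ⟨ε, C, hε, hC, hm, hεe⟩ := exists_modulus_const hT hv (x + 1) (half_pos he)
  refine ⟨min 1 (e / (4 * (C + 1))), by positivity, ?_⟩
  rintro ⟨t', x'⟩ ⟨ht', hx'⟩ hd
  simp only at ht hx ht' hx'
  rw [Prod.dist_eq, max_lt_iff, Real.dist_eq, Real.dist_eq, lt_min_iff, lt_min_iff] at hd
  have h1 := abs_limitValue_sub_le hT hv hε hC hm (R := x + 1) ht' ht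
    ⟨hx', by linarith [(abs_lt.1 hd.2.1).2]⟩ ⟨hx, by linarith⟩
  rw [hεe] at h1
  rw [Real.dist_eq]
  refine h1.trans_lt ?_
  have h2 : C * (|t' - t| + |x' - x|) ≤ C * (e / (4 * (C + 1)) + e / (4 * (C + 1))) := by
    gcongr
    exacts [hd.1.2.le, hd.2.2.le]
  have h3 : C * (e / (4 * (C + 1)) + e / (4 * (C + 1))) < e / 2 := by
    rw [← add_div, mul_div_assoc', div_lt_iff₀ (by positivity)]
    nlinarith
  linarith

/-- The limit of the scheme is a function of the right class, with the right boundary and initial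
values, above the obstacle. -/
theorem exists_limit (hT : 0 ≤ T) {v : CSpace r T} (hv : IsObstacle v) : ∃ z : CSpace r T,
    (∀ t ∈ Icc 0 T, ∀ x, 0 ≤ x → extend hT z t x = limitValue (extend hT v) t x) ∧
    (∀ t ∈ Icc 0 T, extend hT z t 0 = 0) ∧ (∀ x, 0 ≤ x → extend hT z 0 x = 0) ∧
    (∀ t ∈ Icc 0 T, ∀ x, 0 ≤ x → extend hT v t x ≤ extend hT z t x) := by
  have hlim : ∀ t ∈ Icc 0 T, ∀ x, 0 ≤ x → Tendsto (fun n => approx (extend hT v) n t x) U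
      (𝓝 (limitValue (extend hT v) t x)) := fun t ht x hx => tendsto_approx hT ht hx
  have h0 : ∀ t ∈ Icc 0 T, ∀ x, 0 ≤ x → 0 ≤ limitValue (extend hT v) t x := fun t ht x hx =>
    ge_of_tendsto' (hlim t ht x hx) fun n => scheme_nonneg _ _
  obtain ⟨M, hM0, hM⟩ := exists_approx_le hT v
  obtain ⟨z, hz⟩ := exists_cspace_eq (r := r) (T := T) (limitValue (extend hT v))
    (continuousOn_limitValue hT hv) (M := M) fun t ht x hx => by
      rw [abs_of_nonneg (h0 t ht x hx)]
      exact le_of_tendsto' (hlim t ht x hx) fun n => hM n t x ht hx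
  have hz' : ∀ t ∈ Icc 0 T, ∀ x, 0 ≤ x → extend hT z t x = limitValue (extend hT v) t x :=
    fun t ht x hx => by
      rw [extend_of_mem hT z ht hx]
      exact hz _
  refine ⟨z, hz', fun t ht => ?_, fun x hx => ?_, fun t ht x hx => ?_⟩
  · rw [hz' t ht 0 le_rfl]
    refine tendsto_nhds_unique (hlim t ht 0 le_rfl) (tendsto_const_nhds.congr fun n => ?_)
    exact (scheme_of_nonpos _ le_rfl).symm
  · rw [hz' 0 ⟨le_rfl, hT⟩ x hx]
    refine tendsto_nhds_unique (hlim 0 ⟨le_rfl, hT⟩ x hx) (tendsto_const_nhds.congr fun n => ?_)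
    rw [approx, steps, zero_div, Nat.floor_zero, scheme_zero]
  · rw [hz' t ht x hx]
    rcases hx.eq_or_lt with rfl | hx
    · rw [hv.extend_eq_zero hT t le_rfl]
      exact h0 t ht 0 le_rfl
    have hst : Tendsto (fun n => (steps n t : ℝ) * timeStep (stepSize n)) U (𝓝 t) := by
      refine tendsto_iff_dist_tendsto_zero.2 (squeeze_zero (fun _ => dist_nonneg) (fun n => ?_)
        tendsto_timeStep)
      exact abs_steps_mul_sub_le n ht.1
    have hVt : Tendsto (fun n => extend hT v (steps n t * timeStep (stepSize n)) x) U
        (𝓝 (extend hT v t x)) :=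
      ((continuous_extend hT v).comp (by fun_prop : Continuous fun t : ℝ => (t, x))).continuousAt
        |>.tendsto.comp hst
    refine le_of_tendsto_of_tendsto' hVt (hlim t ht x hx.le) fun n => ?_
    unfold approx
    rcases steps n t with _ | k
    · rw [scheme_zero, Nat.cast_zero, zero_mul]
      exact hv.extend_nonpos hT le_rfl x
    · exact obstacle_le_scheme k hx

/-- Along the ultrafilter, the scheme converges to its limit uniformly on compact sets. -/
theorem eventually_abs_scheme_sub_le (hT : 0 ≤ T) {v : CSpace r T} (hv : IsObstacle v)
    {z : CSpace r T}
    (hz : ∀ t ∈ Icc 0 T, ∀ x, 0 ≤ x → extend hT z t x = limitValue (extend hT v) t x)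
    (R : ℝ) {e : ℝ} (he : 0 < e) : ∀ᶠ n in U, ∀ k : ℕ, k * timeStep (stepSize n) ≤ T →
      ∀ x ∈ Icc 0 R, ∀ s ∈ Icc 0 T, |s - k * timeStep (stepSize n)| ≤ timeStep (stepSize n) →
        |scheme (extend hT v) (stepSize n) k x - extend hT z s x| ≤ e := by
  obtain ⟨ε, C, hε, hC, hm, hεe⟩ := exists_modulus_const hT hv R (e := e / 8) (by positivity)
  obtain ⟨ρ, hρ, hρe⟩ : ∃ ρ > 0, 8 * (C * ρ) ≤ e / 2 := by
    refine ⟨e / (16 * (C + 1)), by positivity, ?_⟩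
    rw [mul_div_assoc', mul_div_assoc', div_le_div_iff₀ (by positivity) two_pos]
    nlinarith
  obtain ⟨N, hNK, hNf, hNc⟩ := (isCompact_Icc.prod isCompact_Icc :
    IsCompact (Icc (0 : ℝ) T ×ˢ Icc (0 : ℝ) R)).finite_cover_balls hρ
  have hev : ∀ᶠ n in U, ∀ q ∈ N, |approx (extend hT v) n q.1 q.2 -
      limitValue (extend hT v) q.1 q.2| < e / 8 := by
    rw [eventually_all_finite hNf]
    intro q hq
    have := tendsto_approx hT (v := v) (hNK hq).1 (hNK hq).2.1
    exact (Metric.tendsto_nhds.1 this) (e / 8) (by positivity)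
  filter_upwards [hev, tendsto_stepSize.eventually (gt_mem_nhds hρ)] with n hn hδ
  intro k hk x hx s hs hsk
  obtain ⟨q, hq, hqd⟩ := mem_iUnion₂.1 (hNc (show (s, x) ∈ _ from ⟨hs, hx⟩))
  rw [Metric.mem_ball, Prod.dist_eq, max_lt_iff, Real.dist_eq, Real.dist_eq] at hqd
  simp only at hqd
  have hqt := (hNK hq).1
  have hqx := (hNK hq).2
  have h1 := abs_scheme_sub_le (stepSize_pos n) hε hC hm (by positivity)
    (fun t x hx => hv.extend_eq_zero hT t hx) (fun x => hv.extend_nonpos hT le_rfl x)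
    hk ((steps_mul_le n hqt.1).trans hqt.2) hx hqx
  have h2 := hn q hq
  have h3 := abs_limitValue_sub_le hT hv hε hC hm hqt hs hqx hx
  rw [hεe] at h1 h3
  rw [hz s hs x hx.1]
  have h4 := timeStep_stepSize_le n
  have h5 : |k * timeStep (stepSize n) - steps n q.1 * timeStep (stepSize n)| ≤ 3 * ρ := by
    have h6 := abs_le.1 (abs_steps_mul_sub_le n hqt.1)
    have h7 := abs_lt.1 hqd.1
    have h8 := abs_le.1 hsk
    rw [abs_le]
    constructor <;> linarith
  have h9 : C * (|k * timeStep (stepSize n) - steps n q.1 * timeStep (stepSize n)| + |x - q.2| +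
      stepSize n) ≤ C * (3 * ρ + ρ + ρ) := by
    gcongr
    exact hqd.2.le
  have h10 : C * (|q.1 - s| + |q.2 - x|) ≤ C * (ρ + ρ) := by
    rw [abs_sub_comm q.1, abs_sub_comm q.2]
    gcongr
    exacts [hqd.1.le, hqd.2.le]
  have h11 := abs_le.1 (h1.trans (add_le_add_right h9 _))
  have h12 := abs_lt.1 h2
  have h13 := abs_le.1 (h3.trans (add_le_add_right h10 _))
  unfold approx at h12
  rw [abs_le]
  have : 0 ≤ C * ρ := by positivity
  constructor <;> linarith [h11.1, h11.2, h12.1, h12.2, h13.1, h13.2]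

/-! ### The weak equation for the scheme and its limit -/

/-- The amount by which the obstacle raises the scheme in the step from `k` to `k + 1`. -/
noncomputable def push (V : ℝ → ℝ → ℝ) (δ : ℝ) (k : ℕ) (x : ℝ) : ℝ :=
  if x ≤ 0 then 0 else scheme V δ (k + 1) x - walk δ (scheme V δ k) x

theorem push_of_pos {V : ℝ → ℝ → ℝ} {δ : ℝ} (k : ℕ) {x : ℝ} (hx : 0 < x) :
    push V δ k x = scheme V δ (k + 1) x - walk δ (scheme V δ k) x := if_neg (not_le.2 hx)

theorem push_nonneg (V : ℝ → ℝ → ℝ) (δ : ℝ) (k : ℕ) (x : ℝ) : 0 ≤ push V δ k x := by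
  unfold push
  split_ifs with h
  · exact le_rfl
  · exact sub_nonneg.2 (walk_scheme_le k (not_le.1 h))

theorem push_le_scheme (V : ℝ → ℝ → ℝ) (δ : ℝ) (k : ℕ) (x : ℝ) :
    push V δ k x ≤ scheme V δ (k + 1) x := by
  unfold push
  split_ifs with h
  · exact scheme_nonneg _ _
  · exact sub_le_self _ (div_nonneg (add_nonneg (scheme_nonneg _ _) (scheme_nonneg _ _))
      zero_le_two)

/-- The scheme is only pushed where it sits on the obstacle. -/
theorem scheme_eq_of_push_ne_zero {V : ℝ → ℝ → ℝ} {δ : ℝ} {k : ℕ} {x : ℝ} (hx : 0 < x)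
    (h : push V δ k x ≠ 0) : scheme V δ (k + 1) x = V ((k + 1 : ℕ) * timeStep δ) x := by
  rw [push_of_pos k hx, scheme_succ_of_pos k hx] at h
  rw [scheme_succ_of_pos k hx]
  rcases max_choice (V ((k + 1 : ℕ) * timeStep δ) x) (walk δ (scheme V δ k) x) with h' | h'
  · exact h'
  · rw [h', sub_self] at h
    exact absurd rfl h

theorem measurable_push {V : ℝ → ℝ → ℝ} (hV : ∀ t, Continuous (V t)) (δ : ℝ) (k : ℕ) :
    Measurable (push V δ k) := by
  have ih := measurable_scheme (δ := δ) hV k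
  refine Measurable.ite measurableSet_Iic measurable_const ((measurable_scheme hV _).sub ?_)
  exact ((ih.comp (measurable_id.add_const δ)).add
    (ih.comp (measurable_id.sub_const δ))).div_const 2

section integrals

variable {V : ℝ → ℝ → ℝ} {δ M : ℝ}

theorem integrable_mul_of_abs_le {f g ψ : ℝ → ℝ} (hf : Measurable f) (hg : Continuous g)
    (hfg : ∀ x, |f x| ≤ g x) (hψ : Continuous ψ) (hc : HasCompactSupport ψ) :
    Integrable fun x => f x * ψ x := by
  refine ((hg.mul hψ).integrable_of_hasCompactSupport hc.mul_left).mono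
    (hf.mul hψ.measurable).aestronglyMeasurable (Eventually.of_forall fun x => ?_)
  rw [Pi.mul_apply, norm_mul, norm_mul]
  gcongr
  exact (hfg x).trans (le_abs_self _)

theorem abs_scheme_le (hδ : 0 < δ) (hM : 0 ≤ M) (hVM : ∀ t x, 0 < x → V t x ≤ M * Real.exp (r * x))
    (k : ℕ) (x : ℝ) :
    |scheme V δ k x| ≤ M * Real.exp (r * x + r ^ 2 * (k * timeStep δ)) := by
  rw [abs_of_nonneg (scheme_nonneg _ _)]
  rcases le_or_gt x 0 with h | h
  · rw [scheme_of_nonpos _ h]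
    positivity
  · exact scheme_le_exp hδ hM hVM k (by linarith)

theorem integrable_scheme_mul (hV : ∀ t, Continuous (V t)) (hδ : 0 < δ) (hM : 0 ≤ M)
    (hVM : ∀ t x, 0 < x → V t x ≤ M * Real.exp (r * x)) (k : ℕ) {ψ : ℝ → ℝ} (hψ : Continuous ψ)
    (hc : HasCompactSupport ψ) : Integrable fun x => scheme V δ k x * ψ x :=
  integrable_mul_of_abs_le (measurable_scheme hV k)
    (g := fun x => M * Real.exp (r * x + r ^ 2 * (k * timeStep δ))) (by fun_prop)
    (abs_scheme_le hδ hM hVM k) hψ hc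

theorem integrable_push_mul (hV : ∀ t, Continuous (V t)) (hδ : 0 < δ) (hM : 0 ≤ M)
    (hVM : ∀ t x, 0 < x → V t x ≤ M * Real.exp (r * x)) (k : ℕ) {ψ : ℝ → ℝ} (hψ : Continuous ψ)
    (hc : HasCompactSupport ψ) : Integrable fun x => push V δ k x * ψ x :=
  integrable_mul_of_abs_le (measurable_push hV δ k)
    (g := fun x => M * Real.exp (r * x + r ^ 2 * ((k + 1 : ℕ) * timeStep δ))) (by fun_prop)
    (fun x => by
      rw [abs_of_nonneg (push_nonneg _ _ _ _)]
      exact (push_le_scheme _ _ _ _).trans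
        ((le_abs_self _).trans (abs_scheme_le hδ hM hVM (k + 1) x))) hψ hc

theorem hasCompactSupport_comp_add {ψ : ℝ → ℝ} (hc : HasCompactSupport ψ) (s : ℝ) :
    HasCompactSupport fun x => ψ (x + s) :=
  hc.comp_homeomorph (Homeomorph.addRight s)

theorem continuous_walk {ψ : ℝ → ℝ} (hψ : Continuous ψ) (δ : ℝ) : Continuous (walk δ ψ) := by
  unfold walk
  fun_prop

theorem hasCompactSupport_walk {ψ : ℝ → ℝ} (hc : HasCompactSupport ψ) (δ : ℝ) :
    HasCompactSupport (walk δ ψ) := by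
  have h1 := hasCompactSupport_comp_add hc δ
  have h2 := hasCompactSupport_comp_add hc (-δ)
  have h3 : HasCompactSupport fun x => (ψ (x + δ) + ψ (x + -δ)) * (1 / 2) :=
    (h1.add h2).mul_right
  have e : walk δ ψ = fun x => (ψ (x + δ) + ψ (x + -δ)) * (1 / 2) := by
    ext x
    simp only [walk, sub_eq_add_neg]
    ring
  rwa [e]

theorem integral_scheme_succ (hV : ∀ t, Continuous (V t)) (hδ : 0 < δ) (hM : 0 ≤ M)
    (hVM : ∀ t x, 0 < x → V t x ≤ M * Real.exp (r * x)) (k : ℕ) {φ : ℝ → ℝ} (hφ : Continuous φ)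
    (hc : HasCompactSupport φ) (h0 : ∀ x ≤ 0, φ x = 0) :
    ∫ x, scheme V δ (k + 1) x * φ x =
      (∫ x, scheme V δ k x * walk δ φ x) + ∫ x, push V δ k x * φ x := by
  have hp := integrable_push_mul hV hδ hM hVM k hφ hc
  have h1 := integrable_scheme_mul hV hδ hM hVM k (ψ := fun x => φ (x + δ)) (by fun_prop)
    (hasCompactSupport_comp_add hc δ)
  have h2 := integrable_scheme_mul hV hδ hM hVM k (ψ := fun x => φ (x + -δ)) (by fun_prop)
    (hasCompactSupport_comp_add hc (-δ))
  have h1' : Integrable fun x => scheme V δ k (x - δ) * φ x := by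
    simpa using h1.comp_sub_right δ
  have h2' : Integrable fun x => scheme V δ k (x + δ) * φ x := by
    simpa using h2.comp_add_right δ
  have e1 : ∫ x, scheme V δ k (x - δ) * φ x = ∫ x, scheme V δ k x * φ (x + δ) := by
    rw [← integral_sub_right_eq_self (fun x => scheme V δ k x * φ (x + δ)) δ]
    simp
  have e2 : ∫ x, scheme V δ k (x + δ) * φ x = ∫ x, scheme V δ k x * φ (x + -δ) := by
    rw [← integral_add_right_eq_self (fun x => scheme V δ k x * φ (x + -δ)) δ]
    simp
  have e3 : ∫ x, scheme V δ k x * walk δ φ x =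
      ((∫ x, scheme V δ k x * φ (x + δ)) + ∫ x, scheme V δ k x * φ (x + -δ)) / 2 := by
    rw [← integral_add h1 h2, ← integral_div]
    refine integral_congr_ae (Eventually.of_forall fun x => ?_)
    simp only [walk, sub_eq_add_neg]
    ring
  have e4 (x : ℝ) : scheme V δ (k + 1) x * φ x =
      (scheme V δ k (x + δ) * φ x + scheme V δ k (x - δ) * φ x) / 2 + push V δ k x * φ x := by
    rcases le_or_gt x 0 with h | h
    · rw [h0 x h]; ring
    · rw [push_of_pos k h, walk]; ring
  simp only [e4]
  have h12 : Integrable fun x =>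
      (scheme V δ k (x + δ) * φ x + scheme V δ k (x - δ) * φ x) / 2 := (h2'.add h1').div_const 2
  rw [integral_add h12 hp, integral_div, integral_add h2' h1', e1, e2, e3]
  ring

/-- Summation by parts in time, with the symmetric walk moved to the test function. -/
theorem sum_integral_push (hV : ∀ t, Continuous (V t)) (hδ : 0 < δ) (hM : 0 ≤ M)
    (hVM : ∀ t x, 0 < x → V t x ≤ M * Real.exp (r * x)) {φ : ℝ → ℝ} (hφ : Continuous φ)
    (hc : HasCompactSupport φ) (h0 : ∀ x ≤ 0, φ x = 0) (K : ℕ) :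
    ∑ k ∈ Finset.range K, ∫ x, push V δ k x * φ x = (∫ x, scheme V δ K x * φ x) -
      ∑ k ∈ Finset.range K, ∫ x, scheme V δ k x * (walk δ φ x - φ x) := by
  induction K with
  | zero => simp [scheme_zero]
  | succ K ih =>
    have h1 : ∫ x, scheme V δ K x * (walk δ φ x - φ x) =
        (∫ x, scheme V δ K x * walk δ φ x) - ∫ x, scheme V δ K x * φ x := by
      rw [← integral_sub (integrable_scheme_mul hV hδ hM hVM K (continuous_walk hφ δ)
        (hasCompactSupport_walk hc δ)) (integrable_scheme_mul hV hδ hM hVM K hφ hc)]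
      simp only [mul_sub]
    rw [Finset.sum_range_succ, Finset.sum_range_succ, ih, h1,
      integral_scheme_succ hV hδ hM hVM K hφ hc h0]
    ring

end integrals

/-- The generator of the random walk is consistent with the second derivative. -/
theorem exists_walk_sub_le {φ : ℝ → ℝ} (hφ : IsTestFunction φ) {e : ℝ} (he : 0 < e) :
    ∃ δ₀ > 0, ∀ δ, 0 < δ → δ < δ₀ → ∀ x,
      |walk δ φ x - φ x - timeStep δ * iteratedDeriv 2 φ x| ≤ e * timeStep δ := by
  have huc := hφ.hasCompactSupport_iteratedDeriv.uniformContinuous_of_continuous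
    hφ.continuous_iteratedDeriv
  obtain ⟨δ₀, hδ₀, h⟩ := Metric.uniformContinuous_iff.1 huc (e / 2) (by positivity)
  refine ⟨δ₀, hδ₀, fun δ hδ hδδ x => ?_⟩
  have hφ1 : ContDiff ℝ ∞ (deriv φ) := ((contDiff_infty_iff_deriv (f := φ)).1 hφ.smooth).2
  have hd (y : ℝ) : HasDerivAt φ (deriv φ y) y :=
    (hφ.smooth.differentiable (by simp)).differentiableAt.hasDerivAt
  have hd2 (y : ℝ) : HasDerivAt (deriv φ) (iteratedDeriv 2 φ y) y := by
    rw [iteratedDeriv_two_eq]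
    exact (hφ1.differentiable (by simp)).differentiableAt.hasDerivAt
  set D := iteratedDeriv 2 φ with hD
  -- Two applications of the mean value inequality to the symmetric second difference.
  set g₁ : ℝ → ℝ := fun s => deriv φ (x + s) - deriv φ (x - s) - 2 * s * D x with hg₁
  have hg₁' (s : ℝ) : HasDerivAt g₁ (D (x + s) + D (x - s) - 2 * D x) s := by
    have a1 : HasDerivAt (fun s => deriv φ (x + s)) (D (x + s)) s :=
      (hd2 (x + s)).comp_const_add x s
    have a2 : HasDerivAt (fun s => deriv φ (x - s)) (-D (x - s)) s :=
      (hd2 (x - s)).comp_const_sub x s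
    have a3 : HasDerivAt (fun s => 2 * s * D x) (2 * D x) s := by
      simpa using ((hasDerivAt_id s).const_mul 2).mul_const (D x)
    exact ((a1.sub a2).sub a3).congr_deriv (by ring)
  have hb1 : ∀ s ∈ Icc 0 δ, |g₁ s| ≤ e * s := by
    intro s hs
    have := Convex.norm_image_sub_le_of_norm_hasDerivWithin_le (f := g₁) (s := Icc 0 s) (C := e)
      (fun y _ => (hg₁' y).hasDerivWithinAt) (fun y hy => ?_) (convex_Icc 0 s)
      (left_mem_Icc.2 hs.1) (right_mem_Icc.2 hs.1)
    · simpa [hg₁, abs_of_nonneg hs.1] using this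
    · have hy' : |y| < δ₀ := by rw [abs_of_nonneg hy.1]; linarith [hy.2, hs.2]
      have b1 := h (a := x + y) (b := x) (by simpa [Real.dist_eq] using hy')
      have b2 := h (a := x - y) (b := x) (by simpa [Real.dist_eq] using hy')
      rw [Real.dist_eq, abs_lt] at b1 b2
      rw [Real.norm_eq_abs, abs_le]
      constructor <;> linarith [b1.1, b1.2, b2.1, b2.2]
  set g : ℝ → ℝ := fun s => φ (x + s) + φ (x - s) - 2 * φ x - s ^ 2 * D x with hg
  have hg' (s : ℝ) : HasDerivAt g (g₁ s) s := by
    have a1 : HasDerivAt (fun s => φ (x + s)) (deriv φ (x + s)) s := (hd (x + s)).comp_const_add x s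
    have a2 : HasDerivAt (fun s => φ (x - s)) (-deriv φ (x - s)) s :=
      (hd (x - s)).comp_const_sub x s
    have a3 : HasDerivAt (fun s => s ^ 2 * D x) (2 * s * D x) s := by
      simpa using ((hasDerivAt_id s).pow 2).mul_const (D x)
    exact ((a1.add a2).sub_const (2 * φ x)).sub a3
  have hb := Convex.norm_image_sub_le_of_norm_hasDerivWithin_le (f := g) (s := Icc 0 δ) (C := e * δ)
    (fun y _ => (hg' y).hasDerivWithinAt) (fun y hy => ?_) (convex_Icc 0 δ)
    (left_mem_Icc.2 hδ.le) (right_mem_Icc.2 hδ.le)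
  · have e1 : g 0 = 0 := by simp [hg]; ring
    have e2 : walk δ φ x - φ x - timeStep δ * D x = g δ / 2 := by
      simp only [hg, walk, timeStep]; ring
    rw [e1, sub_zero, sub_zero, Real.norm_eq_abs, Real.norm_eq_abs, abs_of_pos hδ] at hb
    rw [e2, abs_div, abs_two, timeStep]
    linarith
  · exact (hb1 y hy).trans (by gcongr; exact hy.2)

theorem abs_integral_mul_le {f ψ : ℝ → ℝ} {e : ℝ} (hψ : Continuous ψ) (hc : HasCompactSupport ψ)
    (h : ∀ x, ψ x ≠ 0 → |f x| ≤ e) : |∫ x, f x * ψ x| ≤ e * ∫ x, |ψ x| := by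
  rw [← integral_const_mul, ← Real.norm_eq_abs]
  refine norm_integral_le_of_norm_le
    (((hψ.integrable_of_hasCompactSupport (μ := volume) hc).norm).const_mul e)
    (Eventually.of_forall fun x => ?_)
  rw [norm_mul, Real.norm_eq_abs, Real.norm_eq_abs]
  by_cases hx : ψ x = 0
  · simp [hx]
  · gcongr
    exact h x hx

/-- The mass that the reflection measure of the limit must give to `φ` up to time `t`, according to
the weak heat equation. -/
noncomputable def weakMass (hT : 0 ≤ T) (z : CSpace r T) (φ : ℝ → ℝ) (t : ℝ) : ℝ :=
  (∫ x in Ioi (0 : ℝ), extend hT z t x * φ x) -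
    ∫ s in (0 : ℝ)..t, ∫ x in Ioi (0 : ℝ), extend hT z s x * iteratedDeriv 2 φ x

theorem iteratedDeriv_two_of_nonpos {φ : ℝ → ℝ} {c d : ℝ}
    (hs : tsupport φ ⊆ Icc c d) (hc : 0 < c) {x : ℝ} (hx : x ≤ 0) : iteratedDeriv 2 φ x = 0 := by
  rw [iteratedDeriv_two_eq]
  refine image_eq_zero_of_notMem_tsupport fun h => ?_
  have := hs (tsupport_deriv_subset (tsupport_deriv_subset h))
  linarith [this.1]

theorem continuous_weakMass (hT : 0 ≤ T) (z : CSpace r T) {φ : ℝ → ℝ} (hφ : IsTestFunction φ) :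
    Continuous (weakMass hT z φ) := by
  refine (continuous_setIntegral_mul (continuous_extend hT z) hφ.smooth.continuous
    hφ.compactSupport).sub ?_
  exact intervalIntegral.continuous_primitive (fun a b =>
    (continuous_setIntegral_mul (continuous_extend hT z) hφ.continuous_iteratedDeriv
      hφ.hasCompactSupport_iteratedDeriv).intervalIntegrable a b) 0

theorem tendsto_integral_approx_mul (hT : 0 ≤ T) {v z : CSpace r T} (hv : IsObstacle v)
    (hz : ∀ t ∈ Icc 0 T, ∀ x, 0 ≤ x → extend hT z t x = limitValue (extend hT v) t x)
    {φ : ℝ → ℝ} (hφ : Continuous φ) {d : ℝ} (hc : HasCompactSupport φ) (hs : tsupport φ ⊆ Icc 0 d)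
    {t : ℝ} (ht : t ∈ Icc 0 T) :
    Tendsto (fun n => ∫ x, approx (extend hT v) n t x * φ x) U
      (𝓝 (∫ x, extend hT z t x * φ x)) := by
  obtain ⟨M, hM0, hM⟩ := exists_extend_bound hT v
  have hVc : ∀ t, Continuous (extend hT v t) := fun t =>
    (continuous_extend hT v).comp (by fun_prop : Continuous fun x : ℝ => (t, x))
  have hZc : Continuous (extend hT z t) :=
    (continuous_extend hT z).comp (by fun_prop : Continuous fun x : ℝ => (t, x))
  have hI : 0 ≤ ∫ x, |φ x| := integral_nonneg fun x => abs_nonneg _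
  rw [Metric.tendsto_nhds]
  intro e he
  filter_upwards [eventually_abs_scheme_sub_le hT hv hz d
    (e := e / ((∫ x, |φ x|) + 1)) (by positivity)] with n hn
  rw [Real.dist_eq, ← integral_sub]
  · simp only [← sub_mul]
    refine (abs_integral_mul_le (e := e / ((∫ x, |φ x|) + 1)) hφ hc fun x hx => ?_).trans_lt ?_
    · refine hn _ ((steps_mul_le n ht.1).trans ht.2) x (hs (subset_tsupport _ hx)) t ht ?_
      rw [abs_sub_comm]
      exact abs_steps_mul_sub_le n ht.1
    · rw [div_mul_eq_mul_div, div_lt_iff₀ (by positivity)]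
      nlinarith
  · exact integrable_scheme_mul hVc (stepSize_pos n) hM0
      (fun t x hx => (le_abs_self _).trans (hM t x hx.le)) _ hφ hc
  · exact (hZc.mul hφ).integrable_of_hasCompactSupport hc.mul_left

theorem tsupport_iteratedDeriv_subset {φ : ℝ → ℝ} :
    tsupport (iteratedDeriv 2 φ) ⊆ tsupport φ := by
  rw [iteratedDeriv_two_eq]
  exact tsupport_deriv_subset.trans tsupport_deriv_subset

/-- The discrete generator terms are a Riemann sum for the time integral in the weak equation. -/
theorem tendsto_generator_sum (hT : 0 ≤ T) {v z : CSpace r T} (hv : IsObstacle v)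
    (hz : ∀ t ∈ Icc 0 T, ∀ x, 0 ≤ x → extend hT z t x = limitValue (extend hT v) t x)
    {φ : ℝ → ℝ} (hφ : IsTestFunction φ) {c d : ℝ} (hc : 0 < c) (hs : tsupport φ ⊆ Icc c d)
    {t : ℝ} (ht : t ∈ Icc 0 T) :
    Tendsto (fun n => ∑ k ∈ Finset.range (steps n t),
      ∫ x, scheme (extend hT v) (stepSize n) k x * (walk (stepSize n) φ x - φ x)) U
      (𝓝 (∫ s in (0 : ℝ)..t, ∫ x, extend hT z s x * iteratedDeriv 2 φ x)) := by
  obtain ⟨M, hM0, hM⟩ := exists_extend_bound hT v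
  set V := extend hT v with hV_def
  have hVM : ∀ t x, 0 < x → V t x ≤ M * Real.exp (r * x) :=
    fun t x hx => (le_abs_self _).trans (hM t x hx.le)
  have hVc : ∀ t, Continuous (V t) := fun t =>
    (continuous_extend hT v).comp (by fun_prop : Continuous fun x : ℝ => (t, x))
  have hZc (s : ℝ) : Continuous (extend hT z s) :=
    (continuous_extend hT z).comp (by fun_prop : Continuous fun x : ℝ => (s, x))
  set D := iteratedDeriv 2 φ with hD
  have hDc : Continuous D := hφ.continuous_iteratedDeriv
  have hDs : HasCompactSupport D := hφ.hasCompactSupport_iteratedDeriv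
  have hDt : tsupport D ⊆ Icc c d := tsupport_iteratedDeriv_subset.trans hs
  set G : ℝ → ℝ := fun s => ∫ x, extend hT z s x * D x with hG
  have hGc : Continuous G := by
    have h := continuous_setIntegral_mul (continuous_extend hT z) hDc hDs
    refine h.congr fun s => setIntegral_Ioi_eq_of_tsupport fun x hx => ?_
    exact image_eq_zero_of_notMem_tsupport fun h' => by linarith [(hDt h').1]
  -- The integral up to the last time of the grid.
  have hprim : Tendsto (fun n => ∫ s in (0 : ℝ)..(steps n t * timeStep (stepSize n)), G s) U
      (𝓝 (∫ s in (0 : ℝ)..t, G s)) := by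
    have hst : Tendsto (fun n => (steps n t : ℝ) * timeStep (stepSize n)) U (𝓝 t) :=
      tendsto_iff_dist_tendsto_zero.2 (squeeze_zero (fun _ => dist_nonneg)
        (fun n => abs_steps_mul_sub_le n ht.1) tendsto_timeStep)
    exact (intervalIntegral.continuous_primitive (fun a b => hGc.intervalIntegrable a b)
      0).continuousAt.tendsto.comp hst
  set B : ℝ := M * Real.exp (|r| * (|d| + 1) + r ^ 2 * T) with hB
  have hB0 : 0 ≤ B := by positivity
  set S : Set ℝ := Icc (c - 1) (d + 1) with hS
  set C₀ : ℝ := B * volume.real S + ∫ x, |D x| with hC₀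
  have hC₀0 : 0 ≤ C₀ := add_nonneg (by positivity) (integral_nonneg fun x => abs_nonneg _)
  have hdiff : Tendsto (fun n => (∑ k ∈ Finset.range (steps n t),
      ∫ x, scheme V (stepSize n) k x * (walk (stepSize n) φ x - φ x)) -
      ∫ s in (0 : ℝ)..(steps n t * timeStep (stepSize n)), G s) U (𝓝 0) := by
    rw [Metric.tendsto_nhds]
    intro e' he'
    obtain ⟨e, he, hee⟩ : ∃ e > 0, T * (e * C₀) < e' := by
      refine ⟨e' / (T * C₀ + 1), by positivity, ?_⟩
      rw [div_mul_eq_mul_div, mul_div_assoc', div_lt_iff₀ (by positivity)]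
      nlinarith
    obtain ⟨δ₀, hδ₀, hwalk⟩ := exists_walk_sub_le hφ he
    filter_upwards [eventually_abs_scheme_sub_le hT hv hz d he,
      tendsto_stepSize.eventually (gt_mem_nhds hδ₀),
      tendsto_stepSize.eventually (gt_mem_nhds one_pos)] with n hn hnδ hn1
    set δ := stepSize n with hδ_def
    set h := timeStep δ with hh_def
    have hδ : 0 < δ := stepSize_pos n
    have hh : 0 < h := timeStep_pos hδ
    have hKt : steps n t * h ≤ t := steps_mul_le n ht.1
    have hsum : ∫ s in (0 : ℝ)..(steps n t * h), G s =
        ∑ k ∈ Finset.range (steps n t), ∫ s in (k * h)..((k + 1 : ℕ) * h), G s := by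
      rw [intervalIntegral.sum_integral_adjacent_intervals (a := fun k : ℕ => (k : ℝ) * h)
        fun k _ => hGc.intervalIntegrable _ _]
      simp
    rw [Real.dist_eq, sub_zero, hsum, ← Finset.sum_sub_distrib]
    have hterm : ∀ k ∈ Finset.range (steps n t),
        |(∫ x, scheme V δ k x * (walk δ φ x - φ x)) -
          ∫ s in (k * h)..((k + 1 : ℕ) * h), G s| ≤ h * (e * C₀) := by
      intro k hk
      have hk1 : ((k + 1 : ℕ) : ℝ) ≤ steps n t := by exact_mod_cast Finset.mem_range.1 hk
      have hk1T : ((k + 1 : ℕ) : ℝ) * h ≤ T :=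
        (mul_le_mul_of_nonneg_right hk1 hh.le).trans (hKt.trans ht.2)
      have hkk : ((k + 1 : ℕ) : ℝ) * h = k * h + h := by push_cast; ring
      have hk0 : 0 ≤ (k : ℝ) * h := by positivity
      have hkT : (k : ℝ) * h ≤ T := by linarith
      have i1 := integrable_scheme_mul hVc hδ hM0 hVM k hDc hDs
      have hωc : Continuous fun x => walk δ φ x - φ x - h * D x :=
        ((continuous_walk hφ.smooth.continuous δ).sub hφ.smooth.continuous).sub
          (continuous_const.mul hDc)
      have hωs : HasCompactSupport fun x => walk δ φ x - φ x - h * D x :=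
        ((hasCompactSupport_walk hφ.compactSupport δ).sub hφ.compactSupport).sub hDs.mul_left
      have i2 := integrable_scheme_mul hVc hδ hM0 hVM k hωc hωs
      have split1 : ∫ x, scheme V δ k x * (walk δ φ x - φ x) =
          (∫ x, scheme V δ k x * (walk δ φ x - φ x - h * D x)) + h * ∫ x, scheme V δ k x * D x := by
        rw [← integral_const_mul, ← integral_add i2 (i1.const_mul h)]
        refine integral_congr_ae (Eventually.of_forall fun x => ?_)
        ring
      have φzero : ∀ x, x ∉ Icc c d → φ x = 0 := fun x hx =>
        image_eq_zero_of_notMem_tsupport fun h' => hx (hs h')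
      have Dzero : ∀ x, x ∉ Icc c d → D x = 0 := fun x hx =>
        image_eq_zero_of_notMem_tsupport fun h' => hx (hDt h')
      -- The consistency error of the walk.
      have est1 : |∫ x, scheme V δ k x * (walk δ φ x - φ x - h * D x)| ≤
          B * (e * h) * volume.real S := by
        rw [← setIntegral_eq_integral_of_forall_compl_eq_zero (s := S), ← Real.norm_eq_abs]
        · refine norm_setIntegral_le_of_norm_le_const measure_Icc_lt_top fun x hx => ?_
          rw [norm_mul]
          refine mul_le_mul ?_ (hwalk δ hδ hnδ x) (norm_nonneg _) hB0
          rcases le_or_gt x 0 with hx0 | hx0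
          · rw [scheme_of_nonpos k hx0, norm_zero]
            exact hB0
          · refine (abs_scheme_le hδ hM0 hVM k x).trans ?_
            have hrx : r * x ≤ |r| * (|d| + 1) := by
              calc r * x ≤ |r| * x := mul_le_mul_of_nonneg_right (le_abs_self r) hx0.le
                _ ≤ |r| * (|d| + 1) := by
                  gcongr
                  linarith [hx.2, le_abs_self d]
            rw [hB]
            gcongr
        · intro x hx
          have n1 : x + δ ∉ Icc c d := fun h' => hx ⟨by linarith [h'.1], by linarith [h'.2]⟩
          have n2 : x - δ ∉ Icc c d := fun h' => hx ⟨by linarith [h'.1], by linarith [h'.2]⟩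
          have n3 : x ∉ Icc c d := fun h' => hx ⟨by linarith [h'.1], by linarith [h'.2]⟩
          rw [walk, φzero _ n1, φzero _ n2, φzero _ n3, Dzero _ n3]
          ring
      -- The error of the Riemann sum.
      have est2 : |h * (∫ x, scheme V δ k x * D x) - ∫ s in (k * h)..((k + 1 : ℕ) * h), G s| ≤
          e * (∫ x, |D x|) * h := by
        have e1 : h * (∫ x, scheme V δ k x * D x) =
            ∫ s in (k * h)..((k + 1 : ℕ) * h), ∫ x, scheme V δ k x * D x := by
          rw [intervalIntegral.integral_const, hkk, smul_eq_mul]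
          ring
        rw [e1, ← intervalIntegral.integral_sub (by simp) (hGc.intervalIntegrable _ _)]
        have e2 : |((k + 1 : ℕ) : ℝ) * h - k * h| = h := by
          rw [hkk, add_sub_cancel_left, abs_of_pos hh]
        rw [← Real.norm_eq_abs]
        refine (intervalIntegral.norm_integral_le_of_norm_le_const (C := e * ∫ x, |D x|)
          fun s hs' => ?_).trans (by rw [e2])
        rw [uIoc_of_le (by linarith)] at hs'
        have hsT : s ∈ Icc 0 T := ⟨by linarith [hs'.1], by linarith [hs'.2]⟩
        simp only [hG]
        have i3 : Integrable fun x => extend hT z s x * D x :=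
          ((hZc s).mul hDc).integrable_of_hasCompactSupport hDs.mul_left
        rw [← integral_sub i1 i3, Real.norm_eq_abs]
        simp only [← sub_mul]
        refine abs_integral_mul_le hDc hDs fun x hx => ?_
        have hxI := hDt (subset_tsupport _ hx)
        refine hn k hkT x ⟨hc.le.trans hxI.1, hxI.2⟩ s hsT ?_
        rw [abs_le]
        constructor <;> linarith [hs'.1, hs'.2]
      rw [split1, add_sub_assoc]
      refine (abs_add_le _ _).trans ((add_le_add est1 est2).trans (le_of_eq ?_))
      rw [hC₀]
      ring
    refine (Finset.abs_sum_le_sum_abs _ _).trans_lt ((Finset.sum_le_sum hterm).trans_lt ?_)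
    rw [Finset.sum_const, Finset.card_range, nsmul_eq_mul, ← mul_assoc]
    refine lt_of_le_of_lt ?_ hee
    gcongr
    exact hKt.trans ht.2
  have := hdiff.add hprim
  simpa using this

/-- The mass received by `φ` from the pushes of the scheme up to time `t`. -/
noncomputable def pushMass (V : ℝ → ℝ → ℝ) (n : ℕ) (t : ℝ) (φ : ℝ → ℝ) : ℝ :=
  ∑ k ∈ Finset.range (steps n t), ∫ x, push V (stepSize n) k x * φ x

/-- The weak equation away from the boundary, for the scheme in the limit. -/
theorem tendsto_pushMass (hT : 0 ≤ T) {v z : CSpace r T} (hv : IsObstacle v)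
    (hz : ∀ t ∈ Icc 0 T, ∀ x, 0 ≤ x → extend hT z t x = limitValue (extend hT v) t x)
    {φ : ℝ → ℝ} (hφ : IsTestFunction φ) {c d : ℝ} (hc : 0 < c) (hs : tsupport φ ⊆ Icc c d)
    {t : ℝ} (ht : t ∈ Icc 0 T) :
    Tendsto (fun n => pushMass (extend hT v) n t φ) U (𝓝 (weakMass hT z φ t)) := by
  obtain ⟨M, hM0, hM⟩ := exists_extend_bound hT v
  have hVc : ∀ t, Continuous (extend hT v t) := fun t =>
    (continuous_extend hT v).comp (by fun_prop : Continuous fun x : ℝ => (t, x))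
  have φzero : ∀ x ≤ 0, φ x = 0 := fun x hx =>
    image_eq_zero_of_notMem_tsupport fun h' => by linarith [(hs h').1]
  have h := (tendsto_integral_approx_mul hT hv hz hφ.smooth.continuous hφ.compactSupport
    (hs.trans (Icc_subset_Icc_left hc.le)) ht).sub (tendsto_generator_sum hT hv hz hφ hc hs ht)
  have e : weakMass hT z φ t = (∫ x, extend hT z t x * φ x) -
      ∫ s in (0 : ℝ)..t, ∫ x, extend hT z s x * iteratedDeriv 2 φ x := by
    unfold weakMass
    rw [setIntegral_Ioi_eq_of_tsupport φzero]
    congr 2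
    ext s
    exact setIntegral_Ioi_eq_of_tsupport fun x hx => iteratedDeriv_two_of_nonpos hs hc hx
  rw [e]
  refine h.congr fun n => ?_
  exact (sum_integral_push hVc (stepSize_pos n) hM0
    (fun t x hx => (le_abs_self _).trans (hM t x hx.le)) hφ.smooth.continuous hφ.compactSupport
    φzero _).symm

/-! ### The reflection measure of the limit -/

instance : LocallyCompactSpace (Ioi (0 : ℝ)) := isOpen_Ioi.locallyCompactSpace

theorem isCompact_strip {c : ℝ} (hc : 0 < c) (d : ℝ) :
    IsCompact {p : ReflDomain T | (p.1 : ℝ) ∈ Icc c d} := by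
  have h1 : IsCompact {x : Ioi (0 : ℝ) | (x : ℝ) ∈ Icc c d} := by
    rw [Subtype.isCompact_iff]
    convert isCompact_Icc (a := c) (b := d) using 1
    ext x
    constructor
    · rintro ⟨y, hy, rfl⟩
      exact hy
    · intro hx
      exact ⟨⟨x, hc.trans_le hx.1⟩, hx, rfl⟩
  have h2 := h1.prod (isCompact_univ (X := Icc (0 : ℝ) T))
  convert h2 using 1
  ext p
  simp

/-- The product of a function of the position, supported away from `0`, and a continuous function on
the domain of the reflection measure, as a compactly supported function. -/
noncomputable def mulCc {φ : ℝ → ℝ} (hφ : Continuous φ) {c d : ℝ} (hc : 0 < c)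
    (hs : tsupport φ ⊆ Icc c d) (g : C(ReflDomain T, ℝ)) : C_c(ReflDomain T, ℝ) where
  toFun p := φ p.1 * g p
  continuous_toFun := by fun_prop
  hasCompactSupport' := HasCompactSupport.intro (isCompact_strip hc d) fun p hp => by
    rw [image_eq_zero_of_notMem_tsupport (f := φ) fun h => hp (hs h), zero_mul]

theorem integrable_of_tsupport_subset {η : Measure (ReflDomain T)} [IsFiniteMeasureOnCompacts η]
    {φ : ℝ → ℝ} (hφ : Continuous φ) {c d : ℝ} (hc : 0 < c) (hs : tsupport φ ⊆ Icc c d) :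
    Integrable (fun p : ReflDomain T => φ p.1) η := by
  have h' := (mulCc (T := T) hφ hc hs 1).continuous.integrable_of_hasCompactSupport
    (μ := η) (mulCc (T := T) hφ hc hs 1).hasCompactSupport
  exact h'.congr (Eventually.of_forall fun p => mul_one _)

/-- Compactly supported functions are dominated by multiples of smooth cutoffs of the position. -/
theorem exists_dominating_cutoff (f : C_c(ReflDomain T, ℝ)) : ∃ B c d, 0 ≤ B ∧ 0 < c ∧
    ∀ p, |f p| ≤ B * cutoff (2 / c) 1 (c / 2) d p.1 := by
  obtain ⟨B, hB⟩ := f.hasCompactSupport.exists_bound_of_continuous f.continuous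
  have hK : IsCompact ((fun p : ReflDomain T => (p.1 : ℝ)) '' tsupport f) :=
    f.hasCompactSupport.isCompact.image (by fun_prop)
  have hc : ∃ c > 0, ∀ p ∈ tsupport f, c ≤ (p.1 : ℝ) := by
    rcases (tsupport f).eq_empty_or_nonempty with h | h
    · exact ⟨1, one_pos, by simp [h]⟩
    · obtain ⟨p, hp, hmin⟩ := f.hasCompactSupport.isCompact.exists_isMinOn h
        (f := fun p : ReflDomain T => (p.1 : ℝ)) (by fun_prop)
      exact ⟨p.1, p.1.2, fun q hq => hmin hq⟩
  obtain ⟨c, hc, hcp⟩ := hc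
  obtain ⟨d, hd⟩ := hK.bddAbove
  refine ⟨|B|, c, d, abs_nonneg _, hc, fun p => ?_⟩
  by_cases hp : p ∈ tsupport f
  · rw [cutoff_eq_one _ zero_le_one (hd (mem_image_of_mem _ hp)), mul_one]
    · exact (hB p).trans (le_abs_self B)
    · rw [div_mul_eq_mul_div, le_div_iff₀ hc]
      linarith [hcp p hp]
  · rw [image_eq_zero_of_notMem_tsupport hp, abs_zero]
    exact mul_nonneg (abs_nonneg _) (cutoff_nonneg _ _ _ _ _)

theorem integrable_subtype {g : ℝ → ℝ} (hg : Integrable g) :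
    Integrable fun x : Ioi (0 : ℝ) => g x := by
  have he : MeasurableEmbedding (Subtype.val : Ioi (0 : ℝ) → ℝ) :=
    MeasurableEmbedding.subtype_coe measurableSet_Ioi
  have h := he.integrable_map_iff (μ := (volume : Measure (Ioi (0 : ℝ)))) (g := g)
  rw [show Measure.map (Subtype.val : Ioi (0 : ℝ) → ℝ) volume = volume.restrict (Ioi (0 : ℝ)) from
    map_comap_subtype_coe measurableSet_Ioi volume] at h
  exact h.1 hg.integrableOn

theorem integral_subtype_Ioi {g : ℝ → ℝ} (hg : ∀ x ≤ 0, g x = 0) :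
    ∫ x : Ioi (0 : ℝ), g x = ∫ x, g x :=
  (integral_subtype measurableSet_Ioi g).trans
    (setIntegral_eq_integral_of_forall_compl_eq_zero fun x hx => hg x (not_lt.1 hx))

/-- The end of the `k`-th step of the scheme, as a point of the time interval. -/
noncomputable def gridTime (hT : 0 ≤ T) (n k : ℕ) : Icc (0 : ℝ) T :=
  projIcc 0 T hT ((k + 1 : ℕ) * timeStep (stepSize n))

theorem coe_gridTime (hT : 0 ≤ T) {n k : ℕ} (hk : k < steps n T) :
    (gridTime hT n k : ℝ) = (k + 1 : ℕ) * timeStep (stepSize n) := by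
  have h := timeStep_stepSize_pos n
  have h1 : ((k + 1 : ℕ) : ℝ) ≤ steps n T := by exact_mod_cast hk
  rw [gridTime, projIcc_of_mem hT ⟨by positivity,
    (mul_le_mul_of_nonneg_right h1 h.le).trans (steps_mul_le n hT)⟩]

/-- The integral of `f` against the pushes of the scheme. -/
noncomputable def pushIntegral (hT : 0 ≤ T) (V : ℝ → ℝ → ℝ) (n : ℕ)
    (f : C_c(ReflDomain T, ℝ)) : ℝ :=
  ∑ k ∈ Finset.range (steps n T),
    ∫ x : Ioi (0 : ℝ), f (x, gridTime hT n k) * push V (stepSize n) k x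

theorem integrable_mul_push (hT : 0 ≤ T) (v : CSpace r T) (n k : ℕ) (f : C_c(ReflDomain T, ℝ))
    (τ : Icc (0 : ℝ) T) :
    Integrable fun x : Ioi (0 : ℝ) => f (x, τ) * push (extend hT v) (stepSize n) k x := by
  obtain ⟨M, hM0, hM⟩ := exists_extend_bound hT v
  have hVc : ∀ t, Continuous (extend hT v t) := fun t =>
    (continuous_extend hT v).comp (by fun_prop : Continuous fun x : ℝ => (t, x))
  obtain ⟨B, c, d, hB, hc, hf⟩ := exists_dominating_cutoff f
  have hψ : IsTestFunction (cutoff (2 / c) 1 (c / 2) d) :=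
    isTestFunction_cutoff (by positivity) le_rfl (by positivity)
  have hi := integrable_subtype (integrable_push_mul hVc (stepSize_pos n) hM0
    (fun t x hx => (le_abs_self _).trans (hM t x hx.le)) k hψ.smooth.continuous hψ.compactSupport)
  refine (hi.const_mul B).mono' ?_ (Eventually.of_forall fun x => ?_)
  · refine AEStronglyMeasurable.mul ?_ ?_
    · exact (f.continuous.comp (by fun_prop : Continuous fun x : Ioi (0 : ℝ) => (x, τ)))
        |>.aestronglyMeasurable
    · exact ((measurable_push hVc _ _).comp measurable_subtype_coe).aestronglyMeasurable
  · rw [norm_mul, Real.norm_eq_abs, Real.norm_of_nonneg (push_nonneg _ _ _ _)]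
    have := mul_le_mul_of_nonneg_right (hf (x, τ)) (push_nonneg (extend hT v) (stepSize n) k x)
    linarith

theorem pushIntegral_mono (hT : 0 ≤ T) (v : CSpace r T) (n : ℕ) {f g : C_c(ReflDomain T, ℝ)}
    (h : ∀ p, f p ≤ g p) :
    pushIntegral hT (extend hT v) n f ≤ pushIntegral hT (extend hT v) n g :=
  Finset.sum_le_sum fun _ _ => integral_mono (integrable_mul_push hT v n _ f _)
    (integrable_mul_push hT v n _ g _) fun _ =>
      mul_le_mul_of_nonneg_right (h _) (push_nonneg _ _ _ _)

theorem pushIntegral_add (hT : 0 ≤ T) (v : CSpace r T) (n : ℕ) (f g : C_c(ReflDomain T, ℝ)) :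
    pushIntegral hT (extend hT v) n (f + g) =
      pushIntegral hT (extend hT v) n f + pushIntegral hT (extend hT v) n g := by
  unfold pushIntegral
  rw [← Finset.sum_add_distrib]
  refine Finset.sum_congr rfl fun k _ => ?_
  rw [← integral_add (integrable_mul_push hT v n _ f _) (integrable_mul_push hT v n _ g _)]
  simp only [CompactlySupportedContinuousMap.coe_add, Pi.add_apply, add_mul]

theorem pushIntegral_smul (hT : 0 ≤ T) (v : CSpace r T) (n : ℕ) (a : ℝ)
    (f : C_c(ReflDomain T, ℝ)) :
    pushIntegral hT (extend hT v) n (a • f) = a * pushIntegral hT (extend hT v) n f := by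
  unfold pushIntegral
  rw [Finset.mul_sum]
  refine Finset.sum_congr rfl fun k _ => ?_
  rw [← integral_const_mul]
  simp only [CompactlySupportedContinuousMap.coe_smul, Pi.smul_apply, smul_eq_mul, mul_assoc]

theorem integral_mul_push (hT : 0 ≤ T) (v : CSpace r T) (n k : ℕ) {φ : ℝ → ℝ}
    (h0 : ∀ x ≤ 0, φ x = 0) :
    ∫ x : Ioi (0 : ℝ), φ x * push (extend hT v) (stepSize n) k x =
      ∫ x, push (extend hT v) (stepSize n) k x * φ x := by
  rw [integral_subtype_Ioi (g := fun x => φ x * push (extend hT v) (stepSize n) k x)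
    fun x hx => by rw [h0 x hx, zero_mul]]
  simp only [mul_comm]

theorem pushIntegral_mulCc_one (hT : 0 ≤ T) (v : CSpace r T) (n : ℕ) {φ : ℝ → ℝ}
    (hφ : Continuous φ) {c d : ℝ} (hc : 0 < c) (hs : tsupport φ ⊆ Icc c d) :
    pushIntegral hT (extend hT v) n (mulCc hφ hc hs 1) = pushMass (extend hT v) n T φ := by
  refine Finset.sum_congr rfl fun k _ => ?_
  rw [← integral_mul_push hT v n k fun x hx =>
    image_eq_zero_of_notMem_tsupport fun h => by linarith [(hs h).1]]
  simp [mulCc]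

/-- The pushes of the scheme converge along the ultrafilter, against compactly supported functions,
to a measure, by the Riesz–Markov–Kakutani theorem. -/
theorem exists_limit_measure (hT : 0 ≤ T) {v z : CSpace r T} (hv : IsObstacle v)
    (hz : ∀ t ∈ Icc 0 T, ∀ x, 0 ≤ x → extend hT z t x = limitValue (extend hT v) t x) :
    ∃ η : Measure (ReflDomain T), IsFiniteMeasureOnCompacts η ∧ ∀ f : C_c(ReflDomain T, ℝ),
      Tendsto (fun n => pushIntegral hT (extend hT v) n f) U (𝓝 (∫ p, f p ∂η)) := by
  have hex (f : C_c(ReflDomain T, ℝ)) :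
      ∃ l, Tendsto (fun n => pushIntegral hT (extend hT v) n f) U (𝓝 l) := by
    obtain ⟨B, c, d, hB, hc, hf⟩ := exists_dominating_cutoff f
    have hψ : IsTestFunction (cutoff (2 / c) 1 (c / 2) d) :=
      isTestFunction_cutoff (by positivity) le_rfl (by positivity)
    have hs : tsupport (cutoff (2 / c) 1 (c / 2) d) ⊆ Icc (c / 2) (d + 1) :=
      tsupport_cutoff_subset (by positivity) le_rfl
    have hlim := tendsto_pushMass hT hv hz hψ (half_pos hc) hs ⟨hT, le_rfl⟩
    set F := weakMass hT z (cutoff (2 / c) 1 (c / 2) d) T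
    refine exists_tendsto_U (A := -(B * (F + 1))) (B := B * (F + 1)) ?_
    filter_upwards [hlim.eventually (gt_mem_nhds (lt_add_one F))] with n hn
    rw [← pushIntegral_mulCc_one hT v n hψ.smooth.continuous (half_pos hc) hs] at hn
    set ψ := mulCc (T := T) hψ.smooth.continuous (half_pos hc) hs 1 with hψ'
    have hψ1 (p : ReflDomain T) : ψ p = cutoff (2 / c) 1 (c / 2) d p.1 := mul_one _
    have h1 : pushIntegral hT (extend hT v) n f ≤ pushIntegral hT (extend hT v) n (B • ψ) := by
      refine pushIntegral_mono hT v n fun p => ?_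
      rw [CompactlySupportedContinuousMap.smul_apply, hψ1, smul_eq_mul]
      exact (le_abs_self _).trans (hf p)
    have h2 : pushIntegral hT (extend hT v) n ((-B) • ψ) ≤ pushIntegral hT (extend hT v) n f := by
      refine pushIntegral_mono hT v n fun p => ?_
      rw [CompactlySupportedContinuousMap.smul_apply, hψ1, smul_eq_mul]
      linarith [(abs_le.1 (hf p)).1]
    rw [pushIntegral_smul] at h1 h2
    have h3 := mul_le_mul_of_nonneg_left hn.le hB
    exact ⟨by linarith, by linarith⟩
  choose L hL using hex
  let Λ₀ : C_c(ReflDomain T, ℝ) →ₗ[ℝ] ℝ :=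
    { toFun := L
      map_add' := fun f g => tendsto_nhds_unique (hL (f + g))
        (((hL f).add (hL g)).congr fun n => (pushIntegral_add hT v n f g).symm)
      map_smul' := fun a f => tendsto_nhds_unique (hL (a • f))
        (((hL f).const_mul a).congr fun n => (pushIntegral_smul hT v n a f).symm) }
  let Λ : C_c(ReflDomain T, ℝ) →ₚ[ℝ] ℝ := PositiveLinearMap.mk₀ Λ₀ fun f hf =>
    ge_of_tendsto' (hL f) fun n => Finset.sum_nonneg fun k _ => integral_nonneg fun x =>
      mul_nonneg (hf _) (push_nonneg _ _ _ _)
  refine ⟨RealRMK.rieszMeasure Λ, inferInstance, fun f => ?_⟩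
  rw [RealRMK.integral_rieszMeasure]
  exact hL f

section limitMeasure

variable {v z : CSpace r T} {η : Measure (ReflDomain T)}

/-- Continuous cutoffs in time that decrease to the indicator of `(-∞, t]`. -/
theorem tendsto_ramp (t s : ℝ) :
    Tendsto (fun m : ℕ => max 0 (min 1 (1 - (m + 1) * (s - t)))) atTop
      (𝓝 (if s ≤ t then 1 else 0)) := by
  refine tendsto_const_nhds.congr' ?_
  split_ifs with h
  · refine Eventually.of_forall fun m => ?_
    have : 0 ≤ ((m : ℝ) + 1) * (t - s) := mul_nonneg (by positivity) (by linarith)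
    beta_reduce
    rw [min_eq_left (by linarith), max_eq_right zero_le_one]
  · have h' : 0 < s - t := by linarith
    filter_upwards [((tendsto_natCast_atTop_atTop (R := ℝ)).atTop_mul_const h').eventually_ge_atTop
      1] with m hm
    rw [min_eq_right (by linarith), max_eq_left (by linarith)]

/-- The weak equation for nonnegative test functions supported away from `0`. The indicator of
`[0,t]` is approximated by continuous functions of time, between the indicators of `[0,t]` and
`[0,t']`. -/
theorem setIntegral_eq_weakMass_of_nonneg [IsFiniteMeasureOnCompacts η] (hT : 0 ≤ T)
    (hv : IsObstacle v)
    (hz : ∀ t ∈ Icc 0 T, ∀ x, 0 ≤ x → extend hT z t x = limitValue (extend hT v) t x)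
    (hη : ∀ f : C_c(ReflDomain T, ℝ),
      Tendsto (fun n => pushIntegral hT (extend hT v) n f) U (𝓝 (∫ p, f p ∂η)))
    {φ : ℝ → ℝ} (hφ : IsTestFunction φ) (hφ0 : ∀ x, 0 ≤ φ x) {c d : ℝ} (hc : 0 < c)
    (hs : tsupport φ ⊆ Icc c d) (t : Icc (0 : ℝ) T) :
    ∫ p in {p : ReflDomain T | p.2 ≤ t}, φ p.1 ∂η = weakMass hT z φ t := by
  have h0 : ∀ x ≤ 0, φ x = 0 := fun x hx =>
    image_eq_zero_of_notMem_tsupport fun h => by linarith [(hs h).1]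
  set χ : ℕ → C(ReflDomain T, ℝ) := fun m =>
    ⟨fun p => max 0 (min 1 (1 - (m + 1) * (p.2 - t))), by fun_prop⟩ with hχ
  set f : ℕ → C_c(ReflDomain T, ℝ) := fun m => mulCc hφ.smooth.continuous hc hs (χ m) with hf
  have hfp (m : ℕ) (p : ReflDomain T) : f m p = φ p.1 * χ m p := rfl
  have hχ0 (m : ℕ) (p : ReflDomain T) : 0 ≤ χ m p := le_max_left _ _
  have hχ1 (m : ℕ) (p : ReflDomain T) : χ m p ≤ 1 := max_le zero_le_one (min_le_left _ _)
  have hI0 (n k : ℕ) : 0 ≤ ∫ x, push (extend hT v) (stepSize n) k x * φ x :=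
    integral_nonneg fun x => mul_nonneg (push_nonneg _ _ _ _) (hφ0 x)
  -- The factor `χ m` is constant in each step of the scheme.
  have hterm (m n : ℕ) : pushIntegral hT (extend hT v) n (f m) =
      ∑ k ∈ Finset.range (steps n T), max 0 (min 1 (1 - ((m : ℝ) + 1) * (gridTime hT n k - t))) *
        ∫ x, push (extend hT v) (stepSize n) k x * φ x := by
    refine Finset.sum_congr rfl fun k _ => ?_
    rw [← integral_mul_push hT v n k h0, ← integral_const_mul]
    refine integral_congr_ae (Eventually.of_forall fun x => ?_)
    simp only [hfp, hχ, ContinuousMap.coe_mk]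
    ring
  have hlow (m n : ℕ) : pushMass (extend hT v) n t φ ≤ pushIntegral hT (extend hT v) n (f m) := by
    have hsub : steps n t ≤ steps n T :=
      Nat.floor_le_floor (div_le_div_of_nonneg_right t.2.2 (timeStep_stepSize_pos n).le)
    rw [hterm]
    refine le_trans (Finset.sum_le_sum fun k hk => ?_) (Finset.sum_le_sum_of_subset_of_nonneg
      (Finset.range_subset_range.2 hsub) fun k _ _ => mul_nonneg (le_max_left _ _) (hI0 n k))
    have hk' := Finset.mem_range.1 hk
    have h1 : (gridTime hT n k : ℝ) ≤ t := by
      rw [coe_gridTime hT (hk'.trans_le hsub)]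
      have h1 : ((k + 1 : ℕ) : ℝ) ≤ steps n t := by exact_mod_cast hk'
      exact (mul_le_mul_of_nonneg_right h1 (timeStep_stepSize_pos n).le).trans
        (steps_mul_le n t.2.1)
    have : 0 ≤ ((m : ℝ) + 1) * (t - gridTime hT n k) := mul_nonneg (by positivity) (by linarith)
    rw [min_eq_left (by linarith), max_eq_right zero_le_one, one_mul]
  have hupp (m n : ℕ) : pushIntegral hT (extend hT v) n (f m) ≤
      pushMass (extend hT v) n (min (t + 1 / ((m : ℝ) + 1)) T) φ := by
    set t' := min ((t : ℝ) + 1 / ((m : ℝ) + 1)) T with ht'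
    have hsub : steps n t' ≤ steps n T :=
      Nat.floor_le_floor (div_le_div_of_nonneg_right (min_le_right _ _)
        (timeStep_stepSize_pos n).le)
    rw [hterm]
    unfold pushMass
    rw [← Finset.sum_subset (Finset.range_subset_range.2 hsub)]
    · refine Finset.sum_le_sum fun k _ => ?_
      exact mul_le_of_le_one_left (hI0 n k) (max_le zero_le_one (min_le_left _ _))
    · intro k hk hk'
      rw [Finset.mem_range] at hk hk'
      have hk2 : ((steps n t' : ℕ) : ℝ) + 1 ≤ (k + 1 : ℕ) := by
        push_cast
        have : ((steps n t' : ℕ) : ℝ) ≤ k := by exact_mod_cast not_lt.1 hk'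
        linarith
      have h1 : t' < gridTime hT n k := by
        rw [coe_gridTime hT hk]
        exact (lt_steps_succ_mul n t').trans_le
          (mul_le_mul_of_nonneg_right hk2 (timeStep_stepSize_pos n).le)
      have h2 : (t : ℝ) + 1 / ((m : ℝ) + 1) < gridTime hT n k := by
        rcases min_lt_iff.1 h1 with h | h
        · exact h
        · exact absurd (gridTime hT n k).2.2 (not_le.2 h)
      have h3 : 1 ≤ ((m : ℝ) + 1) * (gridTime hT n k - t) := by
        have h4 : 1 / ((m : ℝ) + 1) ≤ gridTime hT n k - t := by linarith
        rwa [div_le_iff₀' (by positivity)] at h4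
      rw [min_eq_right (by linarith), max_eq_left (by linarith), zero_mul]
  have ht' (m : ℕ) : min ((t : ℝ) + 1 / ((m : ℝ) + 1)) T ∈ Icc 0 T :=
    ⟨le_min (add_nonneg t.2.1 (by positivity)) hT, min_le_right _ _⟩
  have hlow' (m : ℕ) : weakMass hT z φ t ≤ ∫ p, f m p ∂η :=
    le_of_tendsto_of_tendsto' (tendsto_pushMass hT hv hz hφ hc hs t.2) (hη (f m)) (hlow m)
  have hupp' (m : ℕ) : ∫ p, f m p ∂η ≤ weakMass hT z φ (min (t + 1 / ((m : ℝ) + 1)) T) :=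
    le_of_tendsto_of_tendsto' (hη (f m)) (tendsto_pushMass hT hv hz hφ hc hs (ht' m)) (hupp m)
  have hw : Tendsto (fun m : ℕ => weakMass hT z φ (min (t + 1 / ((m : ℝ) + 1)) T)) atTop
      (𝓝 (weakMass hT z φ t)) := by
    refine (continuous_weakMass hT z hφ).continuousAt.tendsto.comp ?_
    have h1 : Tendsto (fun m : ℕ => min ((t : ℝ) + 1 / ((m : ℝ) + 1)) T) atTop
        (𝓝 (min ((t : ℝ) + 0) T)) :=
      (tendsto_one_div_add_atTop_nhds_zero_nat.const_add (t : ℝ)).min tendsto_const_nhds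
    rwa [add_zero, min_eq_left t.2.2] at h1
  have hlim1 : Tendsto (fun m => ∫ p, f m p ∂η) atTop (𝓝 (weakMass hT z φ t)) :=
    tendsto_of_tendsto_of_tendsto_of_le_of_le tendsto_const_nhds hw hlow' hupp'
  have hint : Integrable (fun p : ReflDomain T => φ p.1) η :=
    integrable_of_tsupport_subset hφ.smooth.continuous hc hs
  have hms : MeasurableSet {p : ReflDomain T | p.2 ≤ t} :=
    (measurableSet_Iic (a := t)).preimage measurable_snd
  have hlim2 : Tendsto (fun m => ∫ p, f m p ∂η) atTop
      (𝓝 (∫ p in {p : ReflDomain T | p.2 ≤ t}, φ p.1 ∂η)) := by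
    rw [← integral_indicator hms]
    refine tendsto_integral_of_dominated_convergence (fun p => φ p.1)
      (fun m => (f m).continuous.aestronglyMeasurable) hint (fun m => ?_) ?_
    · refine Eventually.of_forall fun p => ?_
      rw [hfp, Real.norm_of_nonneg (mul_nonneg (hφ0 _) (hχ0 m p))]
      exact mul_le_of_le_one_right (hφ0 _) (hχ1 m p)
    · refine Eventually.of_forall fun p => ?_
      have h := (tendsto_ramp t p.2).const_mul (φ p.1)
      have e : {p : ReflDomain T | p.2 ≤ t}.indicator (fun p => φ p.1) p =
          φ p.1 * if (p.2 : ℝ) ≤ t then 1 else 0 := by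
        by_cases hp : p.2 ≤ t
        · rw [indicator_of_mem (show p ∈ {p : ReflDomain T | p.2 ≤ t} from hp),
            if_pos (show (p.2 : ℝ) ≤ t from hp), mul_one]
        · rw [indicator_of_notMem (show p ∉ {p : ReflDomain T | p.2 ≤ t} from hp),
            if_neg (show ¬ (p.2 : ℝ) ≤ t from hp), mul_zero]
      rw [e]
      exact h
  exact tendsto_nhds_unique hlim2 hlim1

/-- The reflection measure of the limit is carried by the contact set. A push of the scheme happens
at the obstacle, where the limit is close to the obstacle. -/
theorem integral_mul_gap_nonpos (hT : 0 ≤ T) (hv : IsObstacle v)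
    (hz : ∀ t ∈ Icc 0 T, ∀ x, 0 ≤ x → extend hT z t x = limitValue (extend hT v) t x)
    (hη : ∀ f : C_c(ReflDomain T, ℝ),
      Tendsto (fun n => pushIntegral hT (extend hT v) n f) U (𝓝 (∫ p, f p ∂η)))
    {φ : ℝ → ℝ} (hφ : IsTestFunction φ) (hφ0 : ∀ x, 0 ≤ φ x) {c d : ℝ} (hc : 0 < c)
    (hs : tsupport φ ⊆ Icc c d) {g : C(ReflDomain T, ℝ)}
    (hg : ∀ p, g p = z.1 p.toDomain - v.1 p.toDomain) :
    ∫ p, mulCc hφ.smooth.continuous hc hs g p ∂η ≤ 0 := by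
  have hlim1 := tendsto_pushMass hT hv hz hφ hc hs (t := T) ⟨hT, le_rfl⟩
  set F := weakMass hT z φ T
  have key : ∀ e > 0, ∫ p, mulCc hφ.smooth.continuous hc hs g p ∂η ≤ e * F := by
    intro e he
    refine le_of_tendsto_of_tendsto (hη _) (hlim1.const_mul e) ?_
    filter_upwards [eventually_abs_scheme_sub_le hT hv hz d he] with n hn
    rw [← pushIntegral_mulCc_one hT v n hφ.smooth.continuous hc hs, ← pushIntegral_smul]
    refine Finset.sum_le_sum fun k hk => ?_
    have hk' := Finset.mem_range.1 hk
    refine integral_mono (integrable_mul_push hT v n _ _ _) (integrable_mul_push hT v n _ _ _)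
      fun x => ?_
    change φ x * g (x, gridTime hT n k) * push (extend hT v) (stepSize n) k x ≤
      e * (φ x * 1) * push (extend hT v) (stepSize n) k x
    by_cases hpush : push (extend hT v) (stepSize n) k x = 0
    · rw [hpush, mul_zero, mul_zero]
    by_cases hφx : φ x = 0
    · simp [hφx]
    have hxI := hs (subset_tsupport _ hφx)
    have hx0 : (0 : ℝ) < x := x.2
    have h1 := scheme_eq_of_push_ne_zero hx0 hpush
    have hgt := coe_gridTime hT hk'
    have h2 : ((k + 1 : ℕ) : ℝ) * timeStep (stepSize n) ≤ T := hgt ▸ (gridTime hT n k).2.2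
    have h3 := hn (k + 1) h2 x ⟨hx0.le, hxI.2⟩ (gridTime hT n k) (gridTime hT n k).2 (by
      rw [hgt, sub_self, abs_zero]
      exact (timeStep_stepSize_pos n).le)
    have h4 : g (x, gridTime hT n k) = extend hT z (gridTime hT n k) x -
        extend hT v (gridTime hT n k) x := by
      rw [hg, ← extend_coe hT z, ← extend_coe hT v]
      rfl
    rw [h1, ← hgt] at h3
    have h5 : g (x, gridTime hT n k) ≤ e := by linarith [(abs_le.1 h3).1]
    refine mul_le_mul_of_nonneg_right ?_ (push_nonneg _ _ _ _)
    nlinarith [hφ0 x]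
  have h0 : Tendsto (fun e : ℝ => e * F) (𝓝[>] 0) (𝓝 (0 * F)) :=
    (tendsto_id.mul_const F).mono_left nhdsWithin_le_nhds
  rw [zero_mul] at h0
  exact ge_of_tendsto h0 (by filter_upwards [self_mem_nhdsWithin] with e he using key e he)

end limitMeasure

/-! ### Test functions up to the boundary -/

/-- The function `φ`, cut off smoothly near `0`: unchanged on `[2/(n+1), ∞)`, and `0` on
`(-∞, 1/(n+1)]`. -/
noncomputable def truncate (n : ℕ) (φ : ℝ → ℝ) (x : ℝ) : ℝ :=
  Real.smoothTransition ((n + 1) * x - 1) * φ x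

theorem truncate_of_le {n : ℕ} {φ : ℝ → ℝ} {x : ℝ} (hx : x ≤ 1 / ((n : ℝ) + 1)) :
    truncate n φ x = 0 := by
  rw [le_div_iff₀' (by positivity)] at hx
  rw [truncate, Real.smoothTransition.zero_of_nonpos (by linarith), zero_mul]

theorem truncate_of_ge {n : ℕ} {φ : ℝ → ℝ} {x : ℝ} (hx : 2 / ((n : ℝ) + 1) ≤ x) :
    truncate n φ x = φ x := by
  rw [div_le_iff₀' (by positivity)] at hx
  rw [truncate, Real.smoothTransition.one_of_one_le (by linarith), one_mul]

theorem abs_truncate_le (n : ℕ) (φ : ℝ → ℝ) (x : ℝ) : |truncate n φ x| ≤ |φ x| := by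
  rw [truncate, abs_mul, abs_of_nonneg (Real.smoothTransition.nonneg _)]
  exact mul_le_of_le_one_left (abs_nonneg _) (Real.smoothTransition.le_one _)

theorem isTestFunction_truncate {φ : ℝ → ℝ} (hφ : IsTestFunction φ) (n : ℕ) :
    IsTestFunction (truncate n φ) where
  smooth := (Real.smoothTransition.contDiff.comp (by fun_prop)).mul hφ.smooth
  compactSupport := hφ.compactSupport.mul_left
  zero := truncate_of_le (by positivity)

theorem exists_tsupport_truncate_subset {φ : ℝ → ℝ} (hφ : IsTestFunction φ) (n : ℕ) :
    ∃ d, tsupport (truncate n φ) ⊆ Icc (1 / ((n : ℝ) + 1)) d := by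
  obtain ⟨d, hd⟩ := (isTestFunction_truncate hφ n).compactSupport.isCompact.bddAbove
  refine ⟨d, fun x hx => ⟨?_, hd hx⟩⟩
  refine closure_minimal (t := Ici (1 / ((n : ℝ) + 1))) (fun y hy => ?_) isClosed_Ici hx
  by_contra h
  exact hy (truncate_of_le (not_le.1 h).le)

theorem tendsto_truncate (φ : ℝ → ℝ) {x : ℝ} (hx : 0 < x) :
    Tendsto (fun n => truncate n φ x) atTop (𝓝 (φ x)) := by
  refine tendsto_const_nhds.congr' ?_
  have h := (tendsto_natCast_atTop_atTop (R := ℝ)).atTop_mul_const hx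
  filter_upwards [h.eventually_ge_atTop 2] with n hn
  rw [truncate_of_ge]
  rw [div_le_iff₀' (by positivity)]
  linarith

theorem IsTestFunction.contDiff_deriv {φ : ℝ → ℝ} (hφ : IsTestFunction φ) :
    ContDiff ℝ ∞ (deriv φ) := (contDiff_infty_iff_deriv.1 hφ.smooth).2

/-- A test function vanishes at `0`, hence is at most linear there. -/
theorem IsTestFunction.exists_abs_le_mul {φ : ℝ → ℝ} (hφ : IsTestFunction φ) :
    ∃ K, 0 ≤ K ∧ (∀ x, |deriv φ x| ≤ K) ∧ ∀ x, 0 ≤ x → |φ x| ≤ K * x := by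
  obtain ⟨K, hK⟩ := hφ.contDiff_deriv.continuous.bounded_above_of_compact_support
    hφ.compactSupport.deriv
  refine ⟨K, (norm_nonneg _).trans (hK 0), hK, fun x hx => ?_⟩
  have h := convex_univ.norm_image_sub_le_of_norm_deriv_le (f := φ) (x := 0) (y := x) (C := K)
    (fun y _ => (hφ.smooth.differentiable (by simp)).differentiableAt) (fun y _ => hK y)
    (mem_univ _) (mem_univ _)
  rwa [hφ.zero, sub_zero, sub_zero, Real.norm_eq_abs, Real.norm_of_nonneg hx] at h

theorem iteratedDeriv_truncate {φ : ℝ → ℝ} (hφ : IsTestFunction φ) (n : ℕ) (x : ℝ) :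
    iteratedDeriv 2 (truncate n φ) x =
      (n + 1) ^ 2 * deriv (deriv Real.smoothTransition) ((n + 1) * x - 1) * φ x +
        2 * (n + 1) * deriv Real.smoothTransition ((n + 1) * x - 1) * deriv φ x +
        Real.smoothTransition ((n + 1) * x - 1) * iteratedDeriv 2 φ x := by
  have hσ : ContDiff ℝ ∞ Real.smoothTransition := Real.smoothTransition.contDiff
  have hσ' : ContDiff ℝ ∞ (deriv Real.smoothTransition) := (contDiff_infty_iff_deriv.1 hσ).2
  have hl (y : ℝ) : HasDerivAt (fun x : ℝ => ((n : ℝ) + 1) * x - 1) ((n : ℝ) + 1) y := by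
    simpa using ((hasDerivAt_id y).const_mul ((n : ℝ) + 1)).sub_const 1
  have h0 (y : ℝ) := ((hσ.differentiable (by simp)) _).hasDerivAt.comp y (hl y)
  have h1 (y : ℝ) := ((hσ'.differentiable (by simp)) _).hasDerivAt.comp y (hl y)
  have p0 (y : ℝ) := ((hφ.smooth.differentiable (by simp)) y).hasDerivAt
  have p1 (y : ℝ) := ((hφ.contDiff_deriv.differentiable (by simp)) y).hasDerivAt
  have e1 : deriv (truncate n φ) = fun y =>
      deriv Real.smoothTransition ((n + 1) * y - 1) * (n + 1) * φ y +
        Real.smoothTransition ((n + 1) * y - 1) * deriv φ y :=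
    funext fun y => ((h0 y).mul (p0 y)).deriv
  rw [iteratedDeriv_two_eq, iteratedDeriv_two_eq, e1]
  refine ((((h1 x).mul_const ((n : ℝ) + 1)).mul (p0 x)).add ((h0 x).mul (p1 x))).deriv.trans ?_
  simp only [Function.comp_apply]
  ring

/-- Near `0` the second derivative of the truncation is of the order of `n` only, although that of
the cutoff is of the order of `n²`, since the test function is at most linear there. -/
theorem exists_abs_iteratedDeriv_truncate_sub_le {φ : ℝ → ℝ} (hφ : IsTestFunction φ) :
    ∃ C, 0 ≤ C ∧ ∀ n : ℕ, ∀ x, 0 < x → x ≤ 2 / ((n : ℝ) + 1) →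
      |iteratedDeriv 2 (truncate n φ) x - iteratedDeriv 2 φ x| ≤ C * (n + 1) := by
  have hσ : ContDiff ℝ ∞ Real.smoothTransition := Real.smoothTransition.contDiff
  have hσ' : ContDiff ℝ ∞ (deriv Real.smoothTransition) := (contDiff_infty_iff_deriv.1 hσ).2
  have hσ'' : ContDiff ℝ ∞ (deriv (deriv Real.smoothTransition)) :=
    (contDiff_infty_iff_deriv.1 hσ').2
  obtain ⟨A₁, hA₁⟩ := (isCompact_Icc (a := (-1 : ℝ)) (b := 1)).exists_bound_of_continuousOn
    hσ'.continuous.continuousOn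
  obtain ⟨A₂, hA₂⟩ := (isCompact_Icc (a := (-1 : ℝ)) (b := 1)).exists_bound_of_continuousOn
    hσ''.continuous.continuousOn
  have h0mem : (0 : ℝ) ∈ Icc (-1 : ℝ) 1 := by norm_num
  have hA₁0 := (norm_nonneg _).trans (hA₁ 0 h0mem)
  have hA₂0 := (norm_nonneg _).trans (hA₂ 0 h0mem)
  obtain ⟨K, hK0, hK1, hK⟩ := hφ.exists_abs_le_mul
  obtain ⟨K₂, hK₂⟩ := hφ.continuous_iteratedDeriv.bounded_above_of_compact_support
    hφ.hasCompactSupport_iteratedDeriv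
  have hK₂0 := (norm_nonneg _).trans (hK₂ 0)
  refine ⟨A₂ * (2 * K) + 2 * A₁ * K + K₂, by positivity, fun n x hx0 hx => ?_⟩
  have hx' : ((n : ℝ) + 1) * x ≤ 2 := by rwa [le_div_iff₀' (by positivity)] at hx
  have hy : ((n : ℝ) + 1) * x - 1 ∈ Icc (-1 : ℝ) 1 := by
    have : 0 < ((n : ℝ) + 1) * x := by positivity
    constructor <;> linarith
  set y := ((n : ℝ) + 1) * x - 1 with hy_def
  have hn : 1 ≤ (n : ℝ) + 1 := by linarith [(Nat.cast_nonneg n : (0 : ℝ) ≤ n)]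
  rw [iteratedDeriv_truncate hφ]
  have t1 : |((n : ℝ) + 1) ^ 2 * deriv (deriv Real.smoothTransition) y * φ x| ≤
      (A₂ * (2 * K)) * (n + 1) := by
    rw [abs_mul, abs_mul, abs_of_nonneg (by positivity : (0 : ℝ) ≤ ((n : ℝ) + 1) ^ 2)]
    calc _ ≤ ((n : ℝ) + 1) ^ 2 * A₂ * (K * x) := by
          gcongr
          · exact hA₂ y hy
          · exact hK x hx0.le
      _ = ((n : ℝ) + 1) * x * (A₂ * K * (n + 1)) := by ring
      _ ≤ 2 * (A₂ * K * (n + 1)) := by gcongr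
      _ = _ := by ring
  have t2 : |2 * ((n : ℝ) + 1) * deriv Real.smoothTransition y * deriv φ x| ≤
      (2 * A₁ * K) * (n + 1) := by
    rw [abs_mul, abs_mul, abs_of_nonneg (by positivity : (0 : ℝ) ≤ 2 * ((n : ℝ) + 1))]
    calc _ ≤ 2 * ((n : ℝ) + 1) * A₁ * K := by
          gcongr
          · exact hA₁ y hy
          · exact hK1 x
      _ = _ := by ring
  have t3 : |(1 - Real.smoothTransition y) * iteratedDeriv 2 φ x| ≤ K₂ * (n + 1) := by
    rw [abs_mul, abs_of_nonneg (by linarith [Real.smoothTransition.le_one y])]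
    calc _ ≤ 1 * K₂ := by
          gcongr
          · linarith [Real.smoothTransition.nonneg y]
          · exact hK₂ x
      _ ≤ K₂ * (n + 1) := by nlinarith
  rw [abs_le] at *
  constructor <;> nlinarith

theorem iteratedDeriv_truncate_of_gt {φ : ℝ → ℝ} {n : ℕ} {x : ℝ}
    (hx : 2 / ((n : ℝ) + 1) < x) : iteratedDeriv 2 (truncate n φ) x = iteratedDeriv 2 φ x := by
  have h : truncate n φ =ᶠ[𝓝 x] φ := by
    filter_upwards [lt_mem_nhds hx] with y hy using truncate_of_ge hy.le
  exact (h.iteratedDeriv 2).eq_of_nhds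

/-- A function vanishing on the boundary of the half-line is small near it, uniformly in time. -/
theorem exists_abs_extend_le (hT : 0 ≤ T) {z : CSpace r T}
    (hz : ∀ t ∈ Icc 0 T, extend hT z t 0 = 0) {e : ℝ} (he : 0 < e) :
    ∃ ρ > 0, ∀ t ∈ Icc 0 T, ∀ x ∈ Icc 0 ρ, |extend hT z t x| ≤ e := by
  have hopen : IsOpen {p : ℝ × ℝ | |extend hT z p.1 p.2| < e} :=
    isOpen_lt (continuous_extend hT z).abs continuous_const
  obtain ⟨u, w, -, hw, hu, h0, huw⟩ := generalized_tube_lemma (isCompact_Icc (a := 0) (b := T))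
    (isCompact_singleton (x := (0 : ℝ))) hopen (by
      rintro ⟨t, x⟩ ⟨ht, rfl : x = 0⟩
      rw [mem_ofPred_eq, hz t ht, abs_zero]
      exact he)
  obtain ⟨ρ, hρ, hball⟩ := Metric.isOpen_iff.1 hw 0 (h0 rfl)
  refine ⟨ρ / 2, half_pos hρ, fun t ht x hx => ?_⟩
  have h : (t, x) ∈ {p : ℝ × ℝ | |extend hT z p.1 p.2| < e} := huw ⟨hu ht, hball (by
    rw [Metric.mem_ball, Real.dist_eq, sub_zero, abs_of_nonneg hx.1]
    linarith [hx.2])⟩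
  exact le_of_lt h

/-- The integral of a product whose second factor is supported in `(0, b]`. -/
theorem abs_setIntegral_Ioi_le {f g : ℝ → ℝ} {b e A : ℝ} (hb : 0 ≤ b)
    (hf : ∀ x ∈ Icc 0 b, |f x| ≤ e) (hg : ∀ x, 0 < x → x ≤ b → |g x| ≤ A)
    (hg0 : ∀ x, b < x → g x = 0) : |∫ x in Ioi (0 : ℝ), f x * g x| ≤ e * A * b := by
  have he : 0 ≤ e := (abs_nonneg _).trans (hf 0 ⟨le_rfl, hb⟩)
  have h1 : ∫ x in Ioi (0 : ℝ), f x * g x = ∫ x in Ioc 0 b, f x * g x :=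
    (setIntegral_eq_of_subset_of_forall_sdiff_eq_zero measurableSet_Ioi Ioc_subset_Ioi_self
      fun x hx => by rw [hg0 x (not_le.1 fun h => hx.2 ⟨hx.1, h⟩), mul_zero])
  rw [h1, ← Real.norm_eq_abs]
  refine (norm_setIntegral_le_of_norm_le_const (C := e * A) measure_Ioc_lt_top
    fun x hx => ?_).trans ?_
  · rw [norm_mul]
    exact mul_le_mul (hf x ⟨hx.1.le, hx.2⟩) (hg x hx.1 hx.2) (norm_nonneg _) he
  · rw [Real.volume_real_Ioc_of_le hb, sub_zero]

/-- Truncation near the boundary does not change the mass in the limit, because the solution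
vanishes on the boundary. -/
theorem tendsto_weakMass_truncate (hT : 0 ≤ T) {z : CSpace r T}
    (hz : ∀ t ∈ Icc 0 T, extend hT z t 0 = 0) {φ : ℝ → ℝ} (hφ : IsTestFunction φ) {t : ℝ}
    (ht : t ∈ Icc 0 T) :
    Tendsto (fun n => weakMass hT z (truncate n φ) t) atTop (𝓝 (weakMass hT z φ t)) := by
  obtain ⟨C, hC0, hC⟩ := exists_abs_iteratedDeriv_truncate_sub_le hφ
  obtain ⟨K, hK⟩ := hφ.smooth.continuous.bounded_above_of_compact_support hφ.compactSupport
  have hK0 := (norm_nonneg _).trans (hK 0)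
  have hzc (s : ℝ) : Continuous (extend hT z s) :=
    (continuous_extend hT z).comp (by fun_prop : Continuous fun x : ℝ => (s, x))
  rw [Metric.tendsto_atTop]
  intro e he
  set e' := e / (4 * K + 2 * C * T + 1) with he'
  have hD : 0 < 4 * K + 2 * C * T + 1 := by positivity
  have he'0 : 0 < e' := by positivity
  obtain ⟨ρ, hρ, hzρ⟩ := exists_abs_extend_le hT hz he'0
  obtain ⟨N, hN⟩ := exists_nat_gt (2 / ρ)
  refine ⟨N, fun n hn => ?_⟩
  have hn1 : 1 ≤ (n : ℝ) + 1 := by linarith [(Nat.cast_nonneg n : (0 : ℝ) ≤ n)]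
  have hnρ : 2 / ((n : ℝ) + 1) ≤ ρ := by
    have h1 : (N : ℝ) ≤ n := by exact_mod_cast hn
    rw [div_lt_iff₀ hρ] at hN
    rw [div_le_iff₀ (by positivity)]
    nlinarith
  have hsmall (s : ℝ) (hs : s ∈ Icc 0 T) :
      ∀ x ∈ Icc 0 (2 / ((n : ℝ) + 1)), |extend hT z s x| ≤ e' :=
    fun x hx => hzρ s hs x ⟨hx.1, hx.2.trans hnρ⟩
  have hψ := isTestFunction_truncate hφ n
  have i1 {ψ : ℝ → ℝ} (hψ : IsTestFunction ψ) (s : ℝ) :=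
    integrableOn_mul_of_continuous (hzc s) hψ.smooth.continuous hψ.compactSupport (Ioi 0)
  have i2 {ψ : ℝ → ℝ} (hψ : IsTestFunction ψ) (s : ℝ) :=
    integrableOn_mul_of_continuous (hzc s) hψ.continuous_iteratedDeriv
      hψ.hasCompactSupport_iteratedDeriv (Ioi 0)
  have i3 {ψ : ℝ → ℝ} (hψ : IsTestFunction ψ) :=
    (continuous_setIntegral_mul (continuous_extend hT z) hψ.continuous_iteratedDeriv
      hψ.hasCompactSupport_iteratedDeriv).intervalIntegrable (μ := volume) 0 t
  have d1 : |∫ x in Ioi (0 : ℝ), extend hT z t x * (truncate n φ x - φ x)| ≤ 4 * K * e' := by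
    refine (abs_setIntegral_Ioi_le (A := 2 * K) (by positivity) (hsmall t ht)
      (fun x _ _ => ?_) fun x hx => ?_).trans ?_
    · have h1 := abs_truncate_le n φ x
      have h2 : |φ x| ≤ K := hK x
      exact (abs_sub _ _).trans (by linarith)
    · rw [truncate_of_ge hx.le, sub_self]
    · have : 2 / ((n : ℝ) + 1) ≤ 2 := div_le_self zero_le_two hn1
      have := mul_le_mul_of_nonneg_left this (by positivity : 0 ≤ e' * (2 * K))
      linarith
  have d2 (s : ℝ) (hs : s ∈ Icc 0 T) : |∫ x in Ioi (0 : ℝ),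
      extend hT z s x * (iteratedDeriv 2 (truncate n φ) x - iteratedDeriv 2 φ x)| ≤ 2 * C * e' := by
    refine (abs_setIntegral_Ioi_le (A := C * (n + 1)) (by positivity) (hsmall s hs)
      (hC n) fun x hx => ?_).trans ?_
    · rw [iteratedDeriv_truncate_of_gt hx, sub_self]
    · exact le_of_eq (by field_simp)
  have d3 : |∫ s in (0 : ℝ)..t, ∫ x in Ioi (0 : ℝ),
      extend hT z s x * (iteratedDeriv 2 (truncate n φ) x - iteratedDeriv 2 φ x)| ≤
        2 * C * e' * T := by
    rw [← Real.norm_eq_abs]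
    refine (intervalIntegral.norm_integral_le_of_norm_le_const (C := 2 * C * e')
      fun s hs => ?_).trans ?_
    · rw [uIoc_of_le ht.1] at hs
      exact d2 s ⟨hs.1.le, hs.2.trans ht.2⟩
    · rw [sub_zero, abs_of_nonneg ht.1]
      exact mul_le_mul_of_nonneg_left ht.2 (by positivity)
  have hdiff : weakMass hT z (truncate n φ) t - weakMass hT z φ t =
      (∫ x in Ioi (0 : ℝ), extend hT z t x * (truncate n φ x - φ x)) -
        ∫ s in (0 : ℝ)..t, ∫ x in Ioi (0 : ℝ),
          extend hT z s x * (iteratedDeriv 2 (truncate n φ) x - iteratedDeriv 2 φ x) := by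
    simp only [mul_sub]
    rw [integral_sub (i1 hψ t) (i1 hφ t)]
    simp only [fun s => integral_sub (i2 hψ s) (i2 hφ s)]
    rw [intervalIntegral.integral_sub (i3 hψ) (i3 hφ)]
    unfold weakMass
    ring
  rw [Real.dist_eq, hdiff]
  refine (abs_sub _ _).trans_lt ((add_le_add d1 d3).trans_lt ?_)
  have : e = e' * (4 * K + 2 * C * T + 1) := (div_mul_cancel₀ _ hD.ne').symm
  rw [this]
  linarith

theorem weakMass_add_const_mul (hT : 0 ≤ T) (z : CSpace r T) {φ ψ : ℝ → ℝ} (hφ : IsTestFunction φ)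
    (hψ : IsTestFunction ψ) (K t : ℝ) :
    weakMass hT z (fun x => φ x + K * ψ x) t = weakMass hT z φ t + K * weakMass hT z ψ t := by
  have hzc (s : ℝ) : Continuous (extend hT z s) :=
    (continuous_extend hT z).comp (by fun_prop : Continuous fun x : ℝ => (s, x))
  have i1 {ψ : ℝ → ℝ} (hψ : IsTestFunction ψ) (s : ℝ) :=
    integrableOn_mul_of_continuous (hzc s) hψ.smooth.continuous hψ.compactSupport (Ioi 0)
  have i2 {ψ : ℝ → ℝ} (hψ : IsTestFunction ψ) (s : ℝ) :=
    integrableOn_mul_of_continuous (hzc s) hψ.continuous_iteratedDeriv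
      hψ.hasCompactSupport_iteratedDeriv (Ioi 0)
  have i3 {ψ : ℝ → ℝ} (hψ : IsTestFunction ψ) :=
    (continuous_setIntegral_mul (continuous_extend hT z) hψ.continuous_iteratedDeriv
      hψ.hasCompactSupport_iteratedDeriv).intervalIntegrable (μ := volume) 0 t
  have e (x : ℝ) : iteratedDeriv 2 (fun x => φ x + K * ψ x) x =
      iteratedDeriv 2 φ x + K * iteratedDeriv 2 ψ x := by
    have h2 : ((2 : ℕ) : WithTop ℕ∞) ≤ ∞ := WithTop.coe_le_coe.2 le_top
    have hφ2 : ContDiffAt ℝ (2 : ℕ) φ x := (hφ.smooth.of_le h2).contDiffAt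
    have hψ2 : ContDiffAt ℝ (2 : ℕ) ψ x := (hψ.smooth.of_le h2).contDiffAt
    rw [← iteratedDeriv_const_mul K hψ2]
    exact iteratedDeriv_add hφ2 (contDiffAt_const.mul hψ2)
  unfold weakMass
  simp only [e, mul_add, mul_left_comm _ K]
  rw [integral_add (i1 hφ t) ((i1 hψ t).const_mul K), integral_const_mul]
  simp only [integral_add (i2 hφ _) ((i2 hψ _).const_mul K), integral_const_mul]
  rw [intervalIntegral.integral_add (i3 hφ) ((i3 hψ).const_mul K),
    intervalIntegral.integral_const_mul]
  ring

/-- The weak equation for all test functions supported away from `0`: such a test function is a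
difference of nonnegative ones. -/
theorem setIntegral_eq_weakMass_of_tsupport (hT : 0 ≤ T) {z : CSpace r T}
    {η : Measure (ReflDomain T)} [IsFiniteMeasureOnCompacts η] {t : Icc (0 : ℝ) T}
    (hw : ∀ φ : ℝ → ℝ, IsTestFunction φ → (∀ x, 0 ≤ φ x) → ∀ c d, 0 < c → tsupport φ ⊆ Icc c d →
      ∫ p in {p : ReflDomain T | p.2 ≤ t}, φ p.1 ∂η = weakMass hT z φ t)
    {φ : ℝ → ℝ} (hφ : IsTestFunction φ) {c d : ℝ} (hc : 0 < c) (hs : tsupport φ ⊆ Icc c d) :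
    ∫ p in {p : ReflDomain T | p.2 ≤ t}, φ p.1 ∂η = weakMass hT z φ t := by
  obtain ⟨K, hK⟩ := hφ.smooth.continuous.bounded_above_of_compact_support hφ.compactSupport
  have hK0 := (norm_nonneg _).trans (hK 0)
  set ψ := cutoff (2 / c) 1 (c / 2) d with hψ_def
  have hψ : IsTestFunction ψ := isTestFunction_cutoff (by positivity) le_rfl (by positivity)
  have hψs : tsupport ψ ⊆ Icc (c / 2) (d + 1) := tsupport_cutoff_subset (by positivity) le_rfl
  have hsum : IsTestFunction fun x => φ x + K * ψ x :=
    ⟨hφ.smooth.add (contDiff_const.mul hψ.smooth),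
      hφ.compactSupport.add (hψ.compactSupport.mul_left (f := fun _ => K)),
      by rw [hφ.zero, hψ.zero]; simp⟩
  have hφz (x : ℝ) (hx : x ∉ Icc c d) : φ x = 0 :=
    image_eq_zero_of_notMem_tsupport fun h => hx (hs h)
  have hsum0 (x : ℝ) : 0 ≤ φ x + K * ψ x := by
    by_cases hx : x ∈ Icc c d
    · have h1 : ψ x = 1 := by
        refine cutoff_eq_one ?_ zero_le_one hx.2
        rw [div_mul_eq_mul_div, le_div_iff₀ hc]
        linarith [hx.1]
      have h2 : |φ x| ≤ K := hK x
      rw [h1]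
      linarith [(abs_le.1 h2).1]
    · rw [hφz x hx, zero_add]
      exact mul_nonneg hK0 (cutoff_nonneg _ _ _ _ _)
  have hsums : tsupport (fun x => φ x + K * ψ x) ⊆ Icc (c / 2) (d + 1) := by
    refine closure_minimal (fun x hx => ?_) isClosed_Icc
    by_contra h
    have h1 : ψ x = 0 := image_eq_zero_of_notMem_tsupport fun h' => h (hψs h')
    have h2 : φ x = 0 := hφz x fun h' => h ⟨by linarith [h'.1], by linarith [h'.2]⟩
    exact hx (show φ x + K * ψ x = 0 by rw [h1, h2]; simp)
  have e1 := hw _ hsum hsum0 _ _ (half_pos hc) hsums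
  have e2 := hw ψ hψ (cutoff_nonneg _ _ _ _) _ _ (half_pos hc) hψs
  rw [weakMass_add_const_mul hT z hφ hψ, ← e2, integral_add
    (integrable_of_tsupport_subset hφ.smooth.continuous hc hs).integrableOn
    ((integrable_of_tsupport_subset hψ.smooth.continuous (half_pos hc) hψs).const_mul
      K).integrableOn, integral_const_mul] at e1
  linarith

theorem isTestFunction_mul_cutoff (d : ℝ) : IsTestFunction fun x => x * cutoff 1 1 (-1) d x where
  smooth := contDiff_id.mul (contDiff_cutoff _ _ _ _)
  compactSupport := HasCompactSupport.mul_left (f := fun x : ℝ => x)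
    (isCompact_Icc.of_isClosed_subset (isClosed_tsupport _)
      (tsupport_cutoff_subset zero_le_one le_rfl))
  zero := zero_mul _

/-- Test functions are integrable. They are dominated by a multiple of a nonnegative one, whose
truncations near `0` have bounded integrals. -/
theorem integrable_of_weak (hT : 0 ≤ T) {z : CSpace r T} (hz : ∀ t ∈ Icc 0 T, extend hT z t 0 = 0)
    {η : Measure (ReflDomain T)} [IsFiniteMeasureOnCompacts η]
    (hw : ∀ φ : ℝ → ℝ, IsTestFunction φ → (∀ x, 0 ≤ φ x) → ∀ c d, 0 < c → tsupport φ ⊆ Icc c d →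
      ∀ t : Icc (0 : ℝ) T, ∫ p in {p : ReflDomain T | p.2 ≤ t}, φ p.1 ∂η = weakMass hT z φ t)
    {φ : ℝ → ℝ} (hφ : IsTestFunction φ) : Integrable (fun p : ReflDomain T => φ p.1) η := by
  obtain ⟨K, hK0, -, hK⟩ := hφ.exists_abs_le_mul
  obtain ⟨d, hd⟩ := hφ.compactSupport.isCompact.bddAbove
  set ψ : ℝ → ℝ := fun x => x * cutoff 1 1 (-1) d x with hψ_def
  have hψ : IsTestFunction ψ := isTestFunction_mul_cutoff d
  have hψ0 (n : ℕ) (x : ℝ) : 0 ≤ truncate n ψ x := by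
    rcases le_total x 0 with hx | hx
    · exact (truncate_of_le (hx.trans (by positivity))).ge
    · exact mul_nonneg (Real.smoothTransition.nonneg _) (mul_nonneg hx (cutoff_nonneg _ _ _ _ _))
  have hdom (p : ReflDomain T) : ‖φ p.1‖ ≤ K * ψ p.1 := by
    have hp : (0 : ℝ) < p.1 := p.1.2
    by_cases h : (p.1 : ℝ) ≤ d
    · simp only [hψ_def]
      rw [cutoff_eq_one (by linarith) zero_le_one h, mul_one]
      exact hK _ hp.le
    · rw [image_eq_zero_of_notMem_tsupport (f := φ) fun h' => h (hd h'), norm_zero]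
      exact mul_nonneg hK0 (mul_nonneg hp.le (cutoff_nonneg _ _ _ _ _))
  have hi (n : ℕ) : Integrable (fun p : ReflDomain T => truncate n ψ p.1) η := by
    obtain ⟨d', hd'⟩ := exists_tsupport_truncate_subset hψ n
    exact integrable_of_tsupport_subset (isTestFunction_truncate hψ n).smooth.continuous
      (by positivity) hd'
  have htop : {p : ReflDomain T | p.2 ≤ (⟨T, hT, le_rfl⟩ : Icc (0 : ℝ) T)} = univ :=
    eq_univ_of_forall fun p => p.2.2.2
  have hval (n : ℕ) : ∫⁻ p : ReflDomain T, ‖truncate n ψ p.1‖ₑ ∂η =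
      ENNReal.ofReal (weakMass hT z (truncate n ψ) T) := by
    obtain ⟨d', hd'⟩ := exists_tsupport_truncate_subset hψ n
    have h := hw _ (isTestFunction_truncate hψ n) (hψ0 n) _ d' (by positivity) hd' ⟨T, hT, le_rfl⟩
    rw [htop, setIntegral_univ] at h
    change _ = weakMass hT z (truncate n ψ) T at h
    rw [← h, ofReal_integral_eq_lintegral_ofReal (hi n) (Eventually.of_forall fun p => hψ0 n _)]
    refine lintegral_congr fun p => ?_
    rw [Real.enorm_of_nonneg (hψ0 n _)]
  have hψi : Integrable (fun p : ReflDomain T => ψ p.1) η := by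
    refine ⟨(hψ.smooth.continuous.comp (by fun_prop)).aestronglyMeasurable, ?_⟩
    have hfatou := lintegral_liminf_le' (μ := η) (fun n => (hi n).1.aemeasurable.enorm) (u := atTop)
    have hptw (p : ReflDomain T) : liminf (fun n => ‖truncate n ψ p.1‖ₑ) atTop = ‖ψ p.1‖ₑ :=
      (tendsto_truncate ψ p.1.2).enorm.liminf_eq
    have hlim := ((ENNReal.continuous_ofReal.tendsto _).comp
      (tendsto_weakMass_truncate hT hz hψ ⟨hT, le_rfl⟩)).liminf_eq
    simp only [hptw, hval] at hfatou
    exact hfatou.trans_lt ((le_of_eq hlim).trans_lt ENNReal.ofReal_lt_top)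
  exact (hψi.const_mul K).mono' (hφ.smooth.continuous.comp (by fun_prop)).aestronglyMeasurable
    (Eventually.of_forall hdom)

/-- The weak equation for all test functions, by truncation near `0`. -/
theorem setIntegral_eq_weakMass (hT : 0 ≤ T) {z : CSpace r T}
    (hz : ∀ t ∈ Icc 0 T, extend hT z t 0 = 0)
    {η : Measure (ReflDomain T)} [IsFiniteMeasureOnCompacts η]
    (hw : ∀ φ : ℝ → ℝ, IsTestFunction φ → (∀ x, 0 ≤ φ x) → ∀ c d, 0 < c → tsupport φ ⊆ Icc c d →
      ∀ t : Icc (0 : ℝ) T, ∫ p in {p : ReflDomain T | p.2 ≤ t}, φ p.1 ∂η = weakMass hT z φ t)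
    {φ : ℝ → ℝ} (hφ : IsTestFunction φ) (t : Icc (0 : ℝ) T) :
    ∫ p in {p : ReflDomain T | p.2 ≤ t}, φ p.1 ∂η = weakMass hT z φ t := by
  have h1 (n : ℕ) : ∫ p in {p : ReflDomain T | p.2 ≤ t}, truncate n φ p.1 ∂η =
      weakMass hT z (truncate n φ) t := by
    obtain ⟨d, hd⟩ := exists_tsupport_truncate_subset hφ n
    exact setIntegral_eq_weakMass_of_tsupport hT
      (fun φ h h0 c d hc hs => hw φ h h0 c d hc hs t) (isTestFunction_truncate hφ n)
      (by positivity) hd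
  have h2 : Tendsto (fun n => ∫ p in {p : ReflDomain T | p.2 ≤ t}, truncate n φ p.1 ∂η) atTop
      (𝓝 (∫ p in {p : ReflDomain T | p.2 ≤ t}, φ p.1 ∂η)) := by
    refine tendsto_integral_of_dominated_convergence (fun p => ‖φ p.1‖) (fun n => ?_)
      (integrable_of_weak hT hz hw hφ).norm.integrableOn (fun n => ?_) ?_
    · exact ((isTestFunction_truncate hφ n).smooth.continuous.comp
        (by fun_prop)).aestronglyMeasurable
    · exact Eventually.of_forall fun p => abs_truncate_le n φ p.1
    · exact Eventually.of_forall fun p => tendsto_truncate φ p.1.2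
  simp only [h1] at h2
  exact tendsto_nhds_unique h2 (tendsto_weakMass_truncate hT hz hφ t.2)

/-! ### Existence -/

theorem exists_isSolution (hT : 0 ≤ T) {v : CSpace r T} (hv : IsObstacle v) :
    ∃ (z : CSpace r T) (η : Measure (ReflDomain T)), IsSolution v z η := by
  obtain ⟨z, hz, hz0, hzi, hvz⟩ := exists_limit hT hv
  obtain ⟨η, _, hη⟩ := exists_limit_measure hT hv hz
  have hw (φ : ℝ → ℝ) (hφ : IsTestFunction φ) (hφ0 : ∀ x, 0 ≤ φ x) (c d : ℝ) (hc : 0 < c)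
      (hs : tsupport φ ⊆ Icc c d) (t : Icc (0 : ℝ) T) :
      ∫ p in {p : ReflDomain T | p.2 ≤ t}, φ p.1 ∂η = weakMass hT z φ t :=
    setIntegral_eq_weakMass_of_nonneg hT hv hz hη hφ hφ0 hc hs t
  have hge (p : Domain T) : v.1 p ≤ z.1 p := by
    rw [← extend_coe hT v, ← extend_coe hT z]
    exact hvz _ p.1.2 _ p.2.2
  have hcont : Continuous (ReflDomain.toDomain (T := T)) := by
    unfold ReflDomain.toDomain
    fun_prop
  set g : C(ReflDomain T, ℝ) := ⟨fun p => z.1 p.toDomain - v.1 p.toDomain,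
    (z.1.continuous.comp hcont).sub (v.1.continuous.comp hcont)⟩ with hg_def
  have hg (p : ReflDomain T) : g p = z.1 p.toDomain - v.1 p.toDomain := rfl
  have hg0 (p : ReflDomain T) : 0 ≤ g p := sub_nonneg.2 (hge _)
  have hgz : ∀ᵐ p ∂η, g p = 0 := by
    have hn (n : ℕ) : ∀ᵐ p ∂η, (p.1 : ℝ) ∈ Icc (1 / ((n : ℝ) + 1)) (n + 1) → g p = 0 := by
      set c : ℝ := 1 / ((n : ℝ) + 1) with hc_def
      have hc : 0 < c := by positivity
      have hψ : IsTestFunction (cutoff (2 / c) 1 (c / 2) (n + 1)) :=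
        isTestFunction_cutoff (by positivity) le_rfl (by positivity)
      have hψs : tsupport (cutoff (2 / c) 1 (c / 2) (n + 1)) ⊆ Icc (c / 2) ((n + 1) + 1) :=
        tsupport_cutoff_subset (by positivity) le_rfl
      set f := mulCc hψ.smooth.continuous (half_pos hc) hψs g with hf_def
      have hf0 : 0 ≤ (f : ReflDomain T → ℝ) := fun p =>
        mul_nonneg (cutoff_nonneg _ _ _ _ _) (hg0 p)
      have hfi : Integrable f η := f.continuous.integrable_of_hasCompactSupport f.hasCompactSupport
      have hle := integral_mul_gap_nonpos hT hv hz hη hψ (cutoff_nonneg _ _ _ _)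
        (half_pos hc) hψs hg
      have hae := (integral_eq_zero_iff_of_nonneg hf0 hfi).1 (hle.antisymm (integral_nonneg hf0))
      filter_upwards [hae] with p hp hpc
      have h1 : cutoff (2 / c) 1 (c / 2) (n + 1) p.1 = 1 := by
        refine cutoff_eq_one ?_ zero_le_one hpc.2
        rw [div_mul_eq_mul_div, le_div_iff₀ hc]
        linarith [hpc.1]
      have h2 : cutoff (2 / c) 1 (c / 2) (n + 1) p.1 * g p = 0 := hp
      rwa [h1, one_mul] at h2
    filter_upwards [ae_all_iff.2 hn] with p hp
    obtain ⟨n, hn1, hn2⟩ := exists_between_pos p.1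
    exact hp n ⟨hn1.le, hn2⟩
  refine ⟨z, η, ?_, ?_, hge, fun φ hφ => integrable_of_weak hT hz0 hw hφ, fun t φ hφ => ?_,
    fun t => ?_⟩
  · intro t x hx
    rw [← extend_coe hT z (t, x)]
    change extend hT z t x = 0
    rw [hx]
    exact hz0 t t.2
  · intro t x ht
    rw [← extend_coe hT z (t, x)]
    change extend hT z t x = 0
    rw [ht]
    exact hzi x x.2
  · rw [weak_iff_extend hT, setIntegral_eq_weakMass hT hz0 hw hφ t, weakMass]
    ring
  · rw [lintegral_eq_zero_iff' (by exact (g.continuous.measurable.ennreal_ofReal).aemeasurable)]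
    refine ae_restrict_of_ae ?_
    filter_upwards [hgz] with p hp
    rw [← hg, hp, ENNReal.ofReal_zero]
    rfl

end ObstacleProblem

theorem mainTheorem5 (r T : ℝ) (hT : 0 < T) :
    (∀ v : ObstacleProblem.CSpace r T, ObstacleProblem.IsObstacle v →
      ∃! zη : ObstacleProblem.CSpace r T × MeasureTheory.Measure (ObstacleProblem.ReflDomain T),
        ObstacleProblem.IsSolution v zη.1 zη.2) ∧
    ∃ C : ℝ, ∀ (v₁ v₂ z₁ z₂ : ObstacleProblem.CSpace r T)
      (η₁ η₂ : MeasureTheory.Measure (ObstacleProblem.ReflDomain T)),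
      ObstacleProblem.IsObstacle v₁ → ObstacleProblem.IsObstacle v₂ →
      ObstacleProblem.IsSolution v₁ z₁ η₁ → ObstacleProblem.IsSolution v₂ z₂ η₂ →
      ObstacleProblem.growthNorm (z₁ - z₂) ≤ C * ObstacleProblem.growthNorm (v₁ - v₂) := by
  refine ⟨fun v hv => ?_, Real.exp (r ^ 2 * T), fun v₁ v₂ z₁ z₂ η₁ η₂ _ _ h₁ h₂ =>
    h₁.growthNorm_sub_le hT.le h₂⟩
  obtain ⟨z, η, h⟩ := ObstacleProblem.exists_isSolution hT.le hv
  refine ⟨(z, η), h, ?_⟩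
  rintro ⟨z', η'⟩ h'
  obtain rfl : z' = z := h'.eq_of_same_obstacle hT.le h
  obtain rfl : η' = η := h'.measure_unique hT.le h
  rfl
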